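/- **Conventions.** All algebras are associative and unital, and subalgebras contain the unit. Let $\mathbb{P}$ be the set of prime numbers and $F$ a field. Denote by $s(F)$ the class of finite-dimensional central simple $F$-algebras and by $d(F)$ its subclass of division algebras; the degree of $A \in s(F)$ is $\sqrt{[A\colon F]}$. For $A \in s(F)$, $\mathrm{ind}(A)$ is the degree of the underlying central division algebra of $A$, and $\exp(A)$ is the order of the class of $A$ in the Brauer group $\mathrm{Br}(F)$. For $p \in \mathbb{P}$, $\mathrm{Brd}_p(F)$ is the least integer $n \ge 0$ such that $\mathrm{ind}(A)$ divides $\exp(A)^n$ for every $A \in s(F)$ whose class lies in the $p$-component of $\mathrm{Br}(F)$, and $\mathrm{Brd}_p(F) = \infty$ if no such $n$ exists. The field $F$ is *Brauer finite-dimensional* if there are integers $m_p$, $p \in \mathbb{P}$, with $\mathrm{Brd}_p(F') \le m_p$ for every finite extension $F'/F$ and every $p \in \mathbb{P}$. An $F$-algebra $A$ is *locally finite-dimensional* (LFD) if each finite subset of $A$ generates a finite-dimensional $F$-subalgebra, and *normally locally finite* (NLF) if each finite subset of $A$ is contained in a finite-dimensional central $F$-subalgebra of $A$. A tensor product of an infinite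 family of $F$-algebras is the direct limit of the tensor products over $F$ of its finite subfamilies. **Theorem.** Let $F$ be a Brauer finite-dimensional field and $R$ a central division LFD-algebra over $F$. Then $R$ is an NLF-algebra, and there exist integers $k(p) \ge 0$, $p \in \mathbb{P}$, and a central $F$-subalgebra $\widetilde R$ of $R$ with the following properties: (a) $\widetilde R$ is $F$-isomorphic to $\bigotimes_{p \in \mathbb{P}} R_p$, where $\otimes = \otimes_F$ and, for each $p \in \mathbb{P}$, $R_p \in d(F)$ is an $F$-subalgebra of $R$ of degree $p^{k(p)}$; (b) every finite-dimensional $F$-subalgebra of $R$ embeds in $\widetilde R$ as an $F$-algebra; (c) for each $p \in \mathbb{P}$, $k(p)$ is the maximal integer for which there exists $\rho_p \in R$ with $p^{k(p)} \mid [F(\rho_p)\colon F]$; moreover, $\rho_p$ can be chosen to be separable over $F$; (d) the centralizer $C_R(\widetilde R) = \{c \in R : c\tilde r = \tilde r c \text{ for all } \tilde r \in \widetilde R\}$ equals $F$. Furthermore, if $[R\colon F]$ is countably infinite, then $R$ and $\widetilde R$ are isomorphic $F$-algebras. -/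

import Mathlib

open scoped TensorProduct

universe u v w

namespace Koethe

section LocallyFinite

variable (F : Type u) [Field F] (A : Type v) [Ring A] [Algebra F A]

/-- `A` is locally finite-dimensional (LFD) over `F`: every finite subset of `A` generates a
finite-dimensional `F`-subalgebra. -/
def IsLFD : Prop :=
  ∀ Y : Finset A, FiniteDimensional F (Algebra.adjoin F (Y : Set A))

/-- `A` is normally locally finite (NLF) over `F`: every finite subset of `A` lies in a
finite-dimensional central `F`-subalgebra of `A`. -/
def IsNLF : Prop :=
  ∀ Y : Finset A, ∃ Θ : Subalgebra F A,
    (Y : Set A) ⊆ Θ ∧ FiniteDimensional F Θ ∧ Algebra.IsCentral F Θ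

/-- `A` belongs to `d(F)`: it is a finite-dimensional central division algebra over `F`. -/
structure IsFDCentralDivision : Prop where
  finiteDimensional : FiniteDimensional F A
  isCentral : Algebra.IsCentral F A
  nontrivial : Nontrivial A
  isUnit_of_ne_zero : ∀ a : A, a ≠ 0 → IsUnit a

end LocallyFinite

section BrauerDimension

/-- The Schur index of a finite-dimensional central simple `F`-algebra `A`: the degree `d` of its
underlying division algebra `D`, where `A ≃ Mₙ(D)` and `[D : F] = d ^ 2`. -/
noncomputable def schurIndex (F : Type u) [Field F] (A : Type v) [Ring A] [Algebra F A] : ℕ :=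
  sInf {d : ℕ | ∃ (D : Type v) (_ : DivisionRing D) (_ : Algebra F D) (n : ℕ),
    n ≠ 0 ∧ Nonempty (A ≃ₐ[F] Matrix (Fin n) (Fin n) D) ∧ Module.finrank F D = d ^ 2}

/-- The exponent of a finite-dimensional central simple `F`-algebra `A`, i.e. the order of its
class in the Brauer group of `F`: the least `n > 0` such that the `n`-fold tensor power of `A`
over `F` is isomorphic to a matrix algebra over `F`. -/
noncomputable def exponent (F : Type u) [Field F] (A : Type v) [Ring A] [Algebra F A] : ℕ :=
  sInf {n : ℕ | 0 < n ∧
    ∃ m : ℕ, 0 < m ∧ Nonempty ((⨂[F] _ : Fin n, A) ≃ₐ[F] Matrix (Fin m) (Fin m) F)}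

/-- The Brauer `p`-dimension of `E`: the least `n` such that `ind(A)` divides `exp(A) ^ n` for all
finite-dimensional central simple `E`-algebras `A` whose Brauer class lies in the `p`-component
of the Brauer group (that is, whose exponent is a power of `p`), and `⊤` if there is none. -/
noncomputable def brauerPDim (p : ℕ) (E : Type u) [Field E] : ℕ∞ :=
  sInf {N : ℕ∞ | ∃ n : ℕ, N = n ∧
    ∀ (A : Type u) [Ring A] [Algebra E A] [Algebra.IsCentral E A] [IsSimpleRing A]
      [FiniteDimensional E A],
      (∃ r : ℕ, exponent E A = p ^ r) → schurIndex E A ∣ exponent E A ^ n}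

/-- `E` is Brauer finite-dimensional: for every prime `p`, the Brauer `p`-dimensions of the finite
extensions of `E` are bounded by an integer depending only on `p` (and `E`). -/
def IsBrauerFiniteDimensional (E : Type u) [Field E] : Prop :=
  ∃ m : Nat.Primes → ℕ, ∀ (E' : Type u) [Field E'] [Algebra E E'] [FiniteDimensional E E']
    (p : Nat.Primes), brauerPDim (p : ℕ) E' ≤ (m p : ℕ∞)

end BrauerDimension

/-! ### The tensor product of an arbitrary family of algebras

It is the direct limit of the tensor products of the finite subfamilies, along the maps which
fill up a pure tensor by ones. -/

section TensorProduct

variable {ι : Type w} {A : ι → Type v} [∀ i, Ring (A i)]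

open Classical in
/-- Extend a family indexed by a finite set `S` to one indexed by `T` by adding ones. -/
noncomputable def extendOne (S T : Finset ι) (x : ∀ i : S, A i) : ∀ i : T, A i :=
  fun t => if h : (t : ι) ∈ S then x ⟨t, h⟩ else 1

lemma extendOne_update {S T : Finset ι} (h : S ⊆ T) [DecidableEq S] [DecidableEq T]
    (x : ∀ i : S, A i) (i : S) (a : A i) :
    extendOne S T (Function.update x i a) =
      Function.update (extendOne S T x) ⟨i, h i.2⟩ a := by
  funext t
  by_cases ht : t = ⟨i, h i.2⟩
  · subst ht
    simp [extendOne]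
  · rw [Function.update_of_ne ht]
    unfold extendOne
    split_ifs with hS
    · rw [Function.update_of_ne]
      intro hc
      exact ht (Subtype.ext (congrArg (fun s : S => (s : ι)) hc))
    · rfl

lemma extendOne_one (S T : Finset ι) : extendOne S T (1 : ∀ i : S, A i) = 1 := by
  funext t
  simp [extendOne]

lemma extendOne_mul (S T : Finset ι) (x y : ∀ i : S, A i) :
    extendOne S T (x * y) = extendOne S T x * extendOne S T y := by
  funext t
  by_cases h : (t : ι) ∈ S <;> simp [extendOne, h]

lemma extendOne_self (S : Finset ι) (x : ∀ i : S, A i) : extendOne S S x = x := by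
  funext t
  simp [extendOne]

lemma extendOne_extendOne {S T U : Finset ι} (h : S ⊆ T) (x : ∀ i : S, A i) :
    extendOne T U (extendOne S T x) = extendOne S U x := by
  funext t
  by_cases hS : (t : ι) ∈ S
  · simp [extendOne, hS, h hS]
  · simp [extendOne, hS]

variable (F : Type u) [Field F] (A) [∀ i, Algebra F (A i)]

/-- The algebra homomorphism `⨂_{i ∈ S} A i → ⨂_{i ∈ T} A i`, for finite sets `S ⊆ T`, which maps
`⨂ xᵢ` to the pure tensor with the same components at `i ∈ S` and the component `1` at
`i ∈ T \ S`. -/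
noncomputable def transition (S T : Finset ι) (h : S ≤ T) :
    (⨂[F] i : S, A i) →ₐ[F] (⨂[F] i : T, A i) :=
  PiTensorProduct.liftAlgHom
    { toFun := fun x => PiTensorProduct.tprod F (extendOne S T x)
      map_update_add' := by
        classical
        intro _ x i a b
        simp only [extendOne_update h, MultilinearMap.map_update_add]
      map_update_smul' := by
        classical
        intro _ x i c a
        simp only [extendOne_update h, MultilinearMap.map_update_smul] }
    (by
      change PiTensorProduct.tprod F (extendOne S T 1) = 1
      rw [extendOne_one]
      rfl)
    (fun x y => by
      change PiTensorProduct.tprod F (extendOne S T (x * y)) =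
        PiTensorProduct.tprod F (extendOne S T x) * PiTensorProduct.tprod F (extendOne S T y)
      rw [extendOne_mul, PiTensorProduct.tprod_mul_tprod])

lemma transition_tprod (S T : Finset ι) (h : S ≤ T) (x : ∀ i : S, A i) :
    transition A F S T h (PiTensorProduct.tprod F x) =
      PiTensorProduct.tprod F (extendOne S T x) := by
  simp [transition]

instance directedSystem_transition :
    DirectedSystem (fun S : Finset ι => ⨂[F] i : S, A i)
      (fun S T h => (transition A F S T h : (⨂[F] i : S, A i) → ⨂[F] i : T, A i)) where
  map_self S x := by
    induction x using PiTensorProduct.induction_on with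
    | smul_tprod r f => simp [transition_tprod, extendOne_self]
    | add x y hx hy => rw [map_add, hx, hy]
  map_map U T S hUT hTS x := by
    induction x using PiTensorProduct.induction_on with
    | smul_tprod r f =>
      simp only [map_smul, transition_tprod]
      rw [extendOne_extendOne hUT]
    | add x y hx hy => simp only [map_add, hx, hy]

/-- The tensor product `⨂_{i ∈ ι} A i` over `F` of a possibly infinite family of unital
`F`-algebras: the direct limit of the algebras `⨂_{i ∈ S} A i`, over the finite subsets `S`
of `ι`. -/
abbrev AlgTensor : Type _ :=
  DirectLimit (fun S : Finset ι => ⨂[F] i : S, A i) (transition A F)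

end TensorProduct

end Koethe

/-! Write v_p for the exponent of a prime p in a dimension over F. The heart of the matter is that
v_p([S : F]) is bounded as S runs through the finite-dimensional subalgebras of R. Consider a flag:
commuting subalgebras S_1, ..., S_n with a common center Z and with p dividing every [S_j : Z]. They
generate a copy of their tensor product over Z inside the centralizer of Z, which has no zero
divisors. Z is then extended step by step, by extensions of degree prime to p and of degree p, so
that the p-part of the index of the product drops no more than the factors force it to, until all
factors have degree p. The product then has index p^n and exponent dividing p, so n is at most the
bound for the Brauer p-dimensions (`PDiv.card_le`, `IsFlag.le`).

A flag of maximal length exhausts, up to a factor prime to p, every large subalgebra S over its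
center; hence v_p([S : F]) exceeds v_p([Z(S) : F]) by at most a constant
(`exists_padicValNat_le_add`). As R is central, each S is linearly disjoint from the centers of all
sufficiently large subalgebras (`exists_finset_finrank_sup_cen`), and this removes the contribution
of the center. So v_p has a maximum; it is an even number 2k(p), and all large S attain it and have
a center of degree prime to p (`exists_max_padicValNat`).

Next, R contains a central division algebra of degree p^k(p) over F. Take a large S with center L
and a larger S' whose center L' is linearly disjoint from S; applying the bound to the
characteristic makes L and L' separable. The dimensions show that S and S' have the same p-primary
Brauer class over the compositum of L and L'. A class over L' with this stability comes, [L : F] and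
[L' : F] being prime to p, from F by corestriction. The argument is carried out with 2-cocycles and
projective semilinear representations (`exists_stable_cocycle`, `exists_central_algHom`). That the
resulting algebra embeds in S' follows from a dimension count for a bimodule
(`exists_algHom_of_coprime`), which also replaces primary decomposition elsewhere.

Coprimality makes it possible to choose components R_p for different p commuting with each other.
Every finite-dimensional S embeds in the product of those R_p with p dividing [S : F], because the
exponents are already maximal. The Skolem-Noether theorem for finite-dimensional simple algebras
mapping to R (`exists_conj_of_algHom`) then moves this product so that it contains S; this is normal
local finiteness. An element c that commutes with all R_p has degree 1, as a prime divisor p of its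
degree would make v_p of the algebra generated by R_p and c too large. If R has countable dimension,
the R_p are chosen along a basis, so that each basis vector is absorbed (`exists_system`). -/

namespace Koethe

/-! ### Density for central simple algebras; simplicity of tensor products -/

section Density

variable {K : Type*} [Field K] {A : Type*} [Ring A] [Algebra K A]

/-- In a central simple algebra, every linear map agrees on a finite set with a map of the form
`x ↦ ∑ l, u l * x * v l`. -/
theorem exists_sum_mul_mul_eq [IsSimpleRing A] [Algebra.IsCentral K A] (f : A →ₗ[K] A)
    (s : Finset A) : ∃ (n : ℕ) (u v : Fin n → A), ∀ m ∈ s, f m = ∑ l, u l * m * v l := by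
  let φ : A ⊗[K] Aᵐᵒᵖ →ₐ[K] Module.End K A := AlgHom.mulLeftRight K A
  let _ : Module (A ⊗[K] Aᵐᵒᵖ) A := Module.compHom A φ.toRingHom
  have hsmul : ∀ (r : A ⊗[K] Aᵐᵒᵖ) (x : A), r • x = φ r x := fun r x => rfl
  have htm : ∀ (a b x : A), (a ⊗ₜ[K] MulOpposite.op b) • x = a * x * b := by
    intro a b x
    rw [hsmul]
    simp [φ]
  -- The submodules of `A` over its enveloping algebra are the two-sided ideals.
  have : IsSimpleModule (A ⊗[K] Aᵐᵒᵖ) A := by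
    rw [isSimpleModule_iff_toSpanSingleton_surjective]
    refine ⟨inferInstance, fun x hx => ?_⟩
    let I : TwoSidedIdeal A := .mk' {y | y ∈ Submodule.span (A ⊗[K] Aᵐᵒᵖ) {x}}
      (Submodule.span (A ⊗[K] Aᵐᵒᵖ) {x}).zero_mem
      (fun {y z} h h' => (Submodule.span (A ⊗[K] Aᵐᵒᵖ) {x}).add_mem h h')
      (fun {y} h => (Submodule.span (A ⊗[K] Aᵐᵒᵖ) {x}).neg_mem h)
      (fun {a y} h => by
        have := Submodule.smul_mem (Submodule.span (A ⊗[K] Aᵐᵒᵖ) {x})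
          (a ⊗ₜ[K] MulOpposite.op (1 : A)) h
        rw [htm] at this
        simpa using this)
      (fun {y a} h => by
        have := Submodule.smul_mem (Submodule.span (A ⊗[K] Aᵐᵒᵖ) {x})
          ((1 : A) ⊗ₜ[K] MulOpposite.op a) h
        rw [htm] at this
        simpa using this)
    have h1 : (1 : A) ∈ I := IsSimpleRing.one_mem_of_ne_zero_mem I hx (by
      rw [TwoSidedIdeal.mem_mk']
      exact Submodule.mem_span_singleton_self x)
    intro y
    have h2 : y ∈ I := by simpa using I.mul_mem_left y _ h1
    rw [TwoSidedIdeal.mem_mk'] at h2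
    obtain ⟨r, hr⟩ := Submodule.mem_span_singleton.1 h2
    exact ⟨r, hr⟩
  have key : ∀ g : Module.End (A ⊗[K] Aᵐᵒᵖ) A, ∃ c : K, ∀ x, g x = c • x := by
    intro g
    have hl : ∀ a x : A, g (a * x) = a * g x := by
      intro a x
      have := g.map_smul (a ⊗ₜ[K] MulOpposite.op 1) x
      rw [htm, htm] at this; simpa using this
    have hr : ∀ a x : A, g (x * a) = g x * a := by
      intro a x
      have := g.map_smul (1 ⊗ₜ[K] MulOpposite.op a) x
      rw [htm, htm] at this; simpa using this
    have hc : g 1 ∈ Subalgebra.center K A := by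
      rw [Subalgebra.mem_center_iff]
      intro b
      rw [← hl, ← hr]; simp
    rw [Algebra.IsCentral.center_eq_bot, Algebra.mem_bot] at hc
    obtain ⟨c, hc⟩ := hc
    refine ⟨c, fun x => ?_⟩
    have := hr x 1
    rw [one_mul, ← hc] at this
    rw [this, Algebra.smul_def]
  -- By `key` the endomorphism ring of the simple module consists of scalars, so every `K`-linear
  -- map is eligible for the density theorem.
  let f' : Module.End (Module.End (A ⊗[K] Aᵐᵒᵖ) A) A :=
    { toFun := f
      map_add' := f.map_add
      map_smul' := by
        intro g x
        obtain ⟨c, hc⟩ := key g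
        simp only [Module.End.smul_def, hc, RingHom.id_apply]
        rw [f.map_smul] }
  obtain ⟨r, hr⟩ := jacobson_density f' s
  have hex : ∀ r : A ⊗[K] Aᵐᵒᵖ, ∃ (n : ℕ) (u v : Fin n → A), ∀ m, r • m = ∑ l, u l * m * v l := by
    intro r
    induction r using TensorProduct.induction_on with
    | zero => exact ⟨0, Fin.elim0, Fin.elim0, fun m => by simp [hsmul]⟩
    | tmul a b => exact ⟨1, fun _ => a, fun _ => b.unop, fun m => by simpa using htm a b.unop m⟩
    | add x y hx hy =>
      obtain ⟨n, u, v, h⟩ := hx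
      obtain ⟨n', u', v', h'⟩ := hy
      refine ⟨n + n', Fin.append u u', Fin.append v v', fun m => ?_⟩
      rw [add_smul, h, h', Fin.sum_univ_add]
      simp
  obtain ⟨n, u, v, h⟩ := hex r
  exact ⟨n, u, v, fun m hm => (hr m hm).trans (h m)⟩

/-- In a finite-dimensional central simple algebra, every linear map has the form
`x ↦ ∑ l, u l * x * v l`. -/
theorem exists_sum_mul_mul_eq_of_finite [IsSimpleRing A] [Algebra.IsCentral K A]
    [FiniteDimensional K A] (f : A →ₗ[K] A) :
    ∃ (n : ℕ) (u v : Fin n → A), ∀ m, f m = ∑ l, u l * m * v l := by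
  classical
  obtain ⟨n, u, v, h⟩ := exists_sum_mul_mul_eq f
    (Finset.univ.image (Module.finBasis K A))
  refine ⟨n, u, v, fun m => ?_⟩
  let g : A →ₗ[K] A := ∑ l, (LinearMap.mulLeft K (u l)) ∘ₗ (LinearMap.mulRight K (v l))
  have hg : ∀ m, g m = ∑ l, u l * m * v l := fun m => by
    simp [g, LinearMap.sum_apply, mul_assoc]
  have : f = g := (Module.finBasis K A).ext fun i => by
    rw [hg]; exact h _ (by simp)
  rw [this, hg]

variable {B : Type*} [Ring B] [Algebra K B]

/-- Expand a nonzero element of an ideal in a basis of `A`. By density some `x ↦ ∑ u l * x * v l`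
sends one of the basis vectors that occur to 1 and the others to 0, so the ideal contains `1 ⊗ c i₀`
with `c i₀ ≠ 0`, and hence 1 by simplicity of `B`. -/
instance isSimpleRing_tensorProduct [IsSimpleRing A] [Algebra.IsCentral K A] [IsSimpleRing B] :
    IsSimpleRing (A ⊗[K] B) := by
  classical
  have : Nontrivial (A ⊗[K] B) := inferInstance
  refine IsSimpleRing.of_eq_bot_or_eq_top fun I => ?_
  by_contra! hI
  obtain ⟨x, hx, hx0⟩ : ∃ x ∈ I, x ≠ 0 := by
    by_contra! h
    apply hI.1
    rw [eq_bot_iff]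
    intro x hx
    simpa using h x hx
  let b := Module.Basis.ofVectorSpace K A
  obtain ⟨c, hc⟩ : ∃ c : (Module.Basis.ofVectorSpaceIndex K A) →₀ B,
      x = c.sum fun i m => b i ⊗ₜ[K] m := TensorProduct.eq_repr_basis_left b x |>.imp
        fun _ h => h.symm
  obtain ⟨i₀, hi₀⟩ : ∃ i, c i ≠ 0 := by
    by_contra! h
    exact hx0 (by rw [hc, show c = 0 from Finsupp.ext h]; simp)
  let f : A →ₗ[K] A := (b.coord i₀).smulRight 1
  obtain ⟨n, u, v, huv⟩ := exists_sum_mul_mul_eq f (c.support.image b)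
  have h1 : (1 : A) ⊗ₜ[K] c i₀ ∈ I := by
    have h2 : ∑ l, (u l ⊗ₜ[K] (1 : B)) * x * (v l ⊗ₜ[K] (1 : B)) ∈ I :=
      I.finsetSum_mem _ _ fun l _ => I.mul_mem_right _ _ (I.mul_mem_left _ _ hx)
    convert h2 using 1
    calc (1 : A) ⊗ₜ[K] c i₀ = c.sum fun i m => (f (b i)) ⊗ₜ[K] m := by
          rw [Finsupp.sum, Finset.sum_eq_single i₀]
          · simp [f]
          · intro i _ hi
            simp [f, hi]
          · intro h
            simp [Finsupp.notMem_support_iff.1 h]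
      _ = _ := by
          rw [hc]
          simp only [Finsupp.sum, Finset.mul_sum, Finset.sum_mul]
          rw [Finset.sum_comm]
          refine Finset.sum_congr rfl fun i hi => ?_
          rw [huv (b i) (Finset.mem_image_of_mem _ hi), TensorProduct.sum_tmul]
          simp
  let J : TwoSidedIdeal B := I.comap (Algebra.TensorProduct.includeRight : B →ₐ[K] A ⊗[K] B)
  have hJ : (1 : B) ∈ J := IsSimpleRing.one_mem_of_ne_zero_mem J hi₀ (by
    rw [TwoSidedIdeal.mem_comap]; exact h1)
  rw [TwoSidedIdeal.mem_comap] at hJ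
  apply hI.2
  rw [← I.one_mem_iff]
  rw [Algebra.TensorProduct.one_def]
  exact hJ

/-- The centralizer of `1 ⊗ B` is `C ⊗ Z(B)`, and `Z(B)` consists of scalars. -/
theorem exists_tmul_one_eq_of_commute {C : Type*} [CommRing C] [Algebra K C]
    [Algebra.IsCentral K B] (x : C ⊗[K] B) (hx : ∀ b : B, Commute x (1 ⊗ₜ b)) :
    ∃ c : C, x = c ⊗ₜ 1 := by
  have h1 : x ∈ Subalgebra.centralizer K
      ((Algebra.TensorProduct.map (Algebra.ofId K C) (AlgHom.id K B)).range : Set (C ⊗[K] B)) := by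
    rw [Subalgebra.mem_centralizer_iff]
    rintro _ ⟨g, rfl⟩
    induction g using TensorProduct.induction_on with
    | zero => simp
    | tmul r b =>
      have : (Algebra.TensorProduct.map (Algebra.ofId K C) (AlgHom.id K B)) (r ⊗ₜ b) =
          r • ((1 : C) ⊗ₜ[K] b) := by
        simp [Algebra.ofId_apply, TensorProduct.smul_tmul', Algebra.algebraMap_eq_smul_one]
      change (Algebra.TensorProduct.map (Algebra.ofId K C) (AlgHom.id K B)) (r ⊗ₜ b) * x =
        x * (Algebra.TensorProduct.map (Algebra.ofId K C) (AlgHom.id K B)) (r ⊗ₜ b)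
      rw [this, smul_mul_assoc, mul_smul_comm, (hx b).eq]
    | add y z hy hz =>
      simp only [map_add, add_mul, mul_add] at *
      rw [hy, hz]
  rw [Subalgebra.centralizer_tensorProduct_eq_center_tensorProduct_right] at h1
  obtain ⟨y, rfl⟩ := h1
  clear hx
  induction y using TensorProduct.induction_on with
  | zero => exact ⟨0, by simp⟩
  | tmul c b =>
    obtain ⟨b, hb⟩ := b
    rw [Algebra.IsCentral.center_eq_bot, Algebra.mem_bot] at hb
    obtain ⟨r, rfl⟩ := hb
    refine ⟨r • c, ?_⟩
    simp [Algebra.algebraMap_eq_smul_one, TensorProduct.smul_tmul]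
  | add y z hy hz =>
    obtain ⟨c, hc⟩ := hy
    obtain ⟨d, hd⟩ := hz
    exact ⟨c + d, by rw [map_add, hc, hd, TensorProduct.add_tmul]⟩

instance isCentral_baseChange {E : Type*} [Field E] [Algebra K E] [Algebra.IsCentral K B] :
    Algebra.IsCentral E (E ⊗[K] B) where
  out := by
    intro x hx
    obtain ⟨c, rfl⟩ := exists_tmul_one_eq_of_commute x fun b =>
      (Subalgebra.mem_center_iff.1 hx _).symm
    exact Algebra.mem_bot.2 ⟨c, rfl⟩

instance isSimpleRing_baseChange {E : Type*} [Field E] [Algebra K E] [IsSimpleRing B]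
    [Algebra.IsCentral K B] : IsSimpleRing (E ⊗[K] B) :=
  IsSimpleRing.of_ringEquiv (Algebra.TensorProduct.comm K B E).toRingEquiv inferInstance

end Density

/-! ### Finite tensor products of central simple algebras -/

section Pi

variable {F : Type*} [Field F] {ι : Type*} [Fintype ι] {A : ι → Type*} [∀ i, Ring (A i)]
  [∀ i, Algebra F (A i)] {C : Type*} [Ring C] [Algebra F C]

/-- The product of pairwise commuting homomorphisms, as a monoid homomorphism. -/
noncomputable def piMonoidHom (φ : ∀ i, A i →ₐ[F] C)
    (hφ : Pairwise fun i j => ∀ x y, Commute (φ i x) (φ j y)) : (∀ i, A i) →* C :=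
  MonoidHom.noncommPiCoprod (fun i => (φ i : A i →* C)) (fun _ _ h x y => hφ h x y)

theorem piMonoidHom_mulSingle [DecidableEq ι] (φ : ∀ i, A i →ₐ[F] C)
    (hφ : Pairwise fun i j => ∀ x y, Commute (φ i x) (φ j y)) (i : ι) (x : A i) :
    piMonoidHom φ hφ (Pi.mulSingle i x) = φ i x :=
  MonoidHom.noncommPiCoprod_mulSingle _ _ _

theorem piMonoidHom_update [DecidableEq ι] (φ : ∀ i, A i →ₐ[F] C)
    (hφ : Pairwise fun i j => ∀ x y, Commute (φ i x) (φ j y)) (m : ∀ i, A i) (i : ι) (x : A i) :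
    piMonoidHom φ hφ (Function.update m i x) =
      piMonoidHom φ hφ (Function.update m i 1) * φ i x := by
  rw [← piMonoidHom_mulSingle φ hφ, ← map_mul]
  congr 1
  funext j
  by_cases hj : j = i
  · subst hj; simp
  · simp [hj]

/-- The homomorphism `⨂ A i → C` defined by pairwise commuting homomorphisms `A i → C`. -/
noncomputable def piLift (φ : ∀ i, A i →ₐ[F] C)
    (hφ : Pairwise fun i j => ∀ x y, Commute (φ i x) (φ j y)) : (⨂[F] i, A i) →ₐ[F] C :=
  PiTensorProduct.liftAlgHom
    { toFun := piMonoidHom φ hφ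
      map_update_add' := by
        intro _ m i x y
        rw [piMonoidHom_update, piMonoidHom_update φ hφ m i x, piMonoidHom_update φ hφ m i y,
          map_add, mul_add]
      map_update_smul' := by
        intro _ m i c x
        rw [piMonoidHom_update, piMonoidHom_update φ hφ m i x, map_smul, mul_smul_comm] }
    (map_one (piMonoidHom φ hφ)) (map_mul (piMonoidHom φ hφ))

theorem piLift_tprod (φ : ∀ i, A i →ₐ[F] C)
    (hφ : Pairwise fun i j => ∀ x y, Commute (φ i x) (φ j y)) (x : ∀ i, A i) :
    piLift φ hφ (PiTensorProduct.tprod F x) = piMonoidHom φ hφ x := by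
  simp [piLift]

theorem piLift_single [DecidableEq ι] (φ : ∀ i, A i →ₐ[F] C)
    (hφ : Pairwise fun i j => ∀ x y, Commute (φ i x) (φ j y)) (i : ι) (x : A i) :
    piLift φ hφ (PiTensorProduct.singleAlgHom i x) = φ i x := by
  rw [PiTensorProduct.singleAlgHom_apply, piLift_tprod]
  exact piMonoidHom_mulSingle _ _ _ _

theorem piLift_commute (φ : ∀ i, A i →ₐ[F] C)
    (hφ : Pairwise fun i j => ∀ x y, Commute (φ i x) (φ j y)) (c : C)
    (hc : ∀ i x, Commute c (φ i x)) (x : ⨂[F] i, A i) : Commute c (piLift φ hφ x) := by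
  induction x using PiTensorProduct.induction_on with
  | smul_tprod r f =>
    rw [map_smul, piLift_tprod]
    exact (MonoidHom.commute_noncommPiCoprod (fun i => (φ i : A i →* C)) hc f).smul_right r
  | add x y hx hy => rw [map_add]; exact hx.add_right hy

-- An endomorphism of one tensor factor is thus expressed by multiplications; it preserves two-sided
-- ideals, and its effect on central elements is computable.
omit [Fintype ι] in
theorem map_update_eq_sum [DecidableEq ι] (i : ι) (f : A i →ₗ[F] A i) {n : ℕ} (u v : Fin n → A i)
    (h : ∀ a, f a = ∑ l, u l * a * v l) (x : ⨂[F] i, A i) :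
    PiTensorProduct.map (Function.update (fun _ => LinearMap.id) i f) x =
      ∑ l, PiTensorProduct.singleAlgHom (R := F) i (u l) * x *
        PiTensorProduct.singleAlgHom (R := F) i (v l) := by
  induction x using PiTensorProduct.induction_on with
  | smul_tprod r a =>
    rw [map_smul, PiTensorProduct.map_tprod]
    have h1 : (fun j => (Function.update (fun _ => LinearMap.id) i f : ∀ j, A j →ₗ[F] A j) j (a j))
        = Function.update a i (∑ l, u l * a i * v l) := by
      funext j
      by_cases hj : j = i
      · subst hj; simp [h]
      · simp [hj]
    rw [h1, MultilinearMap.map_update_sum, Finset.smul_sum]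
    refine Finset.sum_congr rfl fun l _ => ?_
    rw [PiTensorProduct.singleAlgHom_apply, PiTensorProduct.singleAlgHom_apply,
      mul_smul_comm, smul_mul_assoc, PiTensorProduct.tprod_mul_tprod,
      PiTensorProduct.tprod_mul_tprod]
    congr 2
    funext j
    by_cases hj : j = i
    · subst hj; simp
    · simp [hj]
  | add x y hx hy => simp only [map_add, hx, hy, mul_add, add_mul, Finset.sum_add_distrib]

theorem map_finset_induction [DecidableEq ι] (f : ∀ i, A i →ₗ[F] A i)
    (P : (⨂[F] i, A i) → Prop)
    (hP : ∀ i x, P x → P (PiTensorProduct.map (Function.update (fun _ => LinearMap.id) i (f i)) x))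
    (x : ⨂[F] i, A i) (hx : P x) : P (PiTensorProduct.map f x) := by
  have : ∀ s : Finset ι, P (PiTensorProduct.map
      (fun i => if i ∈ s then f i else LinearMap.id) x) := by
    intro s
    induction s using Finset.induction_on with
    | empty => simpa [PiTensorProduct.map_id] using hx
    | insert i s hi ih =>
      have h := hP i _ ih
      rw [← LinearMap.comp_apply, ← PiTensorProduct.map_comp] at h
      convert h using 3
      funext j
      by_cases hj : j = i
      · subst hj; simp [hi]
      · simp [hj]
  simpa using this Finset.univ

variable [∀ i, IsSimpleRing (A i)] [∀ i, Algebra.IsCentral F (A i)]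
  [∀ i, FiniteDimensional F (A i)]

/-- A coordinate functional of each factor, with values viewed as scalars of that factor, is a sum
of two-sided multiplications. Applied in all factors, such maps keep an ideal stable and, for a
suitable choice of coordinates, turn a nonzero element into a nonzero scalar. -/
instance isSimpleRing_piTensorProduct : IsSimpleRing (⨂[F] i, A i) := by
  classical
  let pb := Basis.piTensorProduct (fun i => Module.finBasis F (A i))
  have hnt : Nontrivial (⨂[F] i, A i) := by
    have : Nonempty (∀ i, Fin (Module.finrank F (A i))) :=
      ⟨fun i => ⟨0, Module.finrank_pos⟩⟩
    exact pb.repr.toEquiv.nontrivial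
  refine IsSimpleRing.of_eq_bot_or_eq_top fun I => ?_
  by_contra! hI
  obtain ⟨x, hx, hx0⟩ : ∃ x ∈ I, x ≠ 0 := by
    by_contra! h
    apply hI.1
    rw [eq_bot_iff]
    intro x hx
    simpa using h x hx
  obtain ⟨p, hp⟩ : ∃ p, pb.repr x p ≠ 0 := by
    by_contra! h
    exact hx0 (pb.repr.map_eq_zero_iff.1 (Finsupp.ext h))
  let f : ∀ i, A i →ₗ[F] A i := fun i => ((Module.finBasis F (A i)).coord (p i)).smulRight 1
  have h1 : PiTensorProduct.map f x ∈ I := by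
    refine map_finset_induction f (· ∈ I) (fun i x hx => ?_) x hx
    obtain ⟨n, u, v, huv⟩ := exists_sum_mul_mul_eq_of_finite (f i)
    rw [map_update_eq_sum i (f i) u v huv]
    exact I.finsetSum_mem _ _ fun l _ => I.mul_mem_right _ _ (I.mul_mem_left _ _ hx)
  have h2 : ∀ y, PiTensorProduct.map f y = pb.repr y p • (1 : ⨂[F] i, A i) := by
    intro y
    induction y using PiTensorProduct.induction_on with
    | smul_tprod r a =>
      rw [map_smul, PiTensorProduct.map_tprod, map_smul, Finsupp.smul_apply,
        Basis.piTensorProduct_repr_tprod_apply, smul_assoc]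
      congr 1
      have : (fun i => f i (a i)) =
          fun i => ((Module.finBasis F (A i)).repr (a i) (p i)) • (1 : A i) := by
        funext i; simp [f]
      rw [this, MultilinearMap.map_smul_univ]
      rfl
    | add y z hy hz => simp only [map_add, hy, hz, Finsupp.add_apply, add_smul]
  rw [h2] at h1
  apply hI.2
  rw [← I.one_mem_iff]
  have := I.mul_mem_left (algebraMap F _ (pb.repr x p)⁻¹) _ h1
  rwa [Algebra.algebraMap_eq_smul_one, smul_mul_smul_comm, inv_mul_cancel₀ hp, one_smul,
    one_mul] at this

/-- A functional with value 1 at 1 yields a map `∑ u l * x * v l` with `∑ u l * v l = 1`; such maps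
fix central elements, yet applied in all factors they take values in the scalars. -/
instance isCentral_piTensorProduct : Algebra.IsCentral F (⨂[F] i, A i) where
  out := by
    classical
    intro x hx
    rw [Subalgebra.mem_center_iff] at hx
    have hg : ∀ i, ∃ g : A i →ₗ[F] F, g 1 = 1 := fun i =>
      Module.Projective.exists_dual_eq_one F (one_ne_zero (α := A i))
    choose g hg using hg
    let f : ∀ i, A i →ₗ[F] A i := fun i => (g i).smulRight 1
    have h1 : PiTensorProduct.map f x = x := by
      refine map_finset_induction f (· = x) (fun i y hy => ?_) x rfl
      subst hy
      obtain ⟨n, u, v, huv⟩ := exists_sum_mul_mul_eq_of_finite (f i)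
      rw [map_update_eq_sum i (f i) u v huv]
      have h2 : ∑ l, u l * v l = 1 := by
        have := huv 1
        simpa [f, hg] using this.symm
      simp_rw [hx, mul_assoc, ← map_mul, ← Finset.mul_sum, ← map_sum, h2, map_one, mul_one]
    rw [← h1]
    clear hx h1
    induction x using PiTensorProduct.induction_on with
    | smul_tprod r a =>
      rw [map_smul, PiTensorProduct.map_tprod]
      have : (fun i => f i (a i)) = fun i => (g i (a i)) • (1 : A i) := by
        funext i; simp [f]
      rw [this, MultilinearMap.map_smul_univ]
      exact Subalgebra.smul_mem _ (Subalgebra.smul_mem _ (Subalgebra.one_mem _) _) _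
    | add y z hy hz => rw [map_add]; exact Subalgebra.add_mem _ hy hz

omit [∀ i, IsSimpleRing (A i)] [∀ i, Algebra.IsCentral F (A i)] in
theorem finrank_piTensorProduct :
    Module.finrank F (⨂[F] i, A i) = ∏ i, Module.finrank F (A i) := by
  classical
  rw [Module.finrank_eq_card_basis (Basis.piTensorProduct (fun i => Module.finBasis F (A i)))]
  simp

end Pi

/-! ### Finite-dimensional subalgebras of a division algebra -/

section SubalgebraInv

variable {F R : Type*} [Field F] [DivisionRing R] [Algebra F R]

theorem inv_mem_of_finiteDimensional (A : Subalgebra F R) [FiniteDimensional F A] {x : R}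
    (hx : x ∈ A) : x⁻¹ ∈ A := by
  by_cases h0 : x = 0
  · simp [h0]
  obtain ⟨y, hy⟩ := FiniteDimensional.exists_mul_eq_one F (K := A) (x := ⟨x, hx⟩)
    (fun h => h0 (congrArg Subtype.val h))
  have hy' : x * y = 1 := congrArg Subtype.val hy
  rw [inv_eq_of_mul_eq_one_right hy']
  exact y.2

/-- A finite-dimensional subalgebra of a division algebra is a division algebra. -/
noncomputable abbrev divisionRingSubalgebra (B : Subalgebra F R) [FiniteDimensional F B] :
    DivisionRing B :=
  { B.toRing with
    inv := fun x => ⟨(x : R)⁻¹, inv_mem_of_finiteDimensional B x.2⟩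
    mul_inv_cancel := fun x hx => Subtype.ext (mul_inv_cancel₀ fun h => hx (Subtype.ext h))
    inv_zero := Subtype.ext inv_zero
    exists_pair_ne := ⟨0, 1, zero_ne_one⟩
    nnqsmul := _
    nnqsmul_def := fun _ _ => rfl
    qsmul := _
    qsmul_def := fun _ _ => rfl }

/-- A commutative finite-dimensional subalgebra of a division algebra is a field. -/
noncomputable abbrev fieldSubalgebra (B : Subalgebra F R) [FiniteDimensional F B]
    (h : ∀ x ∈ B, ∀ y ∈ B, x * y = y * x) : Field B :=
  { divisionRingSubalgebra B with
    mul_comm := fun x y => Subtype.ext (h x x.2 y y.2) }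

end SubalgebraInv

/-! ### Modules over simple Artinian rings and the bimodule criterion -/

section SimpleModules

theorem nonempty_linearEquiv_of_isSimpleModule {A : Type*} [Ring A] [IsSimpleRing A]
    [IsArtinianRing A] (M N : Type*) [AddCommGroup M] [Module A M] [IsSimpleModule A M]
    [AddCommGroup N] [Module A N] [IsSimpleModule A N] : Nonempty (M ≃ₗ[A] N) := by
  obtain ⟨I, ⟨e⟩⟩ := IsSemisimpleRing.exists_linearEquiv_ideal_of_isSimpleModule A M
  obtain ⟨J, ⟨f⟩⟩ := IsSemisimpleRing.exists_linearEquiv_ideal_of_isSimpleModule A N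
  have : IsSimpleModule A I := IsSimpleModule.congr e.symm
  have : IsSimpleModule A J := IsSimpleModule.congr f.symm
  obtain ⟨g⟩ := IsSimpleRing.isIsotypic A A I J
  exact ⟨(e.trans g.symm).trans f.symm⟩

theorem exists_linearEquiv_fun {A : Type*} [Ring A] [IsSimpleRing A]
    [IsArtinianRing A] (I : Type*) [AddCommGroup I] [Module A I] [IsSimpleModule A I]
    (M : Type*) [AddCommGroup M] [Module A M] [Module.Finite A M] :
    ∃ n : ℕ, Nonempty (M ≃ₗ[A] (Fin n → I)) := by
  have : IsIsotypicOfType A M I := fun m _ => nonempty_linearEquiv_of_isSimpleModule m I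
  exact this.linearEquiv_fun

theorem exists_isSimpleModule_ideal (A : Type*) [Ring A] [IsSimpleRing A] [IsArtinianRing A] :
    ∃ I : Ideal A, IsSimpleModule A I := by
  obtain ⟨n, hn, I, hI, _⟩ := IsSimpleRing.exists_ringEquiv_matrix_end_mulOpposite A
  exact ⟨I, hI⟩

variable {F : Type*} [Field F]

theorem isArtinianRing_of_finiteDimensional (F : Type*) [Field F] (A : Type*) [Ring A]
    [Algebra F A] [FiniteDimensional F A] : IsArtinianRing A :=
  isArtinian_of_tower F inferInstance

theorem finrank_dvd_of_algHom {D : Type*} [DivisionRing D] [Algebra F D]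
    {M : Type*} [AddCommGroup M] [Module F M] (φ : D →ₐ[F] Module.End F M) :
    Module.finrank F D ∣ Module.finrank F M := by
  let _ : Module D M := Module.compHom M φ.toRingHom
  have : IsScalarTower F D M := ⟨fun c d m => by
    change φ (c • d) m = c • φ d m
    rw [map_smul]; rfl⟩
  exact ⟨_, (Module.finrank_mul_finrank F D M).symm⟩

/-- The structure of an algebra module defined by a representation. -/
abbrev moduleOfRep {A V : Type*} [Ring A] [Algebra F A] [AddCommGroup V] [Module F V]
    (φ : A →ₐ[F] Module.End F V) : Module A V := Module.compHom V φ.toRingHom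

theorem isScalarTower_moduleOfRep {A V : Type*} [Ring A] [Algebra F A] [AddCommGroup V]
    [Module F V] (φ : A →ₐ[F] Module.End F V) :
    @IsScalarTower F A V _ (moduleOfRep φ).toSMul _ :=
  let _ := moduleOfRep φ
  ⟨fun c d m => by
    change φ (c • d) m = c • φ d m
    rw [map_smul]; rfl⟩

/-- Here `A` plays the role of `B ⊗ Cᵐᵒᵖ` and `d` that of the dimension of `B`. The simple
`A`-module has dimension `w` over `C`, and `w` divides both `m` and `d` because `M` and `A` are
multiples of it. So `w = 1`: the simple module is `C` as a right `C`-space, and `B` acts on it by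
left multiplications. -/
theorem exists_algHom_of_coprime_aux {A B C : Type*} [Ring A] [Algebra F A] [FiniteDimensional F A]
    [IsSimpleRing A] [Ring B] [Algebra F B]
    [DivisionRing C] [Algebra F C] [FiniteDimensional F C]
    (b₀ : B →ₐ[F] A) (c₀ : Cᵐᵒᵖ →ₐ[F] A) (hcomm : ∀ b c, Commute (b₀ b) (c₀ c)) (d : ℕ)
    (hA : Module.finrank F A = d * Module.finrank F C)
    {M : Type*} [AddCommGroup M] [Module F M] [FiniteDimensional F M]
    (φ : A →ₐ[F] Module.End F M) (m : ℕ)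
    (hm : Module.finrank F M = m * Module.finrank F C)
    (hcop : Nat.Coprime m d) : Nonempty (B →ₐ[F] C) := by
  have : IsArtinianRing A := isArtinianRing_of_finiteDimensional F A
  let _ : Module A M := moduleOfRep φ
  have : IsScalarTower F A M := isScalarTower_moduleOfRep φ
  have : Module.Finite A M := Module.Finite.of_restrictScalars_finite F A M
  obtain ⟨I, hI⟩ := exists_isSimpleModule_ideal A
  obtain ⟨k, ⟨e⟩⟩ := exists_linearEquiv_fun (A := A) I M
  obtain ⟨l, ⟨f⟩⟩ := exists_linearEquiv_fun (A := A) I A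
  let ψ : A →ₐ[F] Module.End F I := Algebra.lsmul F F I
  let γ' : Cᵐᵒᵖ →ₐ[F] Module.End F I := ψ.comp c₀
  let β' : B →ₐ[F] Module.End F I := ψ.comp b₀
  have hc' : ∀ b c, Commute (β' b) (γ' c) := fun b c => (hcomm b c).map ψ
  have hfinI : FiniteDimensional F I := inferInstance
  obtain ⟨w, hw⟩ := finrank_dvd_of_algHom γ'
  have hop : Module.finrank F Cᵐᵒᵖ = Module.finrank F C :=
    (MulOpposite.opLinearEquiv F : C ≃ₗ[F] Cᵐᵒᵖ).finrank_eq.symm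
  have hCpos : 0 < Module.finrank F C := Module.finrank_pos
  have h1 : m = k * w := by
    have h := (e.restrictScalars F).finrank_eq
    rw [Module.finrank_pi_fintype, hm] at h
    simp only [Finset.sum_const, Finset.card_univ, Fintype.card_fin, smul_eq_mul] at h
    rw [hw, hop] at h
    apply Nat.eq_of_mul_eq_mul_right hCpos
    rw [h]; ring
  have h2 : d = l * w := by
    have h := (f.restrictScalars F).finrank_eq
    rw [Module.finrank_pi_fintype, hA] at h
    simp only [Finset.sum_const, Finset.card_univ, Fintype.card_fin, smul_eq_mul] at h
    rw [hw, hop] at h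
    apply Nat.eq_of_mul_eq_mul_right hCpos
    rw [h]; ring
  have hw1 : w = 1 := by
    have : w ∣ Nat.gcd m d := Nat.dvd_gcd ⟨k, by rw [h1]; ring⟩ ⟨l, by rw [h2]; ring⟩
    rw [hcop] at this
    exact Nat.dvd_one.1 this
  rw [hw1, mul_one, hop] at hw
  have : Nontrivial I := IsSimpleModule.nontrivial A I
  obtain ⟨x, hx⟩ := exists_ne (0 : I)
  let θ : C →ₗ[F] I :=
    { toFun := fun c => γ' (MulOpposite.op c) x
      map_add' := by intro a b; simp
      map_smul' := by intro a b; simp }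
  have hinj : Function.Injective θ := by
    rw [← LinearMap.ker_eq_bot, LinearMap.ker_eq_bot']
    intro c hc
    by_contra hne
    apply hx
    have h3 : γ' (MulOpposite.op c⁻¹) (θ c) = x := by
      change γ' (MulOpposite.op c⁻¹) (γ' (MulOpposite.op c) x) = x
      rw [← Module.End.mul_apply, ← map_mul, ← MulOpposite.op_mul, mul_inv_cancel₀ hne]
      simp
    rw [hc, map_zero] at h3
    exact h3.symm
  let Θ : C ≃ₗ[F] I := LinearEquiv.ofInjectiveOfFinrankEq θ hinj hw.symm
  have hΘ : ∀ c, Θ c = γ' (MulOpposite.op c) x := fun c => rfl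
  have hΘ' : ∀ b, γ' (MulOpposite.op (Θ.symm (β' b x))) x = β' b x := fun b => by
    rw [← hΘ, LinearEquiv.apply_symm_apply]
  refine ⟨AlgHom.ofLinearMap (Θ.symm.toLinearMap ∘ₗ (LinearMap.applyₗ x) ∘ₗ β'.toLinearMap) ?_ ?_⟩
  · apply Θ.injective
    change Θ (Θ.symm (β' 1 x)) = Θ 1
    rw [LinearEquiv.apply_symm_apply, map_one, hΘ]
    simp
  · intro b b'
    apply Θ.injective
    change Θ (Θ.symm (β' (b * b') x)) = Θ (Θ.symm (β' b x) * Θ.symm (β' b' x))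
    rw [LinearEquiv.apply_symm_apply, hΘ, MulOpposite.op_mul, map_mul, map_mul,
      Module.End.mul_apply, Module.End.mul_apply, hΘ', ← hΘ' b']
    rw [← Module.End.mul_apply, (hc' b _).eq, Module.End.mul_apply, ← Module.End.mul_apply, hΘ']
    rw [Module.End.mul_apply]

/-- A bimodule criterion for the existence of a homomorphism into a division algebra. -/
theorem exists_algHom_of_coprime {B C : Type*} [Ring B] [Algebra F B] [FiniteDimensional F B]
    [DivisionRing C] [Algebra F C] [FiniteDimensional F C] [IsSimpleRing (B ⊗[F] Cᵐᵒᵖ)]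
    {M : Type*} [AddCommGroup M] [Module F M] [FiniteDimensional F M]
    (β : B →ₐ[F] Module.End F M) (γ : Cᵐᵒᵖ →ₐ[F] Module.End F M)
    (hcomm : ∀ b c, Commute (β b) (γ c)) (m : ℕ)
    (hm : Module.finrank F M = m * Module.finrank F C)
    (hcop : Nat.Coprime m (Module.finrank F B)) : Nonempty (B →ₐ[F] C) :=
  exists_algHom_of_coprime_aux (A := B ⊗[F] Cᵐᵒᵖ) Algebra.TensorProduct.includeLeft
    Algebra.TensorProduct.includeRight (fun b c => by simp [Commute, SemiconjBy])
    (Module.finrank F B) (by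
      rw [Module.finrank_tensorProduct,
        (MulOpposite.opLinearEquiv F : C ≃ₗ[F] Cᵐᵒᵖ).finrank_eq.symm])
    (Algebra.TensorProduct.lift β γ hcomm) m hm hcop

end SimpleModules

/-! ### The Skolem-Noether theorem in infinite dimension -/

section SkolemNoether

variable {F : Type*} [Field F] {R : Type*} [DivisionRing R] [Algebra F R] [Algebra.IsCentral F R]

/-- Left multiplication by the image of a homomorphism. -/
noncomputable def leftMul {F : Type*} [Field F] {B X : Type*} [Ring B] [Ring X] [Algebra F B]
    [Algebra F X] (f : B →ₐ[F] X) : B →ₐ[F] Module.End F X :=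
  (Algebra.lmul F X).comp f

/-- Right multiplication by the image of a homomorphism. -/
noncomputable def rightMul {F : Type*} [Field F] {B X : Type*} [Ring B] [Ring X] [Algebra F B]
    [Algebra F X] (f : B →ₐ[F] X) : Bᵐᵒᵖ →ₐ[F] Module.End F X :=
  (Algebra.lsmul F F X : Xᵐᵒᵖ →ₐ[F] Module.End F X).comp f.op

@[simp] theorem leftMul_apply {F : Type*} [Field F] {B X : Type*} [Ring B] [Ring X] [Algebra F B]
    [Algebra F X] (f : B →ₐ[F] X) (b : B) (x : X) : leftMul f b x = f b * x := rfl

@[simp] theorem rightMul_apply {F : Type*} [Field F] {B X : Type*} [Ring B] [Ring X] [Algebra F B]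
    [Algebra F X] (f : B →ₐ[F] X) (b : Bᵐᵒᵖ) (x : X) : rightMul f b x = x * f b.unop := rfl

theorem leftMul_commute_rightMul {F : Type*} [Field F] {B C X : Type*} [Ring B] [Ring X] [Ring C]
    [Algebra F B] [Algebra F X] [Algebra F C] (f : B →ₐ[F] X) (g : C →ₐ[F] X) (b : B) (c : Cᵐᵒᵖ) :
    Commute (leftMul f b) (rightMul g c) := by
  ext x
  simp [mul_assoc]

/-- Right multiplications alone make `R` simple under both actions, so the two modules are
isomorphic. The isomorphism respects right multiplications, hence it is left multiplication by the
image `u` of 1. -/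
theorem exists_conj_of_rep {F R S A : Type*} [Field F] [DivisionRing R] [Algebra F R] [Ring S]
    [Algebra F S] [Ring A] [Algebra F A] [IsSimpleRing A] [IsArtinianRing A] (ρ : R → A) (σ : S → A)
    (f g : S → R) (φ ψ : A →ₐ[F] Module.End F R) (hφ : ∀ r x, φ (ρ r) x = x * r)
    (hψ : ∀ r x, ψ (ρ r) x = x * r) (hφ' : ∀ s x, φ (σ s) x = f s * x)
    (hψ' : ∀ s x, ψ (σ s) x = g s * x) : ∃ u : R, u ≠ 0 ∧ ∀ s, f s * u = u * g s := by
  have hsimple : ∀ φ : A →ₐ[F] Module.End F R, (∀ r x, φ (ρ r) x = x * r) →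
      @IsSimpleModule A _ R _ (moduleOfRep φ) := by
    intro φ hφ
    let _ : Module A R := moduleOfRep φ
    rw [isSimpleModule_iff_toSpanSingleton_surjective]
    refine ⟨inferInstance, fun x hx y => ⟨ρ (x⁻¹ * y), ?_⟩⟩
    change φ (ρ (x⁻¹ * y)) x = y
    rw [hφ, mul_inv_cancel_left₀ hx]
  obtain ⟨e⟩ := @nonempty_linearEquiv_of_isSimpleModule A _ _ _ R R _
    (moduleOfRep ψ) (hsimple ψ hψ) _ (moduleOfRep φ) (hsimple φ hφ)
  have he : ∀ (a : A) (x : R), e (ψ a x) = φ a (e x) := fun a x =>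
    @LinearEquiv.map_smul A R R _ _ _ (moduleOfRep ψ) (moduleOfRep φ) e a x
  refine ⟨e 1, ?_, fun s => ?_⟩
  · intro h0
    have h1 : ∀ r, e r = 0 := fun r => by
      have := he (ρ r) 1
      rwa [hψ, hφ, h0, one_mul, zero_mul] at this
    exact one_ne_zero (e.injective ((h1 1).trans (h1 0).symm))
  · have h1 := he (σ s) 1
    have h2 := he (ρ (g s)) 1
    rw [hψ', hφ', mul_one] at h1
    rw [hψ, hφ, one_mul] at h2
    rw [← h1, h2]

/-- The Skolem-Noether theorem for homomorphisms of a finite-dimensional simple algebra to a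
central division algebra of arbitrary dimension. -/
theorem exists_conj_of_algHom {S : Type*} [Ring S] [IsSimpleRing S] [Algebra F S]
    [FiniteDimensional F S] (f g : S →ₐ[F] R) : ∃ u : R, u ≠ 0 ∧ ∀ s, f s * u = u * g s := by
  -- `R` may be infinite-dimensional over `F`, but the tensor product is finite-dimensional over the
  -- division ring `Rᵐᵒᵖ`.
  have hArt : IsArtinianRing (Rᵐᵒᵖ ⊗[F] S) := by
    have hsm : ∀ (r : Rᵐᵒᵖ) (a : Rᵐᵒᵖ ⊗[F] S), r • a = (r ⊗ₜ[F] (1 : S)) * a := by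
      intro r a
      induction a using TensorProduct.induction_on with
      | zero => simp
      | tmul x y => simp [TensorProduct.smul_tmul']
      | add x y hx hy => simp only [smul_add, mul_add, hx, hy]
    have : IsScalarTower Rᵐᵒᵖ (Rᵐᵒᵖ ⊗[F] S) (Rᵐᵒᵖ ⊗[F] S) := ⟨fun r a b => by
      simp only [smul_eq_mul, hsm, mul_assoc]⟩
    exact isArtinian_of_tower Rᵐᵒᵖ inferInstance
  refine exists_conj_of_rep (F := F) (A := Rᵐᵒᵖ ⊗[F] S) (fun r => MulOpposite.op r ⊗ₜ 1)
    (fun s => 1 ⊗ₜ s) f g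
    (Algebra.TensorProduct.lift (rightMul (AlgHom.id F R)) (leftMul f)
      fun r s => (leftMul_commute_rightMul f (AlgHom.id F R) s r).symm)
    (Algebra.TensorProduct.lift (rightMul (AlgHom.id F R)) (leftMul g)
      fun r s => (leftMul_commute_rightMul g (AlgHom.id F R) s r).symm) ?_ ?_ ?_ ?_ <;>
  · intro r x
    rw [Algebra.TensorProduct.lift_tmul]
    simp

end SkolemNoether

/-! ### Corners of representations of matrix algebras -/

section Corner

variable {F : Type*} [Field F]

/-- The corner of a representation of a matrix algebra. -/
theorem finrank_eq_mul_finrank_range {B : Type*} [Ring B] [Algebra F B] {r : ℕ} (i₀ : Fin r)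
    {V : Type*} [AddCommGroup V] [Module F V] [FiniteDimensional F V]
    (Φ : Matrix (Fin r) (Fin r) B →ₐ[F] Module.End F V) :
    Module.finrank F V =
      r * Module.finrank F (LinearMap.range (Φ (Matrix.single i₀ i₀ 1))) := by
  classical
  let E : Fin r → Fin r → Module.End F V := fun i j => Φ (Matrix.single i j 1)
  have hE : ∀ i j k, E i j * E j k = E i k := fun i j k => by
    simp [E, ← map_mul]
  have hE0 : ∀ i j k l, j ≠ k → E i j * E k l = 0 := fun i j k l h => by
    simp [E, ← map_mul, h]
  have hsum : ∑ i, E i i = 1 := by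
    simp only [E, ← map_sum]
    rw [← map_one Φ]
    congr 1
    ext i j
    rw [Matrix.sum_apply, Matrix.one_apply]
    by_cases hij : i = j
    · subst hij
      rw [Finset.sum_eq_single i (fun k _ hk => by simp [hk]) (by simp)]
      simp
    · rw [if_neg hij]
      refine Finset.sum_eq_zero fun k _ => ?_
      by_cases hk : k = i
      · subst hk; simp [hij]
      · simp [hk]
  have hE' : ∀ i j k v, E i j (E j k v) = E i k v := fun i j k v => by
    rw [← Module.End.mul_apply, hE]
  let e : V ≃ₗ[F] (Fin r → LinearMap.range (E i₀ i₀)) :=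
    { toFun := fun v i => ⟨E i₀ i v, ⟨E i₀ i v, hE' _ _ _ _⟩⟩
      map_add' := fun v w => by ext; simp
      map_smul' := fun c v => by ext; simp
      invFun := fun w => ∑ i, E i i₀ (w i)
      left_inv := fun v => by
        simp only [hE']
        rw [← LinearMap.sum_apply, hsum]; rfl
      right_inv := fun w => by
        funext i
        ext
        simp only [map_sum]
        rw [Finset.sum_eq_single i]
        · obtain ⟨v, hv⟩ := (w i).2
          rw [hE', ← hv, hE']
        · intro j _ hj
          rw [← Module.End.mul_apply, hE0 _ _ _ _ hj.symm]; rfl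
        · simp }
  rw [e.finrank_eq, Module.finrank_pi_fintype]
  simp [E]

/-- Endomorphisms which commute with a given endomorphism act on its range. -/
noncomputable def restrictRange {V : Type*} [AddCommGroup V] [Module F V] (P : Module.End F V)
    {C : Type*} [Ring C] [Algebra F C] (φ : C →ₐ[F] Module.End F V) (h : ∀ c, Commute P (φ c)) :
    C →ₐ[F] Module.End F (LinearMap.range P) where
  toFun c := (φ c).restrict (p := LinearMap.range P) (q := LinearMap.range P) (by
    rintro _ ⟨v, rfl⟩
    exact ⟨φ c v, by rw [← Module.End.mul_apply, (h c).eq, Module.End.mul_apply]⟩)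
  map_one' := by ext; simp
  map_mul' a b := by ext; simp
  map_zero' := by ext; simp
  map_add' a b := by ext; simp
  commutes' a := by ext; simp

@[simp] theorem restrictRange_apply {V : Type*} [AddCommGroup V] [Module F V]
    (P : Module.End F V) {C : Type*} [Ring C] [Algebra F C] (φ : C →ₐ[F] Module.End F V)
    (h : ∀ c, Commute P (φ c)) (c : C) (v : LinearMap.range P) :
    (restrictRange P φ h c v : V) = φ c v := rfl

end Corner

/-! ### The centralizer theorem -/

section Centralizer

variable {L : Type*} [Field L] {S : Type*} [DivisionRing S] [Algebra L S] [Algebra.IsCentral L S]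
  [FiniteDimensional L S]

/-- With right multiplications by `S` and left multiplications by `B`, `S` is a simple `A`-module,
`A` is a sum of `[B : L]` copies of it, and evaluation at 1 identifies `End_A(S)` with the
centralizer of `B`. Hence `S = Hom_A(A, S)` is a sum of `[B : L]` copies of the centralizer. -/
theorem finrank_eq_mul_of_rep {L S : Type*} [Field L] [DivisionRing S] [Algebra L S]
    [FiniteDimensional L S] {A : Type*} [Ring A] [Algebra L A] [IsSimpleRing A]
    [FiniteDimensional L A] (B : Subalgebra L S) (ρ : S → A) (σ : B → A)
    (hgen : Algebra.adjoin L (Set.range ρ ∪ Set.range σ) = ⊤)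
    (φ : A →ₐ[L] Module.End L S) (hρ : ∀ r x, φ (ρ r) x = x * r)
    (hσ : ∀ s x, φ (σ s) x = s * x)
    (hA : Module.finrank L A = Module.finrank L S * Module.finrank L B) :
    Module.finrank L B * Module.finrank L (Subalgebra.centralizer L (B : Set S)) =
      Module.finrank L S := by
  have hArt : IsArtinianRing A := isArtinianRing_of_finiteDimensional L A
  let _ : Module A S := moduleOfRep φ
  have hsm : ∀ (a : A) (x : S), a • x = φ a x := fun _ _ => rfl
  have : IsScalarTower L A S := isScalarTower_moduleOfRep φ
  have : IsSimpleModule A S := by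
    rw [isSimpleModule_iff_toSpanSingleton_surjective]
    refine ⟨inferInstance, fun x hx y => ⟨ρ (x⁻¹ * y), ?_⟩⟩
    change φ (ρ (x⁻¹ * y)) x = y
    rw [hρ, mul_inv_cancel_left₀ hx]
  obtain ⟨n, ⟨e⟩⟩ := exists_linearEquiv_fun (A := A) S A
  have hn : Module.finrank L B = n := by
    have h := (e.restrictScalars L).finrank_eq
    rw [Module.finrank_pi_fintype, hA] at h
    simp only [Finset.sum_const, Finset.card_univ, Fintype.card_fin, smul_eq_mul] at h
    rw [mul_comm] at h
    exact Nat.eq_of_mul_eq_mul_right Module.finrank_pos h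
  have : SMulCommClass A L S := ⟨fun a c x => by rw [hsm, hsm, map_smul]⟩
  let c : (Module.End A S) ≃ₗ[L] Subalgebra.centralizer L (B : Set S) :=
    { toFun := fun g => ⟨g 1, by
        rw [Subalgebra.mem_centralizer_iff]
        intro b hb
        have h1 := g.map_smul (σ ⟨b, hb⟩) 1
        have h2 := g.map_smul (ρ b) 1
        rw [hsm, hsm, hσ, hσ] at h1
        rw [hsm, hsm, hρ, hρ] at h2
        simp only [mul_one, one_mul] at h1 h2
        rw [← h1, h2]⟩
      map_add' := fun g h => by ext; simp
      map_smul' := fun r g => by ext; simp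
      invFun := fun z =>
        { toFun := fun x => z * x
          map_add' := fun x y => mul_add _ _ _
          map_smul' := by
            intro a x
            simp only [hsm, RingHom.id_apply]
            have ha : a ∈ Algebra.adjoin L (Set.range ρ ∪ Set.range σ) := by
              rw [hgen]; exact Algebra.mem_top
            induction ha using Algebra.adjoin_induction generalizing x with
            | mem a ha =>
              rcases ha with ⟨r, rfl⟩ | ⟨b, rfl⟩
              · rw [hρ, hρ, mul_assoc]
              · rw [hσ, hσ, ← mul_assoc, ← mul_assoc,
                  Subalgebra.mem_centralizer_iff L |>.1 z.2 b b.2]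
            | algebraMap r => 
              rw [AlgHom.commutes]
              simp
            | add a b _ _ ha hb => simp only [map_add, LinearMap.add_apply, mul_add, ha, hb]
            | mul a b _ _ ha hb => rw [map_mul, Module.End.mul_apply, Module.End.mul_apply, ha, hb] }
      left_inv := fun g => by
        ext x
        have h2 := g.map_smul (ρ x) 1
        rw [hsm, hsm, hρ, hρ, one_mul] at h2
        exact h2.symm
      right_inv := fun z => by ext; simp }
  have h1 : Module.finrank L S = Module.finrank L (Fin n → Module.End A S) := by
    let e1 : (A →ₗ[A] S) ≃ₗ[L] S := LinearMap.ringLmapEquivSelf A L S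
    let e2 : ((Fin n → S) →ₗ[A] S) ≃ₗ[L] (A →ₗ[A] S) := LinearEquiv.congrLeft S L e.symm
    let e3 : (Fin n → Module.End A S) ≃ₗ[L] ((Fin n → S) →ₗ[A] S) :=
      LinearMap.lsum A (fun _ => S) L
    exact (e3.trans (e2.trans e1)).symm.finrank_eq
  rw [h1, c.finrank_eq.symm, hn, Module.finrank_pi_fintype]
  simp

theorem finrank_mul_finrank_centralizer (B : Subalgebra L S) :
    Module.finrank L B * Module.finrank L (Subalgebra.centralizer L (B : Set S)) =
      Module.finrank L S := by
  let _ : DivisionRing B := divisionRingSubalgebra B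
  refine finrank_eq_mul_of_rep (A := Sᵐᵒᵖ ⊗[L] B) B (fun r => MulOpposite.op r ⊗ₜ 1)
    (fun s => 1 ⊗ₜ s) ?_
    (Algebra.TensorProduct.lift (rightMul (AlgHom.id L S)) (leftMul B.val)
      fun r s => (leftMul_commute_rightMul _ _ s r).symm) ?_ ?_ ?_
  · rw [eq_top_iff, ← Algebra.TensorProduct.adjoin_tmul_eq_top, Algebra.adjoin_le_iff]
    rintro _ ⟨r, s, rfl⟩
    have : r ⊗ₜ[L] s = (r ⊗ₜ 1) * (1 ⊗ₜ s) := by simp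
    rw [this]
    exact mul_mem (Algebra.subset_adjoin (Or.inl ⟨r.unop, rfl⟩))
      (Algebra.subset_adjoin (Or.inr ⟨s, rfl⟩))
  · intro r x
    rw [Algebra.TensorProduct.lift_tmul]
    simp
  · intro r x
    rw [Algebra.TensorProduct.lift_tmul]
    simp
  · rw [Module.finrank_tensorProduct,
      (MulOpposite.opLinearEquiv L : S ≃ₗ[L] Sᵐᵒᵖ).finrank_eq.symm]

theorem centralizer_centralizer_eq (B : Subalgebra L S) :
    Subalgebra.centralizer L (Subalgebra.centralizer L (B : Set S) : Set S) = B := by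
  symm
  apply Subalgebra.eq_of_le_of_finrank_eq
  · rw [Subalgebra.le_centralizer_iff]
  · have h1 := finrank_mul_finrank_centralizer B
    have h2 := finrank_mul_finrank_centralizer (Subalgebra.centralizer L (B : Set S))
    rw [← h1, mul_comm (Module.finrank L B)] at h2
    exact (Nat.eq_of_mul_eq_mul_left Module.finrank_pos h2).symm

end Centralizer

/-! ### Commuting subalgebras, their products, and linear disjointness from centers -/

section Internal

variable {F R : Type*} [Field F] [DivisionRing R] [Algebra F R]

theorem inv_mem_centralizer {s : Set R} {x : R} (hx : x ∈ Subalgebra.centralizer F s) :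
    x⁻¹ ∈ Subalgebra.centralizer F s := by
  rw [Subalgebra.mem_centralizer_iff] at hx ⊢
  intro g hg
  exact Commute.inv_right₀ (hx g hg)

/-- The center of a subalgebra, as a subalgebra of the ambient algebra. -/
def cen {F R : Type*} [Field F] [Ring R] [Algebra F R] (S : Subalgebra F R) : Subalgebra F R :=
  S ⊓ Subalgebra.centralizer F (S : Set R)

theorem mem_cen {F R : Type*} [Field F] [Ring R] [Algebra F R] {S : Subalgebra F R} {x : R} :
    x ∈ cen S ↔ x ∈ S ∧ ∀ y ∈ S, y * x = x * y := by
  rw [cen, Algebra.mem_inf, Subalgebra.mem_centralizer_iff]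
  rfl

theorem cen_le {F R : Type*} [Field F] [Ring R] [Algebra F R] (S : Subalgebra F R) :
    cen S ≤ S := inf_le_left

theorem finiteDimensional_of_le {A B : Subalgebra F R} (h : A ≤ B) [FiniteDimensional F B] :
    FiniteDimensional F A :=
  Submodule.finiteDimensional_of_le (S₁ := Subalgebra.toSubmodule A)
    (S₂ := Subalgebra.toSubmodule B) h

instance finiteDimensional_cen (S : Subalgebra F R) [FiniteDimensional F S] :
    FiniteDimensional F (cen S) := finiteDimensional_of_le (cen_le S)

instance finiteDimensional_inf (S T : Subalgebra F R) [FiniteDimensional F S] :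
    FiniteDimensional F (S ⊓ T : Subalgebra F R) := finiteDimensional_of_le inf_le_left

theorem finrank_dvd_of_le {A B : Subalgebra F R} (h : A ≤ B) [FiniteDimensional F B] :
    Module.finrank F A ∣ Module.finrank F B := by
  have := finiteDimensional_of_le h
  let _ : DivisionRing A := divisionRingSubalgebra A
  exact finrank_dvd_of_algHom (leftMul (Subalgebra.inclusion h))

/-- Shortest relation argument: scale one coefficient to 1; commutators of the coefficients with an
element of `A` form a shorter relation, so all coefficients are central in `A`. -/
theorem eq_zero_of_sum_mul_eq_zero (A : Subalgebra F R) [FiniteDimensional F A] {ι : Type*}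
    [Fintype ι] (b : ι → R) (hb : ∀ i, ∀ a ∈ A, a * b i = b i * a)
    (hind : ∀ z : ι → R, (∀ i, z i ∈ cen A) → ∑ i, z i * b i = 0 → z = 0)
    (a : ι → R) (ha : ∀ i, a i ∈ A) (h0 : ∑ i, a i * b i = 0) : a = 0 := by
  classical
  suffices H : ∀ n : ℕ, ∀ a : ι → R, (∀ i, a i ∈ A) → ∑ i, a i * b i = 0 →
      (Finset.univ.filter fun i => a i ≠ 0).card = n → a = 0 from H _ a ha h0 rfl
  intro n
  induction n using Nat.strong_induction_on with
  | _ n ih =>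
  intro a ha h0 hn
  by_contra hne
  obtain ⟨i₀, hi₀⟩ := Function.ne_iff.1 hne
  have hi₀ : a i₀ ≠ 0 := hi₀
  let a' : ι → R := fun i => (a i₀)⁻¹ * a i
  have ha' : ∀ i, a' i ∈ A := fun i =>
    A.mul_mem (inv_mem_of_finiteDimensional A (ha i₀)) (ha i)
  have h0' : ∑ i, a' i * b i = 0 := by
    simp only [a', mul_assoc, ← Finset.mul_sum, h0, mul_zero]
  have h1 : a' i₀ = 1 := inv_mul_cancel₀ hi₀
  have hcen : ∀ i, a' i ∈ cen A := by
    intro i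
    rw [mem_cen]
    refine ⟨ha' i, fun c hc => ?_⟩
    have hz : (fun i => c * a' i - a' i * c) = 0 := by
      refine ih _ ?_ _ (fun i => A.sub_mem (A.mul_mem hc (ha' i)) (A.mul_mem (ha' i) hc)) ?_ rfl
      · rw [← hn]
        apply Finset.card_lt_card
        rw [Finset.ssubset_iff_of_subset]
        · refine ⟨i₀, by simpa using hi₀, ?_⟩
          simp [h1]
        · intro j hj
          simp only [Finset.mem_filter, Finset.mem_univ, true_and] at hj ⊢
          intro h
          apply hj
          simp [a', h]
      · have : ∀ i, (c * a' i - a' i * c) * b i = c * (a' i * b i) - (a' i * b i) * c := by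
          intro i
          rw [sub_mul, mul_assoc, mul_assoc (a' i), mul_assoc (a' i), hb i c hc]
        simp only [this, Finset.sum_sub_distrib, ← Finset.mul_sum, ← Finset.sum_mul, h0']
        simp
    exact sub_eq_zero.1 (congrFun hz i)
  have := congrFun (hind a' hcen h0') i₀
  rw [h1] at this
  exact one_ne_zero this

theorem mem_sup_iff_exists_sum {A B : Subalgebra F R} {ι : Type*} [Fintype ι]
    (hAB : ∀ a ∈ A, ∀ b ∈ B, a * b = b * a) (b : ι → R) (hb : ∀ i, b i ∈ B)
    (hspan : ∀ x ∈ B, ∃ z : ι → R, (∀ i, z i ∈ A) ∧ x = ∑ i, z i * b i) (x : R) :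
    x ∈ A ⊔ B ↔ ∃ a : ι → R, (∀ i, a i ∈ A) ∧ x = ∑ i, a i * b i := by
  constructor
  · intro hx
    let W : Submodule F R :=
      { carrier := {x | ∃ a : ι → R, (∀ i, a i ∈ A) ∧ x = ∑ i, a i * b i}
        add_mem' := by
          rintro _ _ ⟨a, ha, rfl⟩ ⟨a', ha', rfl⟩
          exact ⟨a + a', fun i => A.add_mem (ha i) (ha' i), by
            simp [add_mul, Finset.sum_add_distrib]⟩
        zero_mem' := ⟨0, fun i => A.zero_mem, by simp⟩
        smul_mem' := by
          rintro c _ ⟨a, ha, rfl⟩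
          exact ⟨c • a, fun i => A.smul_mem (ha i) c, by
            simp [Finset.smul_sum]⟩ }
    have hWA : ∀ a ∈ A, ∀ x ∈ W, a * x ∈ W := by
      rintro a ha _ ⟨a', ha', rfl⟩
      exact ⟨fun i => a * a' i, fun i => A.mul_mem ha (ha' i), by
        simp [Finset.mul_sum, mul_assoc]⟩
    have hWB : ∀ c ∈ B, ∀ x ∈ W, c * x ∈ W := by
      rintro c hc _ ⟨a', ha', rfl⟩
      rw [Finset.mul_sum]
      refine W.sum_mem fun i _ => ?_
      rw [← mul_assoc, ← hAB _ (ha' i) _ hc, mul_assoc]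
      exact hWA _ (ha' i) _ (hspan _ (B.mul_mem hc (hb i)))
    have h1 : (1 : R) ∈ W := hspan 1 B.one_mem
    have key : ∀ w ∈ W, x * w ∈ W := by
      rw [Algebra.sup_def] at hx
      induction hx using Algebra.adjoin_induction with
      | mem x hx =>
        rcases hx with hx | hx
        · exact hWA x hx
        · exact hWB x hx
      | algebraMap r =>
        intro w hw
        rw [← Algebra.smul_def]
        exact W.smul_mem r hw
      | add x y _ _ hx hy =>
        intro w hw
        rw [add_mul]
        exact W.add_mem (hx w hw) (hy w hw)
      | mul x y _ _ hx hy =>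
        intro w hw
        rw [mul_assoc]
        exact hx _ (hy w hw)
    have h2 := key 1 h1
    rwa [mul_one] at h2
  · rintro ⟨a, ha, rfl⟩
    refine Subalgebra.sum_mem _ fun i _ => Subalgebra.mul_mem _ ?_ ?_
    · exact (le_sup_left : A ≤ A ⊔ B) (ha i)
    · exact (le_sup_right : B ≤ A ⊔ B) (hb i)

theorem finrank_sup_of_indep {A B : Subalgebra F R} [FiniteDimensional F A] {ι : Type*} [Fintype ι]
    (hAB : ∀ a ∈ A, ∀ b ∈ B, a * b = b * a) (b : ι → R) (hb : ∀ i, b i ∈ B)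
    (hspan : ∀ x ∈ B, ∃ z : ι → R, (∀ i, z i ∈ A) ∧ x = ∑ i, z i * b i)
    (hind : ∀ a : ι → R, (∀ i, a i ∈ A) → ∑ i, a i * b i = 0 → a = 0) :
    FiniteDimensional F (A ⊔ B : Subalgebra F R) ∧
      Module.finrank F (A ⊔ B : Subalgebra F R) = Module.finrank F A * Fintype.card ι := by
  let T : (ι → A) →ₗ[F] (A ⊔ B : Subalgebra F R) :=
    { toFun := fun a => ⟨∑ i, (a i : R) * b i,
        (mem_sup_iff_exists_sum hAB b hb hspan _).2 ⟨fun i => a i, fun i => (a i).2, rfl⟩⟩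
      map_add' := fun a a' => by ext; simp [add_mul, Finset.sum_add_distrib]
      map_smul' := fun c a => by ext; simp [Finset.smul_sum] }
  have hT : Function.Bijective T := by
    constructor
    · rw [← LinearMap.ker_eq_bot, LinearMap.ker_eq_bot']
      intro a ha
      have h := hind (fun i => a i) (fun i => (a i).2) (congrArg Subtype.val ha)
      funext i
      exact Subtype.ext (congrFun h i)
    · rintro ⟨x, hx⟩
      obtain ⟨a, ha, rfl⟩ := (mem_sup_iff_exists_sum hAB b hb hspan x).1 hx
      exact ⟨fun i => ⟨a i, ha i⟩, rfl⟩
  let e := LinearEquiv.ofBijective T hT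
  refine ⟨e.finiteDimensional, ?_⟩
  rw [← e.finrank_eq, Module.finrank_pi_fintype]
  simp [mul_comm]

theorem exists_basis_over_cen (A B : Subalgebra F R) [FiniteDimensional F A]
    [FiniteDimensional F B] (h : cen A ≤ B) : ∃ (n : ℕ) (b : Fin n → R), (∀ i, b i ∈ B) ∧
      (∀ x ∈ B, ∃ z : Fin n → R, (∀ i, z i ∈ cen A) ∧ x = ∑ i, z i * b i) ∧
      (∀ z : Fin n → R, (∀ i, z i ∈ cen A) → ∑ i, z i * b i = 0 → z = 0) ∧
      Module.finrank F B = Module.finrank F (cen A) * n := by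
  let _ : DivisionRing (cen A) := divisionRingSubalgebra (cen A)
  let _ : Module (cen A) B := Module.compHom B (Subalgebra.inclusion h).toRingHom
  have hsm : ∀ (z : cen A) (x : B), ((z • x : B) : R) = z * x := fun _ _ => rfl
  have : IsScalarTower F (cen A) B := ⟨fun c z x => by ext; simp [hsm]⟩
  have : Module.Finite (cen A) B := Module.Finite.of_restrictScalars_finite F _ _
  let b := Module.finBasis (cen A) B
  refine ⟨Module.finrank (cen A) B, fun i => b i, fun i => (b i).2, ?_, ?_, ?_⟩
  · intro x hx
    refine ⟨fun i => b.repr ⟨x, hx⟩ i, fun i => (b.repr ⟨x, hx⟩ i).2, ?_⟩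
    have := congrArg Subtype.val (b.sum_repr ⟨x, hx⟩)
    rw [AddSubmonoidClass.coe_finsetSum] at this
    exact this.symm
  · intro z hz h0
    have := Fintype.linearIndependent_iff.1 b.linearIndependent (fun i => ⟨z i, hz i⟩) (by
      ext
      simpa [hsm] using h0)
    funext i
    exact congrArg Subtype.val (this i)
  · exact (Module.finrank_mul_finrank F (cen A) B).symm

/-- The product of `A` and `B` is their tensor product over the center of `A`: a basis of `B` over
that center remains independent over all of `A`. -/
theorem finrank_sup_mul_finrank_cen {A B : Subalgebra F R} [FiniteDimensional F A]
    [FiniteDimensional F B] (hAB : ∀ a ∈ A, ∀ b ∈ B, a * b = b * a) (h : cen A ≤ B) :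
    FiniteDimensional F (A ⊔ B : Subalgebra F R) ∧
      Module.finrank F (A ⊔ B : Subalgebra F R) * Module.finrank F (cen A) =
        Module.finrank F A * Module.finrank F B := by
  obtain ⟨n, b, hb, hspan, hind, hn⟩ := exists_basis_over_cen A B h
  have hind' := eq_zero_of_sum_mul_eq_zero A b (fun i a ha => hAB a ha _ (hb i)) hind
  have h1 := finrank_sup_of_indep hAB b hb (fun x hx => by
    obtain ⟨z, hz, hx⟩ := hspan x hx
    exact ⟨z, fun i => cen_le A (hz i), hx⟩) hind'
  refine ⟨h1.1, ?_⟩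
  rw [h1.2, hn, Fintype.card_fin]
  ring

theorem sup_inf_centralizer_eq {A B : Subalgebra F R} [FiniteDimensional F A]
    [FiniteDimensional F B] (hAB : ∀ a ∈ A, ∀ b ∈ B, a * b = b * a) (h : cen A ≤ B) :
    (A ⊔ B) ⊓ Subalgebra.centralizer F (A : Set R) = B := by
  obtain ⟨n, b, hb, hspan, hind, hn⟩ := exists_basis_over_cen A B h
  have hind' := eq_zero_of_sum_mul_eq_zero A b (fun i a ha => hAB a ha _ (hb i)) hind
  apply le_antisymm
  · rintro x ⟨hx, hx'⟩
    obtain ⟨a, ha, rfl⟩ := (mem_sup_iff_exists_sum hAB b hb (fun x hx => by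
      obtain ⟨z, hz, hx⟩ := hspan x hx
      exact ⟨z, fun i => cen_le A (hz i), hx⟩) x).1 hx
    refine Subalgebra.sum_mem _ fun i _ => B.mul_mem (h (mem_cen.2 ⟨ha i, fun c hc => ?_⟩)) (hb i)
    have h2 := (Subalgebra.mem_centralizer_iff F).1 hx' c hc
    have h3 := hind' (fun i => c * a i - a i * c)
      (fun i => A.sub_mem (A.mul_mem hc (ha i)) (A.mul_mem (ha i) hc)) (by
        rw [← sub_eq_zero, Finset.mul_sum, Finset.sum_mul, ← Finset.sum_sub_distrib] at h2
        rw [← h2]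
        refine Finset.sum_congr rfl fun i _ => ?_
        rw [sub_mul, mul_assoc, mul_assoc, mul_assoc, hAB c hc _ (hb i)])
    exact sub_eq_zero.1 (congrFun h3 i)
  · refine le_inf le_sup_right fun x hx => ?_
    rw [Subalgebra.mem_centralizer_iff]
    exact fun g hg => hAB g hg x hx

theorem cen_sup_eq {A B : Subalgebra F R} [FiniteDimensional F A]
    [FiniteDimensional F B] (hAB : ∀ a ∈ A, ∀ b ∈ B, a * b = b * a) (h : cen A ≤ B) :
    cen (A ⊔ B) = cen B := by
  have h0 := sup_inf_centralizer_eq hAB h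
  ext x
  rw [mem_cen, mem_cen]
  constructor
  · rintro ⟨h1, h2⟩
    refine ⟨?_, fun y hy => h2 y ((le_sup_right : B ≤ A ⊔ B) hy)⟩
    rw [← h0, Algebra.mem_inf, Subalgebra.mem_centralizer_iff]
    exact ⟨h1, fun y hy => h2 y ((le_sup_left : A ≤ A ⊔ B) hy)⟩
  · rintro ⟨h1, h2⟩
    refine ⟨(le_sup_right : B ≤ A ⊔ B) h1, fun y hy => ?_⟩
    have : A ⊔ B ≤ Subalgebra.centralizer F {x} := by
      refine sup_le (fun a ha => ?_) (fun b hb => ?_)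
      · rw [Subalgebra.mem_centralizer_iff]
        rintro _ rfl
        exact (hAB a ha _ h1).symm
      · rw [Subalgebra.mem_centralizer_iff]
        rintro _ rfl
        exact (h2 b hb).symm
    exact ((Subalgebra.mem_centralizer_iff F).1 (this hy) x rfl).symm

/-- Induction on `n`. If the last vector is a combination of the others over the centralizer of `Y`,
some coefficient is not in `F`; adding to `Y` an element that does not commute with this coefficient
excludes the relation, since the coefficients were unique. -/
theorem exists_finset_indep [Algebra.IsCentral F R] {n : ℕ} (x : Fin n → R)
    (hx : LinearIndependent F x) : ∃ Y : Finset R, ∀ c : Fin n → R,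
      (∀ i, c i ∈ Subalgebra.centralizer F (Y : Set R)) → ∑ i, c i * x i = 0 → c = 0 := by
  classical
  induction n with
  | zero => exact ⟨∅, fun c _ _ => funext fun i => i.elim0⟩
  | succ n ih =>
    obtain ⟨Y, hY⟩ := ih (fun i => x i.castSucc) (hx.comp _ (Fin.castSucc_injective n))
    by_cases hc : ∃ c : Fin n → R, (∀ i, c i ∈ Subalgebra.centralizer F (Y : Set R)) ∧
        x (Fin.last n) = ∑ i, c i * x i.castSucc
    · obtain ⟨c, hc, hcx⟩ := hc
      have : ∃ i, c i ∉ (⊥ : Subalgebra F R) := by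
        by_contra! hcon
        choose r hr using fun i => Algebra.mem_bot.1 (hcon i)
        have h1 := Fintype.linearIndependent_iff.1 hx (Fin.snoc r (-1)) (by
          rw [Fin.sum_univ_castSucc]
          simp only [Fin.snoc_castSucc, Fin.snoc_last, hcx, neg_smul, one_smul]
          rw [add_neg_eq_zero]
          exact Finset.sum_congr rfl fun i _ => by rw [Algebra.smul_def, hr]) (Fin.last n)
        simp at h1
      obtain ⟨i₀, hi₀⟩ := this
      have : ∃ y, y * c i₀ ≠ c i₀ * y := by
        by_contra! hcon
        apply hi₀
        apply Algebra.IsCentral.out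
        rw [Subalgebra.mem_center_iff]
        exact hcon
      obtain ⟨y, hy⟩ := this
      refine ⟨insert y Y, fun d hd h0 => ?_⟩
      have hd' : ∀ i, d i ∈ Subalgebra.centralizer F (Y : Set R) := fun i =>
        Subalgebra.centralizer_le F _ _ (by simp) (hd i)
      rw [Fin.sum_univ_castSucc, hcx, Finset.mul_sum, ← Finset.sum_add_distrib] at h0
      have h1 := hY (fun i => d i.castSucc + d (Fin.last n) * c i)
        (fun i => Subalgebra.add_mem _ (hd' _) (Subalgebra.mul_mem _ (hd' _) (hc i))) (by
          rw [← h0]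
          exact Finset.sum_congr rfl fun i _ => by rw [add_mul, mul_assoc])
      have hlast : d (Fin.last n) = 0 := by
        by_contra hne
        apply hy
        have h2 : c i₀ = (d (Fin.last n))⁻¹ * (-d i₀.castSucc) := by
          have := congrFun h1 i₀
          simp only [Pi.zero_apply] at this
          rw [eq_inv_mul_iff_mul_eq₀ hne]
          rw [add_comm] at this
          exact eq_neg_of_add_eq_zero_left this
        have h3 : c i₀ ∈ Subalgebra.centralizer F ((insert y Y : Finset R) : Set R) := by
          rw [h2]
          exact Subalgebra.mul_mem _ (inv_mem_centralizer (hd _)) (Subalgebra.neg_mem _ (hd _))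
        exact (Subalgebra.mem_centralizer_iff F).1 h3 y (by simp)
      funext i
      refine Fin.lastCases hlast (fun j => ?_) i
      simpa [hlast] using congrFun h1 j
    · refine ⟨Y, fun d hd h0 => ?_⟩
      have hlast : d (Fin.last n) = 0 := by
        by_contra hne
        apply hc
        refine ⟨fun i => -((d (Fin.last n))⁻¹ * d i.castSucc), fun i => Subalgebra.neg_mem _
          (Subalgebra.mul_mem _ (inv_mem_centralizer (hd _)) (hd _)), ?_⟩
        rw [Fin.sum_univ_castSucc, add_comm] at h0
        have h2 := eq_neg_of_add_eq_zero_left h0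
        rw [← eq_inv_mul_iff_mul_eq₀ hne] at h2
        rw [h2, mul_neg, Finset.mul_sum, ← Finset.sum_neg_distrib]
        exact Finset.sum_congr rfl fun i _ => by rw [neg_mul, mul_assoc]
      rw [Fin.sum_univ_castSucc, hlast, zero_mul, add_zero] at h0
      have h1 := hY _ (fun i => hd _) h0
      funext i
      exact Fin.lastCases hlast (fun j => congrFun h1 j) i

/-- A finite-dimensional subalgebra is linearly disjoint from the center of every sufficiently
large subalgebra. -/
theorem exists_finset_finrank_sup_cen [Algebra.IsCentral F R] (S : Subalgebra F R)
    [FiniteDimensional F S] : ∃ Y : Finset R, ∀ T : Subalgebra F R, FiniteDimensional F T →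
      S ≤ T → (Y : Set R) ⊆ T → FiniteDimensional F (cen T ⊔ S : Subalgebra F R) ∧
        Module.finrank F (cen T ⊔ S : Subalgebra F R) =
          Module.finrank F (cen T) * Module.finrank F S := by
  let b := Module.finBasis F S
  obtain ⟨Y, hY⟩ := exists_finset_indep (F := F) (fun i => (b i : R))
    (b.linearIndependent.map' S.val.toLinearMap (LinearMap.ker_eq_bot.2 Subtype.val_injective))
  refine ⟨Y, fun T hT hST hYT => ?_⟩
  have := finrank_sup_of_indep (A := cen T) (B := S)
    (fun a ha c hc => ((mem_cen.1 ha).2 c (hST hc)).symm) (fun i => (b i : R)) (fun i => (b i).2)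
    (fun x hx => ⟨fun i => algebraMap F R (b.repr ⟨x, hx⟩ i), fun i => Subalgebra.algebraMap_mem _ _,
      by
        have := congrArg Subtype.val (b.sum_repr ⟨x, hx⟩)
        simpa [Algebra.smul_def] using this.symm⟩)
    (fun a ha h0 => hY a (fun i => by
      rw [Subalgebra.mem_centralizer_iff]
      exact fun g hg => (mem_cen.1 (ha i)).2 g (hYT hg)) h0)
  simpa using this

end Internal

/-! ### Separable maximal subfields -/

section Separable

theorem isSeparable_of_adjoin_eq_top {L K : Type*} [Field L] [Field K] [Algebra L K]
    [FiniteDimensional L K] {x : K} (hx : IsSeparable L x) (h : Algebra.adjoin L {x} = ⊤) :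
    Algebra.IsSeparable L K := by
  have h1 : IntermediateField.adjoin L {x} = ⊤ := by
    rw [← IntermediateField.toSubalgebra_injective.eq_iff,
      IntermediateField.adjoin_simple_toSubalgebra_of_isAlgebraic (Algebra.IsAlgebraic.isAlgebraic x),
      h, IntermediateField.top_toSubalgebra]
  have h2 := (IntermediateField.isSeparable_adjoin_simple_iff_isSeparable L K).2 hx
  rw [h1] at h2
  exact AlgEquiv.Algebra.isSeparable IntermediateField.topEquiv

theorem exists_adjoin_eq_top {L K : Type*} [Field L] [Field K] [Algebra L K]
    [FiniteDimensional L K] [Algebra.IsSeparable L K] : ∃ x : K, Algebra.adjoin L {x} = ⊤ := by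
  obtain ⟨x, hx⟩ := Field.exists_primitive_element L K
  refine ⟨x, ?_⟩
  rw [← IntermediateField.adjoin_simple_toSubalgebra_of_isAlgebraic
    (Algebra.IsAlgebraic.isAlgebraic x), hx, IntermediateField.top_toSubalgebra]

theorem isSeparable_coe {L S : Type*} [Field L] [Ring S] [Algebra L S] (K : Subalgebra L S)
    (x : K) : IsSeparable L (x : S) ↔ IsSeparable L x := by
  rw [IsSeparable, IsSeparable, ← minpoly.algHom_eq K.val Subtype.val_injective x]
  rfl

theorem adjoin_commute {L S : Type*} [Field L] [Ring S] [Algebra L S] {s : Set S}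
    (h : ∀ x ∈ s, ∀ y ∈ s, x * y = y * x) :
    ∀ x ∈ Algebra.adjoin L s, ∀ y ∈ Algebra.adjoin L s, x * y = y * x := by
  intro x hx y hy
  have := Algebra.isMulCommutative_adjoin L h
  exact congrArg Subtype.val (mul_comm' (⟨x, hx⟩ : Algebra.adjoin L s) ⟨y, hy⟩)

theorem exists_separable_of_tower {L K M : Type*} [Field L] [Field K] [Field M] [Algebra L K]
    [Algebra L M] [Algebra K M] [IsScalarTower L K M] [FiniteDimensional L M]
    {θ : K} (hθ : IsSeparable L θ) (hK : Algebra.adjoin L {θ} = ⊤) {y : M} (hy : IsSeparable K y)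
    (hM : Algebra.adjoin L {algebraMap K M θ, y} = ⊤) :
    ∃ γ : M, IsSeparable L γ ∧ Algebra.adjoin L {γ} = ⊤ := by
  have : FiniteDimensional L K := Module.Finite.of_injective
    (IsScalarTower.toAlgHom L K M).toLinearMap (algebraMap K M).injective
  have : FiniteDimensional K M := Module.Finite.of_restrictScalars_finite L _ _
  have h1 : Algebra.IsSeparable L K := isSeparable_of_adjoin_eq_top hθ hK
  have h2 : Algebra.IsSeparable K M := by
    refine isSeparable_of_adjoin_eq_top hy ?_
    have h3 : (⊤ : Subalgebra L M) ≤ (Algebra.adjoin K {y}).restrictScalars L := by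
      rw [← hM, Algebra.adjoin_le_iff]
      intro x hx
      rw [SetLike.mem_coe, Subalgebra.mem_restrictScalars]
      rw [Set.mem_insert_iff, Set.mem_singleton_iff] at hx
      rcases hx with hx | hx
      · rw [hx]
        exact Subalgebra.algebraMap_mem _ θ
      · rw [hx]
        exact Algebra.self_mem_adjoin_singleton K y
    exact eq_top_iff.2 fun x _ => h3 Algebra.mem_top
  have h3 : Algebra.IsSeparable L M := Algebra.IsSeparable.trans L K M
  obtain ⟨γ, hγ⟩ := exists_adjoin_eq_top (L := L) (K := M)
  exact ⟨γ, Algebra.IsSeparable.isSeparable L γ, hγ⟩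

variable {L S : Type*} [Field L] [DivisionRing S] [Algebra L S] [FiniteDimensional L S]
  [Algebra.IsCentral L S]

/-- By the double centralizer theorem, the centralizer of `K = L(θ)` is a division algebra with
center `K`. If it is larger than `K`, the Jacobson-Noether theorem gives in it an element `y`
outside `K` and separable over `K`; a primitive element of `K(y)` over `L` is the new generator. -/
theorem exists_adjoin_lt_of_ne_centralizer {θ : S} (hθ : IsSeparable L θ)
    (hne : Algebra.adjoin L {θ} ≠ Subalgebra.centralizer L (Algebra.adjoin L {θ} : Set S)) :
    ∃ θ' : S, IsSeparable L θ' ∧ Algebra.adjoin L {θ} < Algebra.adjoin L {θ'} := by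
  have hKc : ∀ x ∈ Algebra.adjoin L {θ}, ∀ y ∈ Algebra.adjoin L {θ}, x * y = y * x :=
    adjoin_commute (by simp)
  let _ : Field (Algebra.adjoin L {θ}) := fieldSubalgebra _ hKc
  have hKC : Algebra.adjoin L {θ} ≤ Subalgebra.centralizer L (Algebra.adjoin L {θ} : Set S) :=
    fun x hx => (Subalgebra.mem_centralizer_iff L).2 fun g hg => hKc g hg x hx
  let _ : DivisionRing (Subalgebra.centralizer L (Algebra.adjoin L {θ} : Set S)) :=
    divisionRingSubalgebra _
  let _ : Algebra (Algebra.adjoin L {θ})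
      (Subalgebra.centralizer L (Algebra.adjoin L {θ} : Set S)) :=
    (Subalgebra.inclusion hKC).toRingHom.toAlgebra' fun c x =>
      Subtype.ext ((Subalgebra.mem_centralizer_iff L).1 x.2 c c.2)
  have : IsScalarTower L (Algebra.adjoin L {θ})
      (Subalgebra.centralizer L (Algebra.adjoin L {θ} : Set S)) :=
    IsScalarTower.of_algebraMap_eq fun _ => rfl
  have : FiniteDimensional (Algebra.adjoin L {θ})
      (Subalgebra.centralizer L (Algebra.adjoin L {θ} : Set S)) :=
    Module.Finite.of_restrictScalars_finite L _ _
  have : Algebra.IsCentral (Algebra.adjoin L {θ})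
      (Subalgebra.centralizer L (Algebra.adjoin L {θ} : Set S)) := ⟨fun x hx => by
    rw [Subalgebra.mem_center_iff] at hx
    have hx' : (x : S) ∈ Algebra.adjoin L {θ} := by
      have h1 : (x : S) ∈ Subalgebra.centralizer L
          (Subalgebra.centralizer L (Algebra.adjoin L {θ} : Set S) : Set S) :=
        (Subalgebra.mem_centralizer_iff L).2 fun g hg => congrArg Subtype.val (hx ⟨g, hg⟩)
      exact (centralizer_centralizer_eq (Algebra.adjoin L {θ})).le h1
    exact Algebra.mem_bot.2 ⟨⟨x, hx'⟩, rfl⟩⟩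
  obtain ⟨y, hy, hysep⟩ := JacobsonNoether.exists_separable_and_not_isCentral'
    (L := Algebra.adjoin L {θ}) (D := Subalgebra.centralizer L (Algebra.adjoin L {θ} : Set S)) (by
      intro h
      apply hne
      refine le_antisymm hKC fun x hx => ?_
      have h1 : (⟨x, hx⟩ : Subalgebra.centralizer L (Algebra.adjoin L {θ} : Set S)) ∈
        (⊥ : Subalgebra (Algebra.adjoin L {θ}) _) := by rw [h]; exact Algebra.mem_top
      obtain ⟨c, hc⟩ := Algebra.mem_bot.1 h1
      have := congrArg Subtype.val hc
      change (c : S) = x at this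
      exact this ▸ c.2)
  have hθK : θ ∈ Algebra.adjoin L {θ} := Algebra.subset_adjoin rfl
  have hcomm : ∀ a ∈ ({θ, (y : S)} : Set S), ∀ b ∈ ({θ, (y : S)} : Set S), a * b = b * a := by
    have h1 := (Subalgebra.mem_centralizer_iff L).1 y.2 θ hθK
    rintro a (rfl | rfl) b (rfl | rfl)
    · rfl
    · exact h1
    · exact h1.symm
    · rfl
  have hMc := adjoin_commute (L := L) hcomm
  have hKM : Algebra.adjoin L {θ} ≤ Algebra.adjoin L {θ, (y : S)} := Algebra.adjoin_mono (by simp)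
  have hMC : Algebra.adjoin L {θ, (y : S)} ≤
      Subalgebra.centralizer L (Algebra.adjoin L {θ} : Set S) := fun x hx =>
    (Subalgebra.mem_centralizer_iff L).2 fun g hg => hMc g (hKM hg) x hx
  have hyM : (y : S) ∈ Algebra.adjoin L {θ, (y : S)} := Algebra.subset_adjoin (by simp)
  have hθM : θ ∈ Algebra.adjoin L {θ, (y : S)} := hKM hθK
  let _ : Field (Algebra.adjoin L {θ, (y : S)}) := fieldSubalgebra _ hMc
  let _ : Algebra (Algebra.adjoin L {θ}) (Algebra.adjoin L {θ, (y : S)}) :=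
    (Subalgebra.inclusion hKM).toRingHom.toAlgebra
  have : IsScalarTower L (Algebra.adjoin L {θ}) (Algebra.adjoin L {θ, (y : S)}) :=
    IsScalarTower.of_algebraMap_eq fun _ => rfl
  have : FiniteDimensional (Algebra.adjoin L {θ}) (Algebra.adjoin L {θ, (y : S)}) :=
    Module.Finite.of_restrictScalars_finite L _ _
  let incl : Algebra.adjoin L {θ, (y : S)} →ₐ[Algebra.adjoin L {θ}]
      Subalgebra.centralizer L (Algebra.adjoin L {θ} : Set S) :=
    { (Subalgebra.inclusion hMC).toRingHom with commutes' := fun _ => rfl }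
  obtain ⟨γ, hγs, hγ⟩ := exists_separable_of_tower (L := L) (K := Algebra.adjoin L {θ})
    (M := Algebra.adjoin L {θ, (y : S)}) (θ := ⟨θ, hθK⟩) (y := ⟨y, hyM⟩)
    ((isSeparable_coe _ ⟨θ, hθK⟩).1 hθ) (by
      rw [← Algebra.adjoin_adjoin_coe_preimage (R := L) (s := {θ})]
      congr 1
      ext x
      simp [Subtype.ext_iff])
    (by
      rw [IsSeparable, ← minpoly.algHom_eq incl (Subalgebra.inclusion_injective hMC)]
      exact hysep)
    (by
      rw [← Algebra.adjoin_adjoin_coe_preimage (R := L) (s := {θ, (y : S)})]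
      congr 1
      ext x
      simp only [Set.mem_insert_iff, Set.mem_singleton_iff, Set.mem_preimage, Subtype.ext_iff]
      rfl)
  have h4 : Algebra.adjoin L {(γ : S)} = Algebra.adjoin L {θ, (y : S)} := by
    have := congrArg (Subalgebra.map (Algebra.adjoin L {θ, (y : S)}).val) hγ
    rw [AlgHom.map_adjoin, Set.image_singleton, Algebra.map_top, Subalgebra.range_val] at this
    exact this
  refine ⟨γ, (isSeparable_coe _ γ).2 hγs, ?_⟩
  rw [h4]
  refine lt_of_le_of_ne hKM fun h => hy ?_
  rw [← h] at hyM
  exact Algebra.mem_bot.2 ⟨⟨y, hyM⟩, rfl⟩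

variable (L S) in
/-- Koethe's theorem: a central division algebra has a separable maximal subfield. -/
theorem exists_separable_maximal_subfield : ∃ θ : S, IsSeparable L θ ∧
    Subalgebra.centralizer L (Algebra.adjoin L {θ} : Set S) = Algebra.adjoin L {θ} := by
  classical
  have hex : ∃ n, ∃ θ : S, IsSeparable L θ ∧
      Module.finrank L S - Module.finrank L (Algebra.adjoin L {θ}) = n :=
    ⟨_, 1, by simpa using isSeparable_algebraMap (F := L) (K := S) 1, rfl⟩
  obtain ⟨θ, hθ, hn⟩ := Nat.find_spec hex
  refine ⟨θ, hθ, ?_⟩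
  by_contra hne
  obtain ⟨θ', hθ', hlt⟩ := exists_adjoin_lt_of_ne_centralizer hθ (Ne.symm hne)
  refine Nat.find_min hex (m := Module.finrank L S - Module.finrank L (Algebra.adjoin L {θ'}))
    ?_ ⟨θ', hθ', rfl⟩
  rw [← hn]
  have h1 : Module.finrank L (Algebra.adjoin L {θ}) < Module.finrank L (Algebra.adjoin L {θ'}) :=
    Submodule.finrank_lt_finrank_of_lt (s := Subalgebra.toSubmodule (Algebra.adjoin L {θ}))
      (t := Subalgebra.toSubmodule (Algebra.adjoin L {θ'})) hlt
  have h2 : Module.finrank L (Algebra.adjoin L {θ'}) ≤ Module.finrank L S :=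
    Submodule.finrank_le (Subalgebra.toSubmodule (Algebra.adjoin L {θ'}))
  omega

theorem finrank_sq_of_centralizer_eq {K : Subalgebra L S}
    (h : Subalgebra.centralizer L (K : Set S) = K) :
    Module.finrank L K ^ 2 = Module.finrank L S := by
  rw [← finrank_mul_finrank_centralizer K, h, sq]

end Separable

/-! ### Centralizers when the center is larger than the ground field -/

section Center
variable {F S : Type*} [Field F] [DivisionRing S] [Algebra F S] [FiniteDimensional F S]

noncomputable instance fieldCenter : Field (Subalgebra.center F S) :=
  fieldSubalgebra _ fun _ hx y _ => ((Subalgebra.mem_center_iff.1 hx) y).symm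

instance algebraCenter : Algebra (Subalgebra.center F S) S where
  algebraMap := (Subalgebra.center F S).val.toRingHom
  commutes' c x := ((Subalgebra.mem_center_iff.1 c.2) x).symm
  smul_def' _ _ := rfl

instance isScalarTower_center : IsScalarTower F (Subalgebra.center F S) S :=
  IsScalarTower.of_algebraMap_eq fun _ => rfl

instance finiteDimensional_over_center : FiniteDimensional (Subalgebra.center F S) S :=
  Module.Finite.of_restrictScalars_finite F _ _

instance isCentral_center : Algebra.IsCentral (Subalgebra.center F S) S := ⟨fun x hx =>
  Algebra.mem_bot.2 ⟨⟨x, Subalgebra.mem_center_iff.2 (Subalgebra.mem_center_iff.1 hx)⟩, rfl⟩⟩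

/-- A subalgebra which contains the center, as an algebra over the center. -/
def overCenter (B : Subalgebra F S) (h : Subalgebra.center F S ≤ B) :
    Subalgebra (Subalgebra.center F S) S :=
  { B with algebraMap_mem' := fun r => h r.2 }

theorem finrank_overCenter (B : Subalgebra F S) (h : Subalgebra.center F S ≤ B) :
    Module.finrank F (Subalgebra.center F S) *
      Module.finrank (Subalgebra.center F S) (overCenter B h) = Module.finrank F B := 
  Module.finrank_mul_finrank F (Subalgebra.center F S) (overCenter B h)

theorem finrank_mul_finrank_centralizer_of_center_le (B : Subalgebra F S)
    (h : Subalgebra.center F S ≤ B) :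
    Module.finrank F B * Module.finrank F (Subalgebra.centralizer F (B : Set S)) =
      Module.finrank F S * Module.finrank F (Subalgebra.center F S) := by
  have h1 := finrank_mul_finrank_centralizer (overCenter B h)
  have hc : Subalgebra.center F S ≤ Subalgebra.centralizer F (B : Set S) :=
    Subalgebra.center_le_centralizer F _
  have h2 := finrank_overCenter B h
  have h3 := finrank_overCenter _ hc
  have h4 := Module.finrank_mul_finrank F (Subalgebra.center F S) S
  have h5 : overCenter _ hc = Subalgebra.centralizer (Subalgebra.center F S)
    (overCenter B h : Set S) := by ext; rfl
  rw [← h2, ← h3, ← h4, ← h1, h5]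
  ring

theorem centralizer_centralizer_eq_of_center_le (B : Subalgebra F S)
    (h : Subalgebra.center F S ≤ B) :
    Subalgebra.centralizer F (Subalgebra.centralizer F (B : Set S) : Set S) = B := by
  have := centralizer_centralizer_eq (overCenter B h)
  ext x
  exact SetLike.ext_iff.1 this x

end Center

section DoubleCentralizer

variable {F R : Type*} [Field F] [DivisionRing R] [Algebra F R]

theorem finrank_comap_val {S B : Subalgebra F R} (h : B ≤ S) :
    Module.finrank F (B.comap S.val) = Module.finrank F B :=
  LinearEquiv.finrank_eq
    { toFun := fun x => ⟨(x : S), x.2⟩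
      map_add' := fun _ _ => rfl
      map_smul' := fun _ _ => rfl
      invFun := fun x => ⟨⟨x, h x.2⟩, x.2⟩
      left_inv := fun _ => rfl
      right_inv := fun _ => rfl }

theorem comap_cen (S : Subalgebra F R) :
    (cen S).comap S.val = Subalgebra.center F S := by
  ext x
  rw [Subalgebra.mem_comap, Subalgebra.mem_center_iff, mem_cen]
  exact ⟨fun h y => Subtype.ext (h.2 y y.2), fun h => ⟨x.2, fun y hy =>
    congrArg Subtype.val (h ⟨y, hy⟩)⟩⟩

theorem comap_centralizer {S B : Subalgebra F R} (h : B ≤ S) :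
    (S ⊓ Subalgebra.centralizer F (B : Set R)).comap S.val =
      Subalgebra.centralizer F (B.comap S.val : Set S) := by
  ext x
  rw [Subalgebra.mem_comap, Subalgebra.mem_centralizer_iff, Algebra.mem_inf,
    Subalgebra.mem_centralizer_iff]
  exact ⟨fun hx y hy => Subtype.ext (hx.2 y hy), fun hx => ⟨x.2, fun y hy =>
    congrArg Subtype.val (hx ⟨y, h hy⟩ hy)⟩⟩

theorem finrank_mul_finrank_inf_centralizer {S B : Subalgebra F R} [FiniteDimensional F S]
    (hB : B ≤ S) (hc : cen S ≤ B) :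
    Module.finrank F B * Module.finrank F (S ⊓ Subalgebra.centralizer F (B : Set R) :
      Subalgebra F R) = Module.finrank F S * Module.finrank F (cen S) := by
  let _ : DivisionRing S := divisionRingSubalgebra S
  have h := finrank_mul_finrank_centralizer_of_center_le (B.comap S.val)
    (by rw [← comap_cen]; exact fun x hx => hc hx)
  rw [← comap_cen, ← comap_centralizer hB, finrank_comap_val hB, finrank_comap_val inf_le_left,
    finrank_comap_val (cen_le S)] at h
  exact h

theorem inf_centralizer_inf_centralizer {S B : Subalgebra F R} [FiniteDimensional F S]
    (hB : B ≤ S) (hc : cen S ≤ B) :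
    S ⊓ Subalgebra.centralizer F
      (S ⊓ Subalgebra.centralizer F (B : Set R) : Subalgebra F R) = B := by
  let _ : DivisionRing S := divisionRingSubalgebra S
  have h := centralizer_centralizer_eq_of_center_le (B.comap S.val)
    (by rw [← comap_cen]; exact fun x hx => hc hx)
  rw [← comap_centralizer hB, ← comap_centralizer inf_le_left] at h
  ext x
  constructor
  · intro hx
    exact (SetLike.ext_iff.1 h ⟨x, hx.1⟩).1 hx
  · intro hx
    exact (SetLike.ext_iff.1 h ⟨x, hB hx⟩).2 hx

/-- By the double centralizer theorem both sides are the intersection of `B` with its centralizer in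
`S`. -/
theorem cen_inf_centralizer {S B : Subalgebra F R} [FiniteDimensional F S]
    (hB : B ≤ S) (hc : cen S ≤ B) :
    cen (S ⊓ Subalgebra.centralizer F (B : Set R)) = cen B := by
  have h := inf_centralizer_inf_centralizer hB hc
  have h1 : cen (S ⊓ Subalgebra.centralizer F (B : Set R)) =
      (S ⊓ Subalgebra.centralizer F (B : Set R)) ⊓ (S ⊓ Subalgebra.centralizer F
        (S ⊓ Subalgebra.centralizer F (B : Set R) : Subalgebra F R)) := by
    apply le_antisymm
    · exact le_inf inf_le_left (le_inf (inf_le_left.trans inf_le_left) inf_le_right)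
    · exact le_inf inf_le_left (inf_le_right.trans inf_le_right)
  rw [h1, h]
  apply le_antisymm
  · exact le_inf inf_le_right (inf_le_left.trans inf_le_right)
  · exact le_inf (le_inf (inf_le_left.trans hB) inf_le_right) inf_le_left

end DoubleCentralizer

/-! ### Two-cocycles, corestriction, and descent of stable classes -/

section Cocycles

variable {G M : Type*} [Group G] [CommGroup M] [MulDistribMulAction G M]

/-- The 2-cocycle identity on a subgroup. -/
def IsCocycleOn (H : Subgroup G) (f : G → G → M) : Prop :=
  ∀ g ∈ H, ∀ h ∈ H, ∀ k ∈ H, f g h * f (g * h) k = g • f h k * f g (h * k)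

/-- The function is a 2-coboundary on a subgroup. -/
def IsCob (H : Subgroup G) (f : G → G → M) : Prop :=
  ∃ b : G → M, ∀ g ∈ H, ∀ h ∈ H, f g h * b (g * h) = b g * g • b h

theorem IsCocycleOn.mono {H H' : Subgroup G} {f : G → G → M} (hf : IsCocycleOn H f)
    (h : H' ≤ H) : IsCocycleOn H' f :=
  fun g hg k hk l hl => hf g (h hg) k (h hk) l (h hl)

theorem IsCob.mono {H H' : Subgroup G} {f : G → G → M} (hf : IsCob H f)
    (h : H' ≤ H) : IsCob H' f := by
  obtain ⟨b, hb⟩ := hf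
  exact ⟨b, fun g hg k hk => hb g (h hg) k (h hk)⟩

theorem IsCob.mul {H : Subgroup G} {f f' : G → G → M} (hf : IsCob H f) (hf' : IsCob H f') :
    IsCob H (f * f') := by
  obtain ⟨b, hb⟩ := hf
  obtain ⟨b', hb'⟩ := hf'
  refine ⟨b * b', fun g hg h hh => ?_⟩
  simp only [Pi.mul_apply, smul_mul']
  rw [mul_mul_mul_comm, hb g hg h hh, hb' g hg h hh, mul_mul_mul_comm]

theorem IsCob.pow {H : Subgroup G} {f : G → G → M} (hf : IsCob H f) (n : ℕ) :
    IsCob H (f ^ n) := by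
  obtain ⟨b, hb⟩ := hf
  refine ⟨b ^ n, fun g hg h hh => ?_⟩
  simp only [Pi.pow_apply, smul_pow']
  rw [← mul_pow, hb g hg h hh, mul_pow]

theorem IsCob.inv {H : Subgroup G} {f : G → G → M} (hf : IsCob H f) : IsCob H f⁻¹ := by
  obtain ⟨b, hb⟩ := hf
  refine ⟨b⁻¹, fun g hg h hh => ?_⟩
  simp only [Pi.inv_apply, smul_inv']
  rw [← mul_inv, hb g hg h hh, mul_inv]

theorem IsCocycleOn.mul {H : Subgroup G} {f f' : G → G → M} (hf : IsCocycleOn H f)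
    (hf' : IsCocycleOn H f') : IsCocycleOn H (f * f') := by
  intro g hg h hh k hk
  simp only [Pi.mul_apply, smul_mul']
  rw [mul_mul_mul_comm, hf g hg h hh k hk, hf' g hg h hh k hk, mul_mul_mul_comm]

theorem IsCocycleOn.pow {H : Subgroup G} {f : G → G → M} (hf : IsCocycleOn H f) (n : ℕ) :
    IsCocycleOn H (f ^ n) := by
  intro g hg h hh k hk
  simp only [Pi.pow_apply, smul_pow']
  rw [← mul_pow, hf g hg h hh k hk, mul_pow]

/-- The coboundary of a 1-cochain. -/
def cob (b : G → M) : G → G → M := fun g h => b g * g • b h * (b (g * h))⁻¹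

theorem isCob_cob (H : Subgroup G) (b : G → M) : IsCob H (cob b) :=
  ⟨b, fun g _ h _ => by simp [cob]⟩

theorem isCocycleOn_cob (H : Subgroup G) (b : G → M) : IsCocycleOn H (cob b) := by
  intro g _ h _ k _
  simp only [cob, smul_mul', smul_inv', mul_assoc, mul_smul]
  have e1 : (b (g * h))⁻¹ * (b (g * h) * (g • h • b k * (b (g * (h * k)))⁻¹)) =
    g • h • b k * (b (g * (h * k)))⁻¹ := by group
  have e2 : (g • b (h * k))⁻¹ * (b g * (g • b (h * k) * (b (g * (h * k)))⁻¹)) =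
    b g * (b (g * (h * k)))⁻¹ := by
      rw [mul_left_comm, inv_mul_cancel_left]
  rw [e1, e2]
  simp only [mul_left_comm]

/-- Multiply the cocycle identity over its third argument; the cochain is `g ↦ ∏ k, f g k`. -/
theorem IsCocycleOn.isCob_pow_card {H : Subgroup G} [Finite H] {f : G → G → M}
    (hf : IsCocycleOn H f) : IsCob H (f ^ Nat.card H) := by
  classical
  have := Fintype.ofFinite H
  refine ⟨fun g => ∏ k : H, f g k, fun g hg h hh => ?_⟩
  rw [Pi.pow_apply, Pi.pow_apply, Nat.card_eq_fintype_card, ← Finset.card_univ,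
    ← Finset.prod_const, ← Finset.prod_mul_distrib]
  rw [Finset.prod_congr rfl fun (k : H) _ => hf g hg h hh k k.2, Finset.prod_mul_distrib, mul_comm]
  congr 1
  · exact Fintype.prod_equiv (Equiv.mulLeft (⟨h, hh⟩ : H)) _ _ fun k => rfl
  · rw [Finset.smul_prod']

/-- The components of an element with respect to a transversal. -/
def transversalPart {H : Subgroup G} (t : G ⧸ H → G) (i : G ⧸ H) (g : G) : G :=
  (t (g • i))⁻¹ * g * t i

theorem transversalPart_mul {H : Subgroup G} (t : G ⧸ H → G) (i : G ⧸ H) (g k : G) :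
    transversalPart t i (g * k) = transversalPart t (k • i) g * transversalPart t i k := by
  simp only [transversalPart, mul_smul]
  group

theorem transversalPart_mem {H : Subgroup G} {t : G ⧸ H → G}
    (ht : ∀ i, (t i : G ⧸ H) = i) (i : G ⧸ H) (g : G) : transversalPart t i g ∈ H := by
  rw [transversalPart, mul_assoc, ← QuotientGroup.eq, ht]
  conv_lhs => rw [← ht i]
  rfl

variable {H : Subgroup G} [Fintype (G ⧸ H)]

/-- The corestriction of a cochain. -/
def cores (t : G ⧸ H → G) (f : G → G → M) : G → G → M := fun g k =>
  ∏ i : G ⧸ H, t ((g * k) • i) • f (transversalPart t (k • i) g) (transversalPart t i k)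

theorem cores_pow (t : G ⧸ H → G) (f : G → G → M) (n : ℕ) : cores t (f ^ n) = cores t f ^ n := by
  funext g k
  simp only [cores, Pi.pow_apply, smul_pow', Finset.prod_pow]

/-- After a shift of the coset in one factor, each coset contributes the cocycle identity of `f` at
its three transversal parts. -/
theorem isCocycleOn_cores {t : G ⧸ H → G} (ht : ∀ i, (t i : G ⧸ H) = i) {f : G → G → M}
    (hf : IsCocycleOn H f) : IsCocycleOn ⊤ (cores t f) := by
  intro g _ h _ k _
  have h1 : cores t f g h = ∏ i : G ⧸ H, t ((g * h * k) • i) •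
      f (transversalPart t (h • k • i) g) (transversalPart t (k • i) h) := by
    symm
    exact Fintype.prod_equiv (MulAction.toPerm k) _ _ fun i => by
      simp only [MulAction.toPerm_apply, mul_smul]
  rw [h1, cores, cores, cores, Finset.smul_prod', ← Finset.prod_mul_distrib,
    ← Finset.prod_mul_distrib]
  refine Finset.prod_congr rfl fun i _ => ?_
  have h2 : t ((g * h * k) • i) * transversalPart t (h • k • i) g = g * t (h • k • i) := by
    simp only [transversalPart, mul_smul]
    group
  rw [transversalPart_mul, transversalPart_mul, ← mul_assoc g h k, mul_smul h k i]
  rw [smul_smul g, ← h2, mul_smul (t _), ← smul_mul', ← smul_mul', hf _ (transversalPart_mem ht _ _) _ (transversalPart_mem ht _ _) _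
    (transversalPart_mem ht _ _)]

/-- Restricting a corestriction multiplies a class by the index when all coset representatives lie
in `H'`, that is, when there is a single double coset. The explicit cochain compares the two ways of
passing `g` across a representative. -/
theorem isCob_cores_div {t : G ⧸ H → G} (ht : ∀ i, (t i : G ⧸ H) = i) {H' : Subgroup G}
    (ht' : ∀ i, t i ∈ H') {f f' : G → G → M} (hf' : IsCocycleOn H' f')
    (hff' : ∀ g ∈ H ⊓ H', ∀ k ∈ H ⊓ H', f g k = f' g k) :
    IsCob H' (cores t f * (f' ^ Fintype.card (G ⧸ H))⁻¹) := by
  have hm : ∀ i, ∀ g ∈ H', transversalPart t i g ∈ H ⊓ H' := fun i g hg =>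
    ⟨transversalPart_mem ht i g, H'.mul_mem (H'.mul_mem (H'.inv_mem (ht' _)) hg) (ht' _)⟩
  refine ⟨fun g => ∏ i, (f' (t (g • i)) (transversalPart t i g) * (f' g (t i))⁻¹),
    fun g hg k hk => ?_⟩
  have h1 : ∏ i, (f' (t (g • i)) (transversalPart t i g) * (f' g (t i))⁻¹) =
      ∏ i, (f' (t ((g * k) • i)) (transversalPart t (k • i) g) * (f' g (t (k • i)))⁻¹) := by
    symm
    exact Fintype.prod_equiv (MulAction.toPerm k) _ _ fun i => by
      simp only [MulAction.toPerm_apply, mul_smul]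
  beta_reduce
  rw [h1, Finset.smul_prod', ← Finset.prod_mul_distrib, Pi.mul_apply, Pi.mul_apply, Pi.inv_apply,
    Pi.inv_apply, Pi.pow_apply, Pi.pow_apply, ← Finset.card_univ, ← Finset.prod_const,
    ← Finset.prod_inv_distrib, cores, ← Finset.prod_mul_distrib, ← Finset.prod_mul_distrib]
  refine Finset.prod_congr rfl fun i _ => ?_
  rw [hff' _ (hm _ _ hg) _ (hm _ _ hk)]
  set x := t ((g * k) • i) with hx
  set y := t (k • i) with hy
  set a := transversalPart t (k • i) g with ha
  set b := transversalPart t i k with hb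
  have hxa : x * a = g * y := by
    simp only [hx, ha, hy, transversalPart, mul_smul]
    group
  have hyb : y * b = k * t i := by
    simp only [hy, hb, transversalPart]
    group
  have c1 := hf' x (ht' _) a (hm _ _ hg).2 b (hm _ _ hk).2
  have c2 := hf' g hg y (ht' _) b (hm _ _ hk).2
  have c3 := hf' g hg k hk (t i) (ht' _)
  rw [transversalPart_mul, ← ha, ← hb]
  rw [hxa] at c1
  rw [hyb] at c2
  rw [smul_mul', smul_inv']
  have e1 : x • f' a b = f' x a * f' (g * y) b * (f' x (a * b))⁻¹ := by
    rw [c1]; group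
  have e2 : f' (g * y) b = (f' g y)⁻¹ * (g • f' y b * f' g (k * t i)) := by
    rw [← c2]; group
  have e3 : f' g (k * t i) = (g • f' k (t i))⁻¹ * (f' g k * f' (g * k) (t i)) := by
    rw [c3]; group
  rw [e1, e2, e3]
  generalize f' x a = A
  generalize f' g y = B
  generalize g • f' y b = C
  generalize g • f' k (t i) = D
  generalize f' g k = E
  generalize f' (g * k) (t i) = X
  generalize f' x (a * b) = Y
  have : A * (B⁻¹ * (C * (D⁻¹ * (E * X)))) * Y⁻¹ * E⁻¹ * (Y * X⁻¹) =
      A * B⁻¹ * (C * D⁻¹) * (E * E⁻¹) * (X * X⁻¹) * (Y⁻¹ * Y) := by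
    simp only [mul_assoc, mul_left_comm, mul_comm]
  rw [this]
  simp

omit [Fintype (G ⧸ H)] in
theorem IsCob.of_pow_modEq {f : G → G → M} {N n : ℕ} (hf : IsCob H (f ^ N)) (hn : n ≡ 1 [MOD N]) :
    IsCob H (f ^ n * f⁻¹) := by
  obtain ⟨a, b, hab⟩ : ∃ a b, n + N * a = 1 + N * b := by
    rcases le_total 1 n with h | h
    · obtain ⟨b, hb⟩ := (Nat.modEq_iff_dvd' h).1 hn.symm
      exact ⟨0, b, by omega⟩
    · obtain ⟨b, hb⟩ := (Nat.modEq_iff_dvd' h).1 hn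
      exact ⟨b, 0, by omega⟩
  have h := (hf.pow b).mul (hf.pow a).inv
  rw [← pow_mul, ← pow_mul] at h
  have e : f ^ n * f⁻¹ = f ^ (N * b) * (f ^ (N * a))⁻¹ := by
    rw [eq_mul_inv_iff_mul_eq, mul_right_comm, ← pow_add, hab, pow_add, pow_one, mul_comm,
      inv_mul_cancel_left]
  rwa [e]

omit [Fintype (G ⧸ H)] in
/-- A cocycle class which is stable with respect to a second subgroup comes from the whole
group, as far as `p`-primary components are concerned. -/
theorem exists_stable_cocycle [Finite G] {p : ℕ} (hp : p.Prime) {H' : Subgroup G}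
    (hHH' : ∀ g : G, ∃ h ∈ H', h⁻¹ * g ∈ H) {f f' : G → G → M} (hf : IsCocycleOn H f)
    (hf' : IsCocycleOn H' f') (hc : p.Coprime H.index) {w : ℕ} (hw : p.Coprime w)
    (hcob : IsCob (H ⊓ H') ((f * f'⁻¹) ^ w)) :
    ∃ φ : G → G → M, IsCocycleOn ⊤ φ ∧
      (∀ Q : Subgroup G, Q ≤ H' → IsPGroup p Q → IsCob Q (φ * f'⁻¹)) ∧
      ∀ P : Subgroup G, p.Coprime (Nat.card P) → IsCob P φ := by
  classical
  have := Fact.mk hp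
  have := Fintype.ofFinite G
  have : Fintype (G ⧸ H) := Fintype.ofFinite _
  choose t₀ ht₀ ht₀' using fun i : G ⧸ H => hHH' i.out
  have ht : ∀ i, (t₀ i : G ⧸ H) = i := fun i => by
    conv_rhs => rw [← i.out_eq']
    exact QuotientGroup.eq.2 (ht₀' i)
  obtain ⟨s, m, hpm, hG⟩ := Nat.exists_eq_pow_mul_and_not_dvd (Nat.card_pos (α := G)).ne' p hp.ne_one
  have hpm' : p.Coprime m := (Nat.Prime.coprime_iff_not_dvd hp).2 hpm
  -- Raising to the power `z` keeps classes of order dividing `p ^ s` and kills those of order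
  -- dividing `m * w`.
  obtain ⟨z, hz1, hz2⟩ := Nat.chineseRemainder
    (Nat.Coprime.pow_left s (Nat.Coprime.mul_right hpm' hw)) 1 0
  rw [Nat.modEq_zero_iff_dvd] at hz2
  have hcard : Fintype.card (G ⧸ H) = H.index := by
    rw [Subgroup.index, Nat.card_eq_fintype_card]
  -- The power `y` will undo the multiplication by the index that corestriction introduces.
  obtain ⟨y, hy⟩ : ∃ y, Fintype.card (G ⧸ H) * y ≡ 1 [MOD p ^ s] := by
    rw [hcard]
    have h2 := Nat.Coprime.pow_left s hc
    by_cases h1 : p ^ s = 1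
    · exact ⟨0, by rw [h1]; exact Nat.modEq_one⟩
    · obtain ⟨y, hy⟩ := Nat.exists_mul_mod_eq_one_of_coprime h2.symm
        (lt_of_le_of_ne (Nat.one_le_iff_ne_zero.2 (pow_ne_zero _ hp.ne_zero)) (Ne.symm h1))
      exact ⟨y, by
        rw [Nat.ModEq, hy.2, Nat.mod_eq_of_lt]
        exact lt_of_le_of_ne (Nat.one_le_iff_ne_zero.2 (pow_ne_zero _ hp.ne_zero)) (Ne.symm h1)⟩
  have hzD : IsCob (H ⊓ H') (f ^ z * (f' ^ z)⁻¹) := by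
    obtain ⟨d, hd⟩ := hz2
    have := hcob.pow (m * d)
    rw [← pow_mul] at this
    rw [← inv_pow, ← mul_pow, hd]
    convert this using 2
    ring
  obtain ⟨b, hb⟩ := hzD
  -- Correcting by a coboundary makes the two cocycles equal, not merely cohomologous, on the
  -- intersection, as `isCob_cores_div` demands.
  let f₁ : G → G → M := f' ^ z * cob b
  have hf₁ : IsCocycleOn H' f₁ := (hf'.pow z).mul (isCocycleOn_cob _ b)
  have hff₁ : ∀ g ∈ H ⊓ H', ∀ k ∈ H ⊓ H', (f ^ z) g k = f₁ g k := fun g hg k hk => by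
    have h := hb g hg k hk
    simp only [f₁, cob, Pi.mul_apply, Pi.inv_apply] at h ⊢
    rw [← h, mul_assoc (_ * _), mul_inv_cancel, mul_one, mul_left_comm, mul_inv_cancel, mul_one]
  have key := isCob_cores_div ht ht₀ hf₁ hff₁
  refine ⟨cores t₀ (f ^ z) ^ y, (isCocycleOn_cores ht (hf.pow z)).pow y, fun Q hQ hQp => ?_,
    fun P hP => ?_⟩
  · have h1 := ((key.mono hQ).pow y).mul ((isCob_cob Q b).pow (Fintype.card (G ⧸ H) * y))
    have hcardQ : Nat.card Q ∣ p ^ s := by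
      obtain ⟨e, he⟩ := hQp.exists_card_eq
      have h2 : Nat.card Q ∣ Nat.card G := Subgroup.card_subgroup_dvd_card Q
      rw [hG] at h2
      rw [he] at h2 ⊢
      exact (Nat.Coprime.pow_left e hpm').dvd_of_dvd_mul_right h2
    have h3 : z * (Fintype.card (G ⧸ H) * y) ≡ 1 [MOD Nat.card Q] :=
      (by simpa using hz1.mul hy : _ ≡ 1 [MOD p ^ s]).of_dvd hcardQ
    have h4 := (hf'.mono hQ).isCob_pow_card.of_pow_modEq h3
    convert h1.mul h4 using 1
    rw [mul_pow, inv_pow, ← pow_mul, mul_pow, ← pow_mul, mul_inv, mul_assoc (cores t₀ (f ^ z) ^ y),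
      inv_mul_cancel_right, mul_assoc, inv_mul_cancel_left]
  -- A subgroup of order prime to `p` has order dividing `m`, hence dividing `z`.
  · have h1 : Nat.card P ∣ z := by
      refine dvd_trans ?_ ((dvd_mul_right m w).trans hz2)
      have h2 : Nat.card P ∣ Nat.card G := Subgroup.card_subgroup_dvd_card P
      rw [hG] at h2
      exact (Nat.Coprime.pow_left s hP).symm.dvd_of_dvd_mul_left h2
    obtain ⟨d, hd⟩ := h1
    rw [cores_pow, ← pow_mul, hd, mul_assoc, pow_mul]
    exact ((isCocycleOn_cores ht hf).mono le_top).isCob_pow_card.pow _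

end Cocycles

/-! ### Projective semilinear representations and Galois descent -/

section Semilinear

/-- A family of semilinear bijections indexed by the automorphisms of the coefficient field. -/
structure SemilinearFamily (F N V : Type*) [Field F] [Field N] [Algebra F N] [AddCommGroup V]
    [Module N V] where
  /-- The bijection which belongs to an automorphism. -/
  toFun : (N ≃ₐ[F] N) → V ≃+ V
  semilinear : ∀ g (c : N) v, toFun g (c • v) = g c • toFun g v

variable {F N V V' : Type*} [Field F] [Field N] [Algebra F N] [AddCommGroup V] [Module N V]
  [AddCommGroup V'] [Module N V']

instance : CoeFun (SemilinearFamily F N V) fun _ => (N ≃ₐ[F] N) → V ≃+ V := ⟨fun τ => τ.toFun⟩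

namespace SemilinearFamily

/-- The family is multiplicative on a subgroup up to the scalars `f`. -/
def HasMultiplier (τ : SemilinearFamily F N V) (H : Subgroup (N ≃ₐ[F] N))
    (f : (N ≃ₐ[F] N) → (N ≃ₐ[F] N) → Nˣ) : Prop :=
  ∀ g ∈ H, ∀ h ∈ H, ∀ v, τ g (τ h v) = (f g h : N) • τ (g * h) v

theorem HasMultiplier.mono {τ : SemilinearFamily F N V} {H H' : Subgroup (N ≃ₐ[F] N)}
    {f : (N ≃ₐ[F] N) → (N ≃ₐ[F] N) → Nˣ} (h : τ.HasMultiplier H f) (hH : H' ≤ H) :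
    τ.HasMultiplier H' f := fun g hg k hk => h g (hH hg) k (hH hk)

theorem coe_smul_units (g : N ≃ₐ[F] N) (u : Nˣ) : ((g • u : Nˣ) : N) = g u := rfl

theorem symm_smul (τ : SemilinearFamily F N V) (g : N ≃ₐ[F] N) (c : N) (v : V) :
    (τ g).symm (c • v) = g⁻¹ c • (τ g).symm v := by
  apply (τ g).injective
  rw [τ.semilinear, AddEquiv.apply_symm_apply, AddEquiv.apply_symm_apply]
  congr 1
  exact (g.apply_symm_apply c).symm

/-- Evaluating a composite of three operators at a nonzero vector in two ways gives the cocycle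
identity. -/
theorem HasMultiplier.isCocycleOn [Nontrivial V] {τ : SemilinearFamily F N V}
    {H : Subgroup (N ≃ₐ[F] N)} {f : (N ≃ₐ[F] N) → (N ≃ₐ[F] N) → Nˣ}
    (hf : τ.HasMultiplier H f) : IsCocycleOn H f := by
  intro g hg h hh k hk
  obtain ⟨v, hv⟩ := exists_ne (0 : V)
  have h1 : τ g (τ h (τ k v)) = ((f g h : N) * f (g * h) k) • τ (g * h * k) v := by
    rw [hf g hg h hh, hf _ (H.mul_mem hg hh) k hk, smul_smul]
  have h2 : τ g (τ h (τ k v)) = (g (f h k : N) * f g (h * k)) • τ (g * h * k) v := by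
    rw [hf h hh k hk, τ.semilinear, hf g hg _ (H.mul_mem hh hk), smul_smul, mul_assoc]
  have h3 : τ (g * h * k) v ≠ 0 := fun h0 => hv ((τ _).injective (by rw [h0, map_zero]))
  have h4 := smul_left_injective N h3 (h1.symm.trans h2)
  exact Units.ext h4

/-- The induced family on the space of homomorphisms. -/
def hom (τ' : SemilinearFamily F N V') (τ : SemilinearFamily F N V) :
    SemilinearFamily F N (V' →ₗ[N] V) where
  toFun g :=
    { toFun := fun X =>
        { toFun := fun v => τ g (X ((τ' g).symm v))
          map_add' := fun v w => by simp
          map_smul' := fun c v => by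
            rw [symm_smul, map_smul, τ.semilinear, RingHom.id_apply]
            congr 1
            exact g.apply_symm_apply c }
      invFun := fun X =>
        { toFun := fun v => (τ g).symm (X (τ' g v))
          map_add' := fun v w => by simp
          map_smul' := fun c v => by
            rw [τ'.semilinear, map_smul, symm_smul, RingHom.id_apply]
            congr 1
            exact g.symm_apply_apply c }
      left_inv := fun X => by ext v; simp
      right_inv := fun X => by ext v; simp
      map_add' := fun X Y => by ext v; simp }
  semilinear g c X := by
    ext v
    exact τ.semilinear g c _

@[simp] theorem hom_apply (τ' : SemilinearFamily F N V') (τ : SemilinearFamily F N V)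
    (g : N ≃ₐ[F] N) (X : V' →ₗ[N] V) (v : V') : τ'.hom τ g X v = τ g (X ((τ' g).symm v)) := rfl

theorem HasMultiplier.hom {τ' : SemilinearFamily F N V'} {τ : SemilinearFamily F N V}
    {H : Subgroup (N ≃ₐ[F] N)} {f f' : (N ≃ₐ[F] N) → (N ≃ₐ[F] N) → Nˣ}
    (hf : τ.HasMultiplier H f) (hf' : τ'.HasMultiplier H f') :
    (τ'.hom τ).HasMultiplier H (f * f'⁻¹) := by
  intro g hg h hh X
  ext v
  obtain ⟨w, rfl⟩ := (τ' (g * h)).surjective v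
  have h1 : τ' (g * h) w = τ' g (τ' h (((g * h)⁻¹ ((f' g h)⁻¹ : Nˣ) : N) • w)) := by
    rw [hf' g hg h hh, τ'.semilinear, smul_smul]
    have : (g * h) ((g * h)⁻¹ ((f' g h)⁻¹ : Nˣ) : N) = ((f' g h)⁻¹ : Nˣ) :=
      (g * h).apply_symm_apply _
    rw [this, Units.mul_inv, one_smul]
  rw [hom_apply, hom_apply, LinearMap.smul_apply, hom_apply, AddEquiv.symm_apply_apply, h1,
    AddEquiv.symm_apply_apply, AddEquiv.symm_apply_apply, hf g hg h hh, map_smul, τ.semilinear,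
    smul_smul]
  congr 1
  rw [Pi.mul_apply, Pi.mul_apply, Units.val_mul]
  congr 1
  exact (g * h).apply_symm_apply _

/-- Multiplication of a semilinear family by scalars. -/
def rescale (τ : SemilinearFamily F N V) (b : (N ≃ₐ[F] N) → Nˣ) : SemilinearFamily F N V where
  toFun g := (τ g).trans (DistribMulAction.toAddEquiv V (b g))
  semilinear g c v := by
    simp only [AddEquiv.trans_apply, DistribMulAction.toAddEquiv_apply, τ.semilinear]
    rw [smul_comm]

theorem rescale_apply (τ : SemilinearFamily F N V) (b : (N ≃ₐ[F] N) → Nˣ) (g : N ≃ₐ[F] N) (v : V) :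
    τ.rescale b g v = (b g : N) • τ g v := rfl

theorem HasMultiplier.rescale {τ : SemilinearFamily F N V}
    {H : Subgroup (N ≃ₐ[F] N)} {f : (N ≃ₐ[F] N) → (N ≃ₐ[F] N) → Nˣ}
    (hf : τ.HasMultiplier H f) (b : (N ≃ₐ[F] N) → Nˣ) :
    (τ.rescale b).HasMultiplier H (f * cob b) := by
  intro g hg h hh v
  simp only [rescale_apply, τ.semilinear]
  rw [hf g hg h hh, smul_smul, smul_smul, smul_smul]
  congr 1
  rw [Pi.mul_apply, Pi.mul_apply, cob]
  simp only [Units.val_mul, coe_smul_units]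
  have : ((b (g * h))⁻¹ : Nˣ) * (b (g * h) : N) = 1 := Units.inv_mul _
  linear_combination (-(f g h * b g * g (b h)) : N) * this

theorem HasMultiplier.congr {τ : SemilinearFamily F N V}
    {H : Subgroup (N ≃ₐ[F] N)} {f f' : (N ≃ₐ[F] N) → (N ≃ₐ[F] N) → Nˣ}
    (hf : τ.HasMultiplier H f) (h : ∀ g ∈ H, ∀ k ∈ H, f g k = f' g k) : τ.HasMultiplier H f' :=
  fun g hg k hk v => by rw [hf g hg k hk, h g hg k hk]

/-- A family whose multiplier is a product with a coboundary can be rescaled. -/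
theorem HasMultiplier.exists_rescale {τ : SemilinearFamily F N V}
    {H : Subgroup (N ≃ₐ[F] N)} {f f' : (N ≃ₐ[F] N) → (N ≃ₐ[F] N) → Nˣ}
    (hf : τ.HasMultiplier H f) (h : IsCob H (f * f'⁻¹)) :
    ∃ b : (N ≃ₐ[F] N) → Nˣ, (τ.rescale b).HasMultiplier H f' := by
  obtain ⟨b, hb⟩ := h
  refine ⟨b⁻¹, (hf.rescale b⁻¹).congr fun g hg k hk => ?_⟩
  have h1 := hb g hg k hk
  simp only [Pi.mul_apply, Pi.inv_apply, cob, smul_inv', inv_inv] at h1 ⊢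
  rw [← mul_inv, ← h1, mul_inv_rev, mul_inv_rev, inv_inv, mul_comm _ (b _), mul_inv_cancel_left,
    mul_comm, inv_mul_cancel_right]

/-- Take determinants of the matrices of the operators: the relation `A g * g (A h) = f g h • A (g *
h)` turns into a coboundary relation for `f ^ dim V`. -/
theorem HasMultiplier.isCob_pow_finrank [FiniteDimensional N V] {τ : SemilinearFamily F N V}
    {H : Subgroup (N ≃ₐ[F] N)} {f : (N ≃ₐ[F] N) → (N ≃ₐ[F] N) → Nˣ}
    (hf : τ.HasMultiplier H f) : IsCob H (f ^ Module.finrank N V) := by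
  let b := Module.finBasis N V
  let A : (N ≃ₐ[F] N) → Matrix (Fin (Module.finrank N V)) (Fin (Module.finrank N V)) N :=
    fun g => Matrix.of fun i j => b.repr (τ g (b j)) i
  have hA : ∀ g j, τ g (b j) = ∑ i, A g i j • b i := fun g j => (b.sum_repr _).symm
  have hmul : ∀ g ∈ H, ∀ h ∈ H, A g * (A h).map g = (f g h : N) • A (g * h) := by
    intro g hg h hh
    ext i j
    have h1 := hf g hg h hh (b j)
    have h2 := congrArg (fun v => b.repr v i) h1
    rw [hA h j, map_sum] at h2
    simp only [τ.semilinear, map_sum, map_smul, Finsupp.coe_finsetSum, Finsupp.coe_smul,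
      Finset.sum_apply, Pi.smul_apply, smul_eq_mul] at h2
    rw [Matrix.smul_apply, Matrix.mul_apply, smul_eq_mul]
    simp only [Matrix.map_apply]
    rw [← show b.repr (τ (g * h) (b j)) i = A (g * h) i j from rfl, ← h2]
    exact Finset.sum_congr rfl fun k _ => mul_comm _ _
  have hone : A 1 = (f 1 1 : N) • 1 := by
    have h1 : ∀ v, τ 1 v = (f 1 1 : N) • v := fun v => by
      apply (τ 1).injective
      rw [hf 1 H.one_mem 1 H.one_mem, τ.semilinear]
      simp
    ext i j
    change b.repr (τ 1 (b j)) i = _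
    rw [h1, _root_.map_smul]
    simp [Matrix.one_apply, Finsupp.single_apply, eq_comm]
  have hdet : ∀ g ∈ H, ∀ h ∈ H, (A g).det * g (A h).det =
      (f g h : N) ^ Module.finrank N V * (A (g * h)).det := by
    intro g hg h hh
    have h1 := congrArg Matrix.det (hmul g hg h hh)
    rw [Matrix.det_mul, Matrix.det_smul, Fintype.card_fin] at h1
    rw [← h1]
    congr 1
    exact RingHom.map_det (g : N →+* N) (A h)
  have hne : ∀ g ∈ H, (A g).det ≠ 0 := by
    intro g hg h0
    have h1 := hdet g hg g⁻¹ (H.inv_mem hg)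
    rw [h0, zero_mul, mul_inv_cancel, hone, Matrix.det_smul, Matrix.det_one, mul_one] at h1
    exact mul_ne_zero (pow_ne_zero _ (Units.ne_zero _)) (pow_ne_zero _ (Units.ne_zero _)) h1.symm
  classical
  refine ⟨fun g => if hg : (A g).det ≠ 0 then Units.mk0 _ hg else 1, fun g hg h hh => ?_⟩
  beta_reduce
  rw [dif_pos (hne g hg), dif_pos (hne h hh), dif_pos (hne _ (H.mul_mem hg hh))]
  apply Units.ext
  simp only [Pi.pow_apply, Units.val_mul, Units.val_pow_eq_pow_val, Units.val_mk0, coe_smul_units]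
  exact (hdet g hg h hh).symm

/-- A linear form that vanishes on all traces `∑ g, τ g (c • x)` gives a linear relation between
automorphisms, so by Dedekind's lemma it vanishes at `x`. -/
theorem span_fixed_eq_top [FiniteDimensional F N] [FiniteDimensional N V]
    {τ : SemilinearFamily F N V} {Q : Subgroup (N ≃ₐ[F] N)} (hτ : τ.HasMultiplier Q 1) :
    Submodule.span N {v : V | ∀ g ∈ Q, τ g v = v} = ⊤ := by
  classical
  by_contra hne
  obtain ⟨ℓ, hℓ, hℓ'⟩ := Submodule.exists_le_ker_of_lt_top _ (lt_top_iff_ne_top.2 hne)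
  apply hℓ
  ext x
  have := Fintype.ofFinite (N ≃ₐ[F] N)
  have hτ1 : τ 1 x = x := by
    apply (τ 1).injective
    have := hτ 1 Q.one_mem 1 Q.one_mem x
    simpa using this
  have hfix : ∀ c : N, (∑ g : Q, τ g (c • x)) ∈ {v : V | ∀ g ∈ Q, τ g v = v} := by
    intro c g hg
    rw [map_sum]
    refine Fintype.sum_equiv (Equiv.mulLeft (⟨g, hg⟩ : Q)) _ _ fun h => ?_
    have := hτ g hg h h.2 (c • x)
    simpa using this
  have hzero : ∀ c : N, ∑ g : Q, ℓ (τ g x) * (g : N ≃ₐ[F] N) c = 0 := by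
    intro c
    have h1 := hℓ' (Submodule.subset_span (hfix c))
    rw [LinearMap.mem_ker, map_sum] at h1
    rw [← h1]
    refine Finset.sum_congr rfl fun g _ => ?_
    rw [τ.semilinear, map_smul, smul_eq_mul, mul_comm]
  have hlin : LinearIndependent N (fun g : Q => ((g : N ≃ₐ[F] N) : N → N)) := by
    have := (linearIndependent_monoidHom N N).comp
      (fun g : Q => (((g : N ≃ₐ[F] N) : N →+* N) : N →* N)) (fun g h hgh => by
        apply Subtype.ext
        ext c
        exact congrArg (fun φ : N →* N => φ c) hgh)
    exact this
  have h2 := Fintype.linearIndependent_iff.1 hlin (fun g => ℓ (τ g x)) (by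
    funext c
    have := hzero c
    simpa [Finset.sum_apply] using this) ⟨1, Q.one_mem⟩
  change ℓ (τ 1 x) = 0 at h2
  rw [hτ1] at h2
  exact h2

/-- Galois descent for vector spaces. -/
theorem exists_basis_fixed [FiniteDimensional F N] [FiniteDimensional N V]
    {τ : SemilinearFamily F N V} {Q : Subgroup (N ≃ₐ[F] N)} (hτ : τ.HasMultiplier Q 1) :
    ∃ b : Module.Basis (Fin (Module.finrank N V)) N V, ∀ i, ∀ g ∈ Q, τ g (b i) = b i := by
  have hspan := (span_fixed_eq_top hτ).ge
  let b₀ := Module.Basis.ofSpan hspan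
  have hb₀ : ∀ i, b₀ i ∈ {v : V | ∀ g ∈ Q, τ g v = v} := fun i =>
    Module.Basis.ofSpan_subset hspan ⟨i, rfl⟩
  have := Module.Finite.finite_basis b₀
  have := Fintype.ofFinite ((linearIndepOn_empty N id).extend
    (Set.empty_subset {v : V | ∀ g ∈ Q, τ g v = v}))
  let e := Fintype.equivFinOfCardEq (Module.finrank_eq_card_basis b₀).symm
  exact ⟨b₀.reindex e, fun i => by
    rw [Module.Basis.reindex_apply]
    exact hb₀ _⟩

/-- In a fixed basis, a vector is fixed exactly when its coordinates lie in the fixed field. -/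
theorem finrank_fixed [FiniteDimensional F N] [FiniteDimensional N V] [Module F V]
    [IsScalarTower F N V]
    {τ : SemilinearFamily F N V} {Q : Subgroup (N ≃ₐ[F] N)} (hτ : τ.HasMultiplier Q 1)
    (Y : Submodule F V) (hY : ∀ v, v ∈ Y ↔ ∀ g ∈ Q, τ g v = v) :
    Module.finrank F Y =
      Module.finrank F (IntermediateField.fixedField Q) * Module.finrank N V := by
  obtain ⟨b, hb⟩ := exists_basis_fixed hτ
  have hcoe : ∀ g ∈ Q, ∀ v, ∀ i, b.repr (τ g v) i = g (b.repr v i) := by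
    intro g hg v i
    conv_lhs => rw [← b.sum_repr v, map_sum]
    simp only [τ.semilinear, hb _ g hg, map_sum, map_smul, Module.Basis.repr_self]
    simp [Finsupp.single_apply]
  let e : Y ≃ₗ[F] (Fin (Module.finrank N V) → IntermediateField.fixedField Q) :=
    { toFun := fun v i => ⟨b.repr v i, fun g => by
        have h1 := hcoe g g.2 v i
        rw [(hY v).1 v.2 g g.2] at h1
        exact h1.symm⟩
      map_add' := fun v w => by
        funext i
        apply Subtype.ext
        simp
      map_smul' := fun c v => by
        funext i
        apply Subtype.ext
        have : c • (v : V) = algebraMap F N c • (v : V) := by rw [algebraMap_smul]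
        change b.repr (c • (v : V)) i = c • b.repr (v : V) i
        rw [this, map_smul, Finsupp.smul_apply, algebraMap_smul]
      invFun := fun c => ⟨∑ i, (c i : N) • b i, (hY _).2 fun g hg => by
        rw [map_sum]
        refine Finset.sum_congr rfl fun i _ => ?_
        rw [τ.semilinear, hb i g hg]
        congr 1
        exact (c i).2 ⟨g, hg⟩⟩
      left_inv := fun v => Subtype.ext (b.sum_repr v)
      right_inv := fun c => by
        funext i
        apply Subtype.ext
        simp [Finsupp.single_apply] }
  rw [e.finrank_eq, Module.finrank_pi_fintype]
  simp [mul_comm]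

end SemilinearFamily

end Semilinear

/-! ### Splitting representations over a field containing a maximal subfield -/

section Splitting

variable {L N S V : Type*} [Field L] [Field N] [Algebra L N] [DivisionRing S] [Algebra L S]
  [AddCommGroup V] [Module N V] [Module L V] [IsScalarTower L N V]

/-- Right multiplication makes `S` a space over the maximal subfield `K` of dimension `[K : L]`, on
which left multiplications are `K`-linear; then map matrix entries from `K` to `N`. -/
theorem exists_splitting_rep {K : Type*} [Field K] [Algebra L K] [FiniteDimensional L S]
    (ι : K →ₐ[L] S) (j : K →ₐ[L] N)
    (hK : Module.finrank L K ^ 2 = Module.finrank L S) :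
    Nonempty (S →ₐ[L] Module.End N (Fin (Module.finrank L K) → N)) := by
  let _ : Module K S := 
    { smul := fun k s => s * ι k
      one_smul := fun s => by change s * ι 1 = s; simp
      mul_smul := fun a b s => by
        change s * ι (a * b) = s * ι b * ι a
        rw [mul_comm a b, map_mul, mul_assoc]
      smul_zero := fun a => zero_mul _
      smul_add := fun a s t => add_mul _ _ _
      add_smul := fun a b s => by
        change s * ι (a + b) = s * ι a + s * ι b
        rw [map_add, mul_add]
      zero_smul := fun s => by change s * ι 0 = 0; simp }
  have hsm : ∀ (k : K) (s : S), k • s = s * ι k := fun _ _ => rfl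
  have : IsScalarTower L K S := ⟨fun l k s => by simp [hsm]⟩
  have : Module.Finite L K := by
    apply Module.finite_of_finrank_pos
    have : 0 < Module.finrank L S := Module.finrank_pos
    rw [← hK] at this
    exact Nat.pos_of_ne_zero fun h => by simp [h] at this
  have : Module.Finite K S := Module.Finite.of_restrictScalars_finite L K S
  have hrank : Module.finrank K S = Module.finrank L K := by
    have h := Module.finrank_mul_finrank L K S
    rw [← hK, sq] at h
    exact Nat.eq_of_mul_eq_mul_left Module.finrank_pos h
  let b : Module.Basis (Fin (Module.finrank L K)) K S := Module.finBasisOfFinrankEq K S hrank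
  let ρ₁ : S →ₐ[L] Module.End K S :=
    { toFun := fun s =>
        { toFun := fun x => s * x
          map_add' := mul_add s
          map_smul' := fun k x => (mul_assoc s x (ι k)).symm }
      map_one' := by ext x; exact one_mul x
      map_mul' := fun s t => by ext x; exact mul_assoc s t x
      map_zero' := by ext x; exact zero_mul x
      map_add' := fun s t => by ext x; exact add_mul s t x
      commutes' := fun l => by
        ext x
        exact (Algebra.smul_def l x).symm }
  let ρ₂ : S →ₐ[L] Matrix (Fin (Module.finrank L K)) (Fin (Module.finrank L K)) K :=
    ((LinearMap.toMatrixAlgEquiv b).restrictScalars L : Module.End K S →ₐ[L] _).comp ρ₁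
  exact ⟨((Matrix.toLinAlgEquiv' (R := N) (n := Fin (Module.finrank L K))).restrictScalars L :
    _ →ₐ[L] Module.End N (Fin (Module.finrank L K) → N)).comp (j.mapMatrix.comp ρ₂)⟩

variable [FiniteDimensional N V] [FiniteDimensional L S] [Algebra.IsCentral L S]

/-- The extension of a representation over a splitting field to an isomorphism. -/
theorem exists_algEquiv_of_rep (ρ : S →ₐ[L] Module.End N V)
    (h : Module.finrank N V ^ 2 = Module.finrank L S) :
    ∃ e : N ⊗[L] S ≃ₐ[N] Module.End N V, ∀ c x, e (c ⊗ₜ x) = c • ρ x := by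
  let φ : N ⊗[L] S →ₐ[N] Module.End N V :=
    Algebra.TensorProduct.lift (Algebra.ofId N _) ρ fun c x => Algebra.commutes c (ρ x)
  have hφ : ∀ c x, φ (c ⊗ₜ x) = c • ρ x := fun c x => by
    refine (Algebra.TensorProduct.lift_tmul _ _ _ _ _).trans ?_
    rw [Algebra.ofId_apply, Algebra.smul_def]
  have hne : 0 < Module.finrank N V := by
    have : 0 < Module.finrank L S := Module.finrank_pos
    rw [← h] at this
    exact Nat.pos_of_ne_zero fun h => by simp [h] at this
  have : Nontrivial V := Module.nontrivial_of_finrank_pos hne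
  have hinj : Function.Injective φ := RingHom.injective (φ : N ⊗[L] S →+* Module.End N V)
  have hbij : Function.Bijective φ := by
    refine ⟨hinj, ?_⟩
    refine (LinearMap.injective_iff_surjective_of_finrank_eq_finrank (f := φ.toLinearMap) ?_).1 hinj
    rw [Module.finrank_baseChange, Module.finrank_linearMap, ← h, sq]
  exact ⟨AlgEquiv.ofBijective φ hbij, hφ⟩

theorem exists_eq_smul_of_commute (ρ : S →ₐ[L] Module.End N V)
    (h : Module.finrank N V ^ 2 = Module.finrank L S) (X : V →ₗ[N] V)
    (hX : ∀ s v, X (ρ s v) = ρ s (X v)) : ∃ c : N, ∀ v, X v = c • v := by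
  obtain ⟨e, he⟩ := exists_algEquiv_of_rep ρ h
  have hcomm : X ∈ Subalgebra.center N (Module.End N V) := by
    rw [Subalgebra.mem_center_iff]
    intro Y
    obtain ⟨y, rfl⟩ := e.surjective Y
    induction y using TensorProduct.induction_on with
    | zero => simp
    | tmul c s =>
      rw [he]
      ext v
      simp [hX]
    | add a b ha hb => rw [map_add, add_mul, mul_add, ha, hb]
  rw [Algebra.IsCentral.center_eq_bot, Algebra.mem_bot] at hcomm
  obtain ⟨c, rfl⟩ := hcomm
  exact ⟨c, fun v => rfl⟩

end Splitting

/-! ### The cocycle of a central division algebra -/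

section Twisted

variable (F L N : Type*) [Field F] [Field L] [Field N] [Algebra F L] [Algebra F N] [Algebra L N]
  [IsScalarTower F L N]

/-- The automorphisms which fix the image of a subfield. -/
def fixing : Subgroup (N ≃ₐ[F] N) := ((IsScalarTower.toAlgHom F L N).fieldRange).fixingSubgroup

variable {F L N}

theorem mem_fixing {g : N ≃ₐ[F] N} :
    g ∈ fixing F L N ↔ ∀ l : L, g (algebraMap L N l) = algebraMap L N l := by
  rw [fixing, IntermediateField.mem_fixingSubgroup_iff]
  constructor
  · exact fun h l => h _ ⟨l, rfl⟩
  · rintro h _ ⟨l, rfl⟩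
    exact h l

theorem index_fixing [IsGalois F N] [FiniteDimensional F N] :
    (fixing F L N).index = Module.finrank F L := by
  rw [fixing, ← IntermediateField.finrank_eq_fixingSubgroup_index]
  exact (AlgEquiv.ofInjectiveField (IsScalarTower.toAlgHom F L N)).toLinearEquiv.finrank_eq.symm

variable (F N) in
/-- The coordinatewise action. -/
def coordFamily (a : ℕ) : SemilinearFamily F N (Fin a → N) where
  toFun g :=
    { toFun := fun v i => g (v i)
      invFun := fun v i => g.symm (v i)
      left_inv := fun v => by ext; simp
      right_inv := fun v => by ext; simp
      map_add' := fun v w => by ext; simp }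
  semilinear g c v := by ext; simp

variable {S : Type*} [DivisionRing S] [Algebra L S] [FiniteDimensional L S] [Algebra.IsCentral L S]

/-- Twisting `ρ` by `g` gives a second splitting representation. Both extend to isomorphisms from `N
⊗ S` onto `End V`, whose comparison is conjugation by some `T`; then `T⁻¹ ∘ g` commutes with `ρ`. -/
theorem exists_semilinear_of_mem_fixing {a : ℕ} (ρ : S →ₐ[L] Module.End N (Fin a → N))
    (ha : a ^ 2 = Module.finrank L S) (g : N ≃ₐ[F] N) (hg : g ∈ fixing F L N) :
    ∃ t : (Fin a → N) ≃+ (Fin a → N), (∀ (c : N) v, t (c • v) = g c • t v) ∧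
      ∀ x v, t (ρ x v) = ρ x (t v) := by
  have ha' : Module.finrank N (Fin a → N) ^ 2 = Module.finrank L S := by simpa using ha
  let γ := coordFamily F N a
  let ρg : S →ₐ[L] Module.End N (Fin a → N) :=
    { toFun := fun x => γ.hom γ g (ρ x)
      map_one' := by
        rw [map_one]
        refine LinearMap.ext fun v => ?_
        exact (γ g).apply_symm_apply v
      map_mul' := fun x y => by
        rw [map_mul]
        refine LinearMap.ext fun v => ?_
        change γ g (ρ x (ρ y ((γ g).symm v))) =
          γ g (ρ x ((γ g).symm (γ g (ρ y ((γ g).symm v)))))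
        rw [AddEquiv.symm_apply_apply]
      map_zero' := by rw [map_zero, map_zero]
      map_add' := fun x y => by rw [map_add, map_add]
      commutes' := fun l => by
        rw [AlgHom.commutes, IsScalarTower.algebraMap_apply L N (Module.End N (Fin a → N)),
          Algebra.algebraMap_eq_smul_one, (γ.hom γ).semilinear, mem_fixing.1 hg]
        congr 1
        refine LinearMap.ext fun v => ?_
        exact (γ g).apply_symm_apply v }
  have hρg : ∀ x v, ρg x v = γ g (ρ x ((γ g).symm v)) := fun _ _ => rfl
  obtain ⟨e, he⟩ := exists_algEquiv_of_rep ρ ha'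
  obtain ⟨e', he'⟩ := exists_algEquiv_of_rep ρg ha'
  obtain ⟨T, hT⟩ := (e.symm.trans e').eq_linearEquivConjAlgEquiv
  have hTx : ∀ x v, T (ρ x v) = ρg x (T v) := by
    intro x v
    have h1 : e.symm (ρ x) = 1 ⊗ₜ x := by
      rw [AlgEquiv.symm_apply_eq, he, one_smul]
    have h2 : (e.symm.trans e') (ρ x) = ρg x := by
      rw [AlgEquiv.trans_apply, h1, he', one_smul]
    rw [hT] at h2
    rw [← h2]
    simp [LinearEquiv.conjAlgEquiv_apply]
  refine ⟨(γ g).trans T.symm.toAddEquiv, fun c v => ?_, fun x v => ?_⟩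
  · change T.symm (γ g (c • v)) = g c • T.symm (γ g v)
    rw [γ.semilinear, map_smul]
  · change T.symm (γ g (ρ x v)) = ρ x (T.symm (γ g v))
    rw [LinearEquiv.symm_apply_eq, hTx, LinearEquiv.apply_symm_apply, hρg,
      AddEquiv.symm_apply_apply]

/-- A splitting representation extends to a projective semilinear representation of the Galois
group. -/
theorem exists_semilinearFamily {a : ℕ} (ρ : S →ₐ[L] Module.End N (Fin a → N))
    (ha : a ^ 2 = Module.finrank L S) : ∃ (τ : SemilinearFamily F N (Fin a → N))
      (f : (N ≃ₐ[F] N) → (N ≃ₐ[F] N) → Nˣ), τ.HasMultiplier (fixing F L N) f ∧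
      ∀ g ∈ fixing F L N, ∀ x v, τ g (ρ x v) = ρ x (τ g v) := by
  classical
  have ha' : Module.finrank N (Fin a → N) ^ 2 = Module.finrank L S := by simpa using ha
  have hne : 0 < Module.finrank N (Fin a → N) := by
    have : 0 < Module.finrank L S := Module.finrank_pos
    rw [← ha'] at this
    exact Nat.pos_of_ne_zero fun h => by simp [h] at this
  have : Nontrivial (Fin a → N) := Module.nontrivial_of_finrank_pos hne
  choose t ht ht' using exists_semilinear_of_mem_fixing (F := F) ρ ha
  -- Outside the subgroup fixing `L` the value is irrelevant; the coordinatewise action fills it in.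
  let τ : SemilinearFamily F N (Fin a → N) :=
    { toFun := fun g => if hg : g ∈ fixing F L N then t g hg else coordFamily F N a g
      semilinear := fun g c v => by
        split_ifs with hg
        · exact ht g hg c v
        · exact (coordFamily F N a).semilinear g c v }
  have hτ : ∀ g (hg : g ∈ fixing F L N), τ g = t g hg := fun g hg => dif_pos hg
  have hτρ : ∀ g ∈ fixing F L N, ∀ x v, τ g (ρ x v) = ρ x (τ g v) := fun g hg x v => by
    rw [hτ g hg, ht' g hg]
  have hτρ' : ∀ g ∈ fixing F L N, ∀ x v, (τ g).symm (ρ x v) = ρ x ((τ g).symm v) :=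
    fun g hg x v => by
      apply (τ g).injective
      rw [hτρ g hg, AddEquiv.apply_symm_apply, AddEquiv.apply_symm_apply]
  have hf : ∀ g h : N ≃ₐ[F] N, g ∈ fixing F L N → h ∈ fixing F L N →
      ∃ c : Nˣ, ∀ v, τ g (τ h v) = (c : N) • τ (g * h) v := by
    intro g h hg hh
    -- The defect of multiplicativity is `N`-linear and commutes with `ρ`, hence it is a scalar.
    let X : (Fin a → N) →ₗ[N] (Fin a → N) :=
      { toFun := fun v => τ g (τ h ((τ (g * h)).symm v))
        map_add' := fun v w => by simp
        map_smul' := fun c v => by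
          rw [τ.symm_smul, τ.semilinear, τ.semilinear]
          congr 1
          exact (g * h).apply_symm_apply c }
    obtain ⟨c, hc⟩ := exists_eq_smul_of_commute ρ ha' X fun x v => by
      change τ g (τ h ((τ (g * h)).symm (ρ x v))) = ρ x (τ g (τ h ((τ (g * h)).symm v)))
      rw [hτρ' _ (mul_mem hg hh), hτρ h hh, hτρ g hg]
    have hc0 : c ≠ 0 := by
      rintro rfl
      obtain ⟨v, hv⟩ := exists_ne (0 : Fin a → N)
      have h1 := hc (τ (g * h) v)
      rw [zero_smul] at h1
      change τ g (τ h ((τ (g * h)).symm (τ (g * h) v))) = 0 at h1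
      rw [AddEquiv.symm_apply_apply, AddEquiv.map_eq_zero_iff, AddEquiv.map_eq_zero_iff] at h1
      exact hv h1
    refine ⟨Units.mk0 c hc0, fun v => ?_⟩
    have h1 := hc (τ (g * h) v)
    change τ g (τ h ((τ (g * h)).symm (τ (g * h) v))) = _ at h1
    rwa [AddEquiv.symm_apply_apply] at h1
  choose f hf using hf
  refine ⟨τ, fun g h => if hgh : g ∈ fixing F L N ∧ h ∈ fixing F L N then f g h hgh.1 hgh.2 else 1,
    fun g hg h hh v => ?_, hτρ⟩
  beta_reduce
  rw [dif_pos ⟨hg, hh⟩]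
  exact hf g h hg hh v

end Twisted

theorem finrank_linearMap_division {F D M V : Type*} [Field F] [DivisionRing D] [Algebra F D]
    [AddCommGroup M] [Module D M] [Module.Finite D M] [AddCommGroup V] [Module F V] [Module D V]
    [SMulCommClass D F V] [Module.Finite F V] :
    Module.finrank F (M →ₗ[D] V) = Module.finrank D M * Module.finrank F V := by
  rw [← ((Module.finBasis D M).constr F (M' := V)).finrank_eq, Module.finrank_pi_fintype]
  simp

/-! ### Counting intertwiners -/

section Intertwiners

variable {F L' N S' D V V' : Type*} [Field F] [Field L'] [Field N] [Algebra F L'] [Algebra F N]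
  [Algebra L' N] [IsScalarTower F L' N] [DivisionRing S'] [Algebra F S'] [Algebra L' S']
  [IsScalarTower F L' S'] [FiniteDimensional L' S'] [Algebra.IsCentral L' S']
  [DivisionRing D] [Algebra F D]
  [AddCommGroup V] [Module N V] [Module F V] [IsScalarTower F N V] [Module L' V]
  [IsScalarTower L' N V]

/-- The space of homomorphisms which intertwine two actions. -/
def intertwiners [AddCommGroup V'] [Module N V'] [Module F V'] [IsScalarTower F N V']
    (α : D → Module.End N V') (β : D → Module.End N V) : Submodule N (V' →ₗ[N] V) where
  carrier := {X | ∀ d v, X (α d v) = β d (X v)}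
  add_mem' := fun {X Y} hX hY d v => by
    rw [LinearMap.add_apply, LinearMap.add_apply, hX, hY, map_add]
  zero_mem' := fun d v => by simp
  smul_mem' := fun c X hX d v => by
    rw [LinearMap.smul_apply, LinearMap.smul_apply, hX, map_smul]

omit [Algebra F L'] [IsScalarTower F L' N] [IsScalarTower F L' S'] in
-- Through `N ⊗ S' = End(N ^ a')`, a `D`-linear map from `S'` to `V` is the same as `a'`
-- intertwiners, one for each coordinate vector. Both sides are counted over `F`. The hypothesis
-- `hL'` makes `D`-linear maps `L'`-linear, so that they extend to `N ⊗ S'`.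
theorem finrank_intertwiners [FiniteDimensional F N] [FiniteDimensional N V]
    [FiniteDimensional F S'] {a' : ℕ}
    (ρ' : S' →ₐ[L'] Module.End N (Fin a' → N)) (ha' : a' ^ 2 = Module.finrank L' S')
    (δ : D →ₐ[F] S') (Δ : D →ₐ[F] Module.End N V)
    (hL' : ∀ l : L', ∃ d, δ d = algebraMap L' S' l ∧ ∀ v, Δ d v = algebraMap L' N l • v) :
    Module.finrank N (intertwiners (F := F) (fun d => ρ' (δ d)) fun d => Δ d) * a' *
      Module.finrank F D = Module.finrank F S' * Module.finrank N V := by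
  let _ : Module D S' := Module.compHom S' δ.toRingHom
  have hDS : ∀ (d : D) (x : S'), d • x = δ d * x := fun _ _ => rfl
  let _ : Module D V := Module.compHom V Δ.toRingHom
  have hDV : ∀ (d : D) (x : V), d • x = Δ d x := fun _ _ => rfl
  have : IsScalarTower F D S' := ⟨fun c d x => by simp [hDS]⟩
  have : SMulCommClass D F V := ⟨fun d c v => by
    rw [hDV, hDV, ← algebraMap_smul N c v, map_smul, algebraMap_smul]⟩
  have : Module.Finite D S' := Module.Finite.of_restrictScalars_finite F D S'
  have hθ : ∀ (θ : S' →ₗ[D] V) (l : L') (x : S'), θ (l • x) = algebraMap L' N l • θ x := by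
    intro θ l x
    obtain ⟨d, hd, hd'⟩ := hL' l
    rw [Algebra.smul_def, ← hd, ← hDS, map_smul, hDV, hd']
  obtain ⟨e, he⟩ := exists_algEquiv_of_rep ρ' (by simpa using ha')
  set W := intertwiners (F := F) (fun d => ρ' (δ d)) fun d => Δ d with hW
  let E : Fin a' → (Fin a' → N) := fun j => Pi.single j 1
  let Φ : (Fin a' → W) →ₗ[F] (S' →ₗ[D] V) :=
    { toFun := fun X =>
        { toFun := fun x => ∑ j, (X j : (Fin a' → N) →ₗ[N] V) (ρ' x (E j))
          map_add' := fun x y => by simp [Finset.sum_add_distrib]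
          map_smul' := fun d x => by
            rw [RingHom.id_apply, hDV, map_sum]
            refine Finset.sum_congr rfl fun j _ => ?_
            rw [hDS, map_mul, Module.End.mul_apply, (X j).2 d] }
      map_add' := fun X Y => by ext x; simp [Finset.sum_add_distrib]
      map_smul' := fun c X => by ext x; simp [Finset.smul_sum] }
  have hΦ : ∀ X x, Φ X x = ∑ j, (X j : (Fin a' → N) →ₗ[N] V) (ρ' x (E j)) := fun _ _ => rfl
  have hbij : Function.Bijective Φ := by
    constructor
    · rw [← LinearMap.ker_eq_bot, LinearMap.ker_eq_bot']
      intro X hX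
      have h1 : ∀ Y : Module.End N (Fin a' → N),
          ∑ j, (X j : (Fin a' → N) →ₗ[N] V) (Y (E j)) = 0 := by
        intro Y
        obtain ⟨y, rfl⟩ := e.surjective Y
        induction y using TensorProduct.induction_on with
        | zero => simp
        | tmul c s =>
          have := congrArg (fun θ => c • θ s) hX
          simp only [hΦ, LinearMap.zero_apply, smul_zero, Finset.smul_sum] at this
          rw [← this]
          refine Finset.sum_congr rfl fun j _ => ?_
          rw [he, LinearMap.smul_apply, map_smul]
        | add a b ha hb =>
          simp only [map_add, LinearMap.add_apply, Finset.sum_add_distrib, ha, hb, add_zero]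
      funext i
      apply Subtype.ext
      refine LinearMap.ext fun v => ?_
      have h2 := h1 ((LinearMap.proj i : (Fin a' → N) →ₗ[N] N).smulRight v)
      rw [Finset.sum_eq_single i] at h2
      · simpa [E] using h2
      · intro j _ hj
        simp [E, hj.symm]
      · simp
    · intro θ
      let θL : S' →ₗ[L'] V :=
        { toFun := θ
          map_add' := map_add θ
          map_smul' := fun l x => by
            rw [hθ θ l x, RingHom.id_apply, algebraMap_smul] }
      let Θ : Module.End N (Fin a' → N) →ₗ[N] V :=
        (θL.liftBaseChange N).comp e.symm.toLinearMap
      have hΘe : ∀ c x, Θ (e (c ⊗ₜ x)) = c • θ x := fun c x => by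
        change θL.liftBaseChange N (e.symm (e (c ⊗ₜ x))) = c • θ x
        rw [AlgEquiv.symm_apply_apply, LinearMap.liftBaseChange_tmul]
        rfl
      have hΘρ : ∀ x, Θ (ρ' x) = θ x := fun x => by
        have := hΘe 1 x
        rwa [he, one_smul, one_smul] at this
      have hΘΔ : ∀ d Y, Θ (ρ' (δ d) * Y) = Δ d (Θ Y) := by
        intro d Y
        obtain ⟨y, rfl⟩ := e.surjective Y
        induction y using TensorProduct.induction_on with
        | zero => simp
        | tmul c s =>
          rw [hΘe, he, mul_smul_comm, ← map_mul, map_smul, hΘρ, map_smul, ← hDS, map_smul, hDV]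
        | add a b ha hb => simp only [map_add, mul_add, ha, hb]
      let X : Fin a' → W := fun i =>
        ⟨{ toFun := fun v => Θ ((LinearMap.proj i : (Fin a' → N) →ₗ[N] N).smulRight v)
           map_add' := fun v w => by
             rw [← map_add]
             congr 1
             ext j : 2
             simp
           map_smul' := fun c v => by
             rw [RingHom.id_apply, ← map_smul]
             congr 1
             refine LinearMap.ext fun w => ?_
             simp [smul_comm c] },
          fun d v => by
            change Θ ((LinearMap.proj i : (Fin a' → N) →ₗ[N] N).smulRight (ρ' (δ d) v)) = Δ d (Θ _)
            rw [← hΘΔ]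
            congr 1
            refine LinearMap.ext fun w => ?_
            simp⟩
      refine ⟨X, LinearMap.ext fun x => ?_⟩
      rw [hΦ]
      change ∑ j, Θ ((LinearMap.proj j : (Fin a' → N) →ₗ[N] N).smulRight (ρ' x (E j))) = θ x
      rw [← map_sum, ← hΘρ]
      congr 1
      refine LinearMap.ext fun w => ?_
      rw [LinearMap.sum_apply]
      conv_rhs => rw [pi_eq_sum_univ' w, map_sum]
      refine Finset.sum_congr rfl fun j _ => ?_
      rw [map_smul]
      rfl
  have h1 := (LinearEquiv.ofBijective Φ hbij).finrank_eq
  have : Module.Finite F V := Module.Finite.trans N V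
  have : Module.Finite F W := Module.Finite.trans N W
  rw [finrank_linearMap_division, Module.finrank_pi_fintype, Finset.sum_const, Finset.card_univ,
    Fintype.card_fin, smul_eq_mul, ← Module.finrank_mul_finrank F N W,
    ← Module.finrank_mul_finrank F N V] at h1
  have h2 := Module.finrank_mul_finrank F D S'
  apply Nat.eq_of_mul_eq_mul_left (Module.finrank_pos (R := F) (M := N))
  rw [← h2]
  linear_combination Module.finrank F D * h1

end Intertwiners

/-! ### The regular projective representation of a cocycle -/

section Regular

variable {F N : Type*} [Field F] [Field N] [Algebra F N]

/-- The regular projective representation defined by a cocycle. -/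
def regularFamily (φ : (N ≃ₐ[F] N) → (N ≃ₐ[F] N) → Nˣ) :
    SemilinearFamily F N ((N ≃ₐ[F] N) → N) where
  toFun g :=
    { toFun := fun v σ => φ g (g⁻¹ * σ) * g (v (g⁻¹ * σ))
      invFun := fun v σ => g.symm (((φ g σ)⁻¹ : Nˣ) * v (g * σ))
      left_inv := fun v => by
        funext σ
        simp
      right_inv := fun v => by
        funext σ
        simp
      map_add' := fun v w => by
        funext σ
        simp [mul_add] }
  semilinear g c v := by
    funext σ
    simp only [AddEquiv.coe_mk, Equiv.coe_fn_mk, Pi.smul_apply, smul_eq_mul, map_mul]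
    ring

theorem regularFamily_apply (φ : (N ≃ₐ[F] N) → (N ≃ₐ[F] N) → Nˣ) (g : N ≃ₐ[F] N)
    (v : (N ≃ₐ[F] N) → N) (σ : N ≃ₐ[F] N) :
    regularFamily φ g v σ = φ g (g⁻¹ * σ) * g (v (g⁻¹ * σ)) := rfl

theorem hasMultiplier_regularFamily {φ : (N ≃ₐ[F] N) → (N ≃ₐ[F] N) → Nˣ} (hφ : IsCocycleOn ⊤ φ) :
    (regularFamily φ).HasMultiplier ⊤ φ := by
  intro g _ h _ v
  funext σ
  rw [Pi.smul_apply, regularFamily_apply, regularFamily_apply, regularFamily_apply, smul_eq_mul,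
    mul_inv_rev, mul_assoc, map_mul, AlgEquiv.mul_apply]
  have := congrArg Units.val (hφ g trivial h trivial (h⁻¹ * (g⁻¹ * σ)) trivial)
  simp only [Units.val_mul, SemilinearFamily.coe_smul_units, mul_inv_cancel_left] at this
  linear_combination (-(g (h (v (h⁻¹ * (g⁻¹ * σ)))))) * this

end Regular

/-! ### The central simple algebra of a cocycle -/

section Commutant

/-- For a proper ideal `I`, the map from `E ⊗ A` to `E ⊗ (A / I)` is injective by simplicity, so `I
= 0`. -/
theorem isSimpleRing_of_tensorProduct (F : Type*) {E A : Type*} [Field F] [Field E] [Algebra F E]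
    [Ring A] [Algebra F A] [IsSimpleRing (E ⊗[F] A)] : IsSimpleRing A := by
  have : Nontrivial A := by
    by_contra h
    rw [not_nontrivial_iff_subsingleton] at h
    have := (inferInstance : Nontrivial (E ⊗[F] A))
    apply zero_ne_one (α := E ⊗[F] A)
    rw [Algebra.TensorProduct.one_def, Subsingleton.elim (1 : A) 0, TensorProduct.tmul_zero]
  refine ⟨⟨fun I => ?_⟩⟩
  by_cases hI : I = ⊤
  · exact Or.inr hI
  left
  have hn : Nontrivial I.ringCon.Quotient := by
    by_contra h
    rw [not_nontrivial_iff_subsingleton] at h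
    apply hI
    rw [eq_top_iff]
    intro x _
    rw [TwoSidedIdeal.mem_iff]
    exact (RingCon.eq I.ringCon).1 (Subsingleton.elim _ _)
  let π : A →ₐ[F] I.ringCon.Quotient := 
    { I.ringCon.mk' with commutes' := fun r => rfl }
  let ψ := Algebra.TensorProduct.map (AlgHom.id F E) π
  have hψ : Function.Injective ψ := RingHom.injective (ψ : E ⊗[F] A →+* E ⊗[F] I.ringCon.Quotient)
  rw [eq_bot_iff]
  intro x hx
  have hx0 : π x = 0 := (RingCon.eq I.ringCon).2 ((TwoSidedIdeal.mem_iff _ _).1 hx)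
  have h1 : (1 : E) ⊗ₜ[F] x = 0 := by
    apply hψ
    rw [map_zero, Algebra.TensorProduct.map_tmul, hx0, TensorProduct.tmul_zero]
  have h2 : x = 0 := by
    have : Function.Injective (Algebra.TensorProduct.includeRight : A →ₐ[F] E ⊗[F] A) :=
      Algebra.TensorProduct.includeRight_injective (algebraMap F E).injective
    apply this
    rw [map_zero]
    exact h1
  rw [h2]
  exact TwoSidedIdeal.zero_mem _

variable {F N V : Type*} [Field F] [Field N] [Algebra F N] [AddCommGroup V] [Module N V]
  [Module F V] [IsScalarTower F N V]

/-- The commutant of a semilinear family. -/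
def commutant (τ : SemilinearFamily F N V) : Subalgebra F (Module.End N V) where
  carrier := {X | ∀ g v, X (τ g v) = τ g (X v)}
  mul_mem' := fun {X Y} hX hY g v => by
    rw [Module.End.mul_apply, Module.End.mul_apply, hY, hX]
  add_mem' := fun {X Y} hX hY g v => by
    rw [LinearMap.add_apply, LinearMap.add_apply, hX, hY, map_add]
  algebraMap_mem' := fun r g v => by
    rw [Module.algebraMap_end_apply, Module.algebraMap_end_apply, ← algebraMap_smul N r,
      ← algebraMap_smul N r (v : V), τ.semilinear, AlgEquiv.commutes]

variable [FiniteDimensional F N] [IsGalois F N] [FiniteDimensional N V] [Nontrivial V]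

/-- The multiplier cancels on `End V`, where the commutant is the space of fixed points; descent
gives `N ⊗ commutant = End V`, and simplicity, center and dimension are read off from there. -/
theorem commutant_properties {τ : SemilinearFamily F N V} {φ : (N ≃ₐ[F] N) → (N ≃ₐ[F] N) → Nˣ}
    (hτ : τ.HasMultiplier ⊤ φ) : IsSimpleRing (commutant τ) ∧ Algebra.IsCentral F (commutant τ) ∧
      FiniteDimensional F (commutant τ) ∧
      Module.finrank F (commutant τ) = Module.finrank N V ^ 2 := by
  have hhom : (τ.hom τ).HasMultiplier ⊤ 1 := (hτ.hom hτ).congr fun g _ k _ => by simp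
  have hfix : ∀ X : V →ₗ[N] V, X ∈ commutant τ ↔ ∀ g ∈ (⊤ : Subgroup (N ≃ₐ[F] N)),
      τ.hom τ g X = X := by
    intro X
    constructor
    · intro hX g _
      refine LinearMap.ext fun v => ?_
      rw [SemilinearFamily.hom_apply, ← hX, AddEquiv.apply_symm_apply]
    · intro hX g v
      conv_lhs => rw [← hX g trivial]
      rw [SemilinearFamily.hom_apply, AddEquiv.symm_apply_apply]
  have hFD : FiniteDimensional F V := Module.Finite.trans N V
  have hfd : FiniteDimensional F (V →ₗ[N] V) := Module.Finite.trans N _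
  have hfd' : FiniteDimensional F (commutant τ) :=
    inferInstanceAs (FiniteDimensional F (Subalgebra.toSubmodule (commutant τ)))
  have hrank : Module.finrank F (commutant τ) = Module.finrank N V ^ 2 := by
    have := SemilinearFamily.finrank_fixed hhom (Subalgebra.toSubmodule (commutant τ)) hfix
    rw [IsGalois.fixedField_top, IntermediateField.finrank_bot, one_mul,
      Module.finrank_linearMap, ← sq] at this
    exact this
  obtain ⟨b, hb⟩ := SemilinearFamily.exists_basis_fixed hhom
  let ψ : N ⊗[F] commutant τ →ₐ[N] Module.End N V :=
    Algebra.TensorProduct.lift (Algebra.ofId N _) (commutant τ).val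
      fun c x => Algebra.commutes c (x : Module.End N V)
  have hψ : ∀ c x, ψ (c ⊗ₜ x) = c • (x : Module.End N V) := fun c x => by
    refine (Algebra.TensorProduct.lift_tmul _ _ _ _ _).trans ?_
    rw [Algebra.ofId_apply, Algebra.smul_def]
    rfl
  have hsurj : Function.Surjective ψ := by
    intro X
    refine ⟨∑ i, b.repr X i ⊗ₜ ⟨b i, (hfix _).2 (hb i)⟩, ?_⟩
    rw [map_sum]
    simp only [hψ]
    exact b.sum_repr X
  have hbij : Function.Bijective ψ := by
    refine ⟨?_, hsurj⟩
    refine (LinearMap.injective_iff_surjective_of_finrank_eq_finrank (f := ψ.toLinearMap) ?_).2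
      hsurj
    rw [Module.finrank_baseChange, Module.finrank_linearMap, hrank, sq]
  let e := AlgEquiv.ofBijective ψ hbij
  refine ⟨?_, ⟨fun x hx => ?_⟩, hfd', hrank⟩
  · have : Nonempty (Fin (Module.finrank N V)) := ⟨⟨0, Module.finrank_pos⟩⟩
    have hs : IsSimpleRing (Module.End N V) :=
      IsSimpleRing.of_ringEquiv (algEquivMatrix (Module.finBasis N V)).symm.toRingEquiv
        inferInstance
    have : IsSimpleRing (N ⊗[F] commutant τ) := IsSimpleRing.of_ringEquiv e.symm.toRingEquiv hs
    exact isSimpleRing_of_tensorProduct F (E := N)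
  · have hx1 : (x : Module.End N V) ∈ Subalgebra.center N (Module.End N V) := by
      rw [Subalgebra.mem_center_iff]
      intro Y
      obtain ⟨y, rfl⟩ := hsurj Y
      induction y using TensorProduct.induction_on with
      | zero => simp
      | tmul c s =>
        rw [hψ, smul_mul_assoc, mul_smul_comm]
        congr 1
        exact congrArg Subtype.val (Subalgebra.mem_center_iff.1 hx s)
      | add a b ha hb => rw [map_add, add_mul, mul_add, ha, hb]
    rw [Algebra.IsCentral.center_eq_bot, Algebra.mem_bot] at hx1
    obtain ⟨c, hc⟩ := hx1
    obtain ⟨v, hv⟩ := exists_ne (0 : V)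
    have hc' : ∀ v, (x : Module.End N V) v = c • v := fun v => by rw [← hc]; rfl
    have hcF : c ∈ (⊥ : IntermediateField F N) := by
      rw [IsGalois.mem_bot_iff_fixed]
      intro g
      have h1 := x.2 g v
      rw [hc', hc', τ.semilinear] at h1
      have h2 : τ g v ≠ 0 := fun h0 => hv ((τ g).injective (by rw [h0, map_zero]))
      exact (smul_left_injective N h2 h1).symm
    obtain ⟨r, hr⟩ := IntermediateField.mem_bot.1 hcF
    refine Algebra.mem_bot.2 ⟨r, Subtype.ext ?_⟩
    refine LinearMap.ext fun v => ?_
    rw [hc', ← hr, algebraMap_smul]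
    rfl

end Commutant

theorem exists_semilinearFamily_of_partial {F N V : Type*} [Field F] [Field N] [Algebra F N]
    [AddCommGroup V] [Module N V] [FiniteDimensional N V] (H : Subgroup (N ≃ₐ[F] N))
    (t : ∀ g ∈ H, V ≃+ V) (ht : ∀ g (hg : g ∈ H) (c : N) v, t g hg (c • v) = g c • t g hg v) :
    ∃ τ : SemilinearFamily F N V, ∀ g (hg : g ∈ H), τ g = t g hg := by
  classical
  let e := (Module.finBasis N V).equivFun
  let γ := coordFamily F N (Module.finrank N V)
  refine ⟨{ toFun := fun g => if hg : g ∈ H then t g hg else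
              (e.toAddEquiv.trans (γ g)).trans e.symm.toAddEquiv
            semilinear := fun g c v => ?_ }, fun g hg => dif_pos hg⟩
  split_ifs with hg
  · exact ht g hg c v
  · change e.symm (γ g (e (c • v))) = g c • e.symm (γ g (e v))
    rw [map_smul, γ.semilinear, map_smul]

theorem isCentral_of_matrix {F A : Type*} [Field F] [Ring A] [Algebra F A] {r : ℕ} [NeZero r]
    [h : Algebra.IsCentral F (Matrix (Fin r) (Fin r) A)] : Algebra.IsCentral F A := by
  refine ⟨fun x hx => ?_⟩
  rw [Subalgebra.mem_center_iff] at hx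
  have h1 : Matrix.scalar (Fin r) x ∈ Subalgebra.center F (Matrix (Fin r) (Fin r) A) := by
    rw [Subalgebra.mem_center_iff]
    intro M
    ext i j
    simp [Matrix.scalar_apply, Matrix.mul_diagonal, Matrix.diagonal_mul, hx]
  obtain ⟨c, hc⟩ := Algebra.mem_bot.1 (h.out h1)
  refine Algebra.mem_bot.2 ⟨c, ?_⟩
  have h2 := congrFun (congrFun hc 0) 0
  simpa [Matrix.algebraMap_matrix_apply] using h2

/-- The range of a diagonal matrix unit keeps the actions of scalar matrices and of everything
commuting with the matrices, and `Y` is `r` copies of it. -/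
theorem exists_corner {F A C Y : Type*} [Field F] [Ring A] [Algebra F A] [Ring C] [Algebra F C]
    [AddCommGroup Y] [Module F Y] [FiniteDimensional F Y] {r : ℕ} [NeZero r]
    (Φ : Matrix (Fin r) (Fin r) A →ₐ[F] Module.End F Y) (γ : C →ₐ[F] Module.End F Y)
    (hcomm : ∀ a c, Commute (Φ a) (γ c)) :
    ∃ (M : Submodule F Y) (α : A →ₐ[F] Module.End F M) (γ' : C →ₐ[F] Module.End F M),
      (∀ a c, Commute (α a) (γ' c)) ∧ Module.finrank F Y = r * Module.finrank F M := by
  let P := Φ (Matrix.single 0 0 1)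
  have h1 : ∀ a, Commute P ((Φ.comp (Matrix.scalarAlgHom (Fin r) F)) a) := fun a => by
    refine Commute.map ?_ Φ
    ext i j
    simp [Matrix.scalarAlgHom, Matrix.scalar_apply, Matrix.mul_diagonal, Matrix.diagonal_mul,
      Matrix.single_apply]
  refine ⟨LinearMap.range P, restrictRange P _ h1, restrictRange P γ (fun c => hcomm _ c),
    fun a c => ?_, finrank_eq_mul_finrank_range 0 Φ⟩
  ext v
  have := LinearMap.congr_fun (hcomm (Matrix.scalarAlgHom (Fin r) F a) c).eq v
  simpa using this

theorem finrank_fixedField {F N : Type*} [Field F] [Field N] [Algebra F N] [FiniteDimensional F N]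
    [IsGalois F N] (P : Subgroup (N ≃ₐ[F] N)) :
    Module.finrank F (IntermediateField.fixedField P) = P.index := by
  rw [IntermediateField.finrank_eq_fixingSubgroup_index, IntermediateField.fixingSubgroup_fixedField]

/-! ### Bimodules from cohomologous multipliers -/

section Bimodule

variable {F N V U A C : Type*} [Field F] [Field N] [Algebra F N] [FiniteDimensional F N]
  [IsGalois F N] [AddCommGroup V] [Module N V] [Module F V] [IsScalarTower F N V]
  [FiniteDimensional N V] [AddCommGroup U] [Module N U] [Module F U] [IsScalarTower F N U]
  [FiniteDimensional N U] [Ring A] [Algebra F A] [Ring C] [Algebra F C]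

/-- After rescaling, `Hom(U, V)` has the trivial multiplier on `P`. Its fixed points carry the
commutant by composition on the left and `C` by composition on the right, and descent gives their
dimension; a corner then replaces `M_r(A)` by `A`. -/
theorem exists_bimodule {τ : SemilinearFamily F N V} {φ : (N ≃ₐ[F] N) → (N ≃ₐ[F] N) → Nˣ}
    (hτ : τ.HasMultiplier ⊤ φ) {r : ℕ} [NeZero r] (e : commutant τ ≃ₐ[F] Matrix (Fin r) (Fin r) A)
    {P : Subgroup (N ≃ₐ[F] N)} {θ : SemilinearFamily F N U}
    {χ : (N ≃ₐ[F] N) → (N ≃ₐ[F] N) → Nˣ} (hθ : θ.HasMultiplier P χ) (hχ : IsCob P (φ * χ⁻¹))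
    (κ : C →ₐ[F] Module.End N U) (hκ : ∀ g ∈ P, ∀ c v, θ g (κ c v) = κ c (θ g v)) :
    ∃ (M : Submodule F (U →ₗ[N] V)) (α : A →ₐ[F] Module.End F M)
      (γ : Cᵐᵒᵖ →ₐ[F] Module.End F M), (∀ a c, Commute (α a) (γ c)) ∧
      P.index * (Module.finrank N U * Module.finrank N V) = r * Module.finrank F M := by
  obtain ⟨b, hb⟩ := (hτ.mono (le_top : P ≤ ⊤)).exists_rescale hχ
  have hhom : (θ.hom (τ.rescale b)).HasMultiplier P 1 :=
    (hb.hom hθ).congr fun g _ k _ => by simp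
  let Y : Submodule F (U →ₗ[N] V) :=
    { carrier := {X | ∀ g ∈ P, θ.hom (τ.rescale b) g X = X}
      add_mem' := fun {X X'} hX hX' g hg => by rw [map_add, hX g hg, hX' g hg]
      zero_mem' := fun g _ => map_zero _
      smul_mem' := fun c X hX g hg => by
        rw [← algebraMap_smul N c X, SemilinearFamily.semilinear, hX g hg, AlgEquiv.commutes] }
  have hY : ∀ X : U →ₗ[N] V, X ∈ Y ↔ ∀ g ∈ P, ∀ v, τ.rescale b g (X v) = X (θ g v) := by
    intro X
    constructor
    · intro hX g hg v
      conv_rhs => rw [← hX g hg]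
      rw [SemilinearFamily.hom_apply, AddEquiv.symm_apply_apply]
    · intro hX g hg
      refine LinearMap.ext fun v => ?_
      rw [SemilinearFamily.hom_apply, hX g hg, AddEquiv.apply_symm_apply]
  have hfd : FiniteDimensional F (U →ₗ[N] V) := Module.Finite.trans N _
  have hrank := SemilinearFamily.finrank_fixed hhom Y fun _ => Iff.rfl
  rw [finrank_fixedField, Module.finrank_linearMap] at hrank
  let Φ₀ : commutant τ →ₐ[F] Module.End F Y :=
    { toFun := fun a =>
        { toFun := fun X => ⟨(a : Module.End N V).comp (X : U →ₗ[N] V), (hY _).2 fun g hg v => by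
            rw [LinearMap.comp_apply, LinearMap.comp_apply, ← (hY _).1 X.2 g hg,
              SemilinearFamily.rescale_apply, SemilinearFamily.rescale_apply, map_smul, a.2]⟩
          map_add' := fun X X' => Subtype.ext (LinearMap.comp_add _ _ _)
          map_smul' := fun c X => Subtype.ext (by
            refine LinearMap.ext fun v => ?_
            change (a : Module.End N V) (c • X.1 v) = c • (a : Module.End N V) (X.1 v)
            rw [← algebraMap_smul N c, map_smul, algebraMap_smul]) }
      map_one' := rfl
      map_mul' := fun _ _ => rfl
      map_zero' := LinearMap.ext fun X => Subtype.ext (LinearMap.zero_comp _)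
      map_add' := fun a a' => LinearMap.ext fun X => Subtype.ext (LinearMap.add_comp _ _ _)
      commutes' := fun _ => rfl }
  let γ₀ : Cᵐᵒᵖ →ₐ[F] Module.End F Y :=
    { toFun := fun c =>
        { toFun := fun X => ⟨(X : U →ₗ[N] V).comp (κ c.unop), (hY _).2 fun g hg v => by
            rw [LinearMap.comp_apply, LinearMap.comp_apply, (hY _).1 X.2 g hg, hκ g hg]⟩
          map_add' := fun X X' => rfl
          map_smul' := fun c X => rfl }
      map_one' := LinearMap.ext fun X => Subtype.ext (by
        change (X : U →ₗ[N] V).comp (κ 1) = X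
        rw [map_one]; rfl)
      map_mul' := fun c c' => LinearMap.ext fun X => Subtype.ext (by
        change (X : U →ₗ[N] V).comp (κ (c'.unop * c.unop)) = _
        rw [map_mul]; rfl)
      map_zero' := LinearMap.ext fun X => Subtype.ext (by
        change (X : U →ₗ[N] V).comp (κ 0) = 0
        rw [map_zero, LinearMap.comp_zero])
      map_add' := fun c c' => LinearMap.ext fun X => Subtype.ext (by
        change (X : U →ₗ[N] V).comp (κ (c.unop + c'.unop)) = _
        rw [map_add, LinearMap.comp_add]; rfl)
      commutes' := fun x => LinearMap.ext fun X => Subtype.ext (by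
        change (X : U →ₗ[N] V).comp (κ (algebraMap F C x)) = x • (X : U →ₗ[N] V)
        rw [AlgHom.commutes]
        refine LinearMap.ext fun v => ?_
        change X.1 (x • v) = x • X.1 v
        rw [← algebraMap_smul N x, map_smul, algebraMap_smul]) }
  obtain ⟨M, α, γ, hcomm, hM⟩ := exists_corner (Φ₀.comp e.symm.toAlgHom) γ₀ (fun a c => rfl)
  have einj := Submodule.equivMapOfInjective Y.subtype Y.injective_subtype M
  refine ⟨M.map Y.subtype, (einj.conjAlgEquiv F).toAlgHom.comp α,
    (einj.conjAlgEquiv F).toAlgHom.comp γ, fun a c => (hcomm a c).map (einj.conjAlgEquiv F), ?_⟩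
  rw [← einj.finrank_eq, ← hM, hrank]

end Bimodule

theorem exists_algEquiv_apply_eq {F N P : Type*} [Field F] [Field N] [Algebra F N] [Normal F N]
    [Field P] [Algebra F P] (φ₁ φ₂ : P →ₐ[F] N) : ∃ h : N ≃ₐ[F] N, ∀ x, h (φ₁ x) = φ₂ x := by
  let χ : φ₁.fieldRange ≃ₐ[F] φ₂.fieldRange :=
    (AlgEquiv.ofInjectiveField φ₁).symm.trans (AlgEquiv.ofInjectiveField φ₂)
  refine ⟨χ.liftNormal N, fun x => ?_⟩
  have h := χ.liftNormal_commutes N (AlgEquiv.ofInjectiveField φ₁ x)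
  have h1 : χ (AlgEquiv.ofInjectiveField φ₁ x) = AlgEquiv.ofInjectiveField φ₂ x := by
    change AlgEquiv.ofInjectiveField φ₂ ((AlgEquiv.ofInjectiveField φ₁).symm _) = _
    rw [AlgEquiv.symm_apply_apply]
  rw [h1] at h
  exact h

/-- Automorphisms of linearly disjoint subfields extend independently of each other. -/
theorem exists_mem_fixing {F L L' N S' : Type*} [Field F] [Field L] [Field L'] [Field N]
    [DivisionRing S'] [Algebra F L] [Algebra F L'] [Algebra F N] [Algebra L N] [Algebra L' N]
    [IsScalarTower F L N] [IsScalarTower F L' N] [Normal F N] [Algebra F S']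
    [FiniteDimensional F L] [FiniteDimensional F L'] (ψ : L ⊗[F] L' →ₐ[F] S')
    (hψ : Function.Injective ψ) (g : N ≃ₐ[F] N) :
    ∃ h ∈ fixing F L' N, h⁻¹ * g ∈ fixing F L N := by
  -- Linear disjointness makes `L ⊗ L'` a field, and any two of its embeddings in a normal extension
  -- differ by an automorphism.
  have : IsDomain (L ⊗[F] L') := hψ.isDomain ψ.toRingHom
  let _ : Field (L ⊗[F] L') := fieldOfFiniteDimensional F _
  let i : L →ₐ[F] N := IsScalarTower.toAlgHom F L N
  let i' : L' →ₐ[F] N := IsScalarTower.toAlgHom F L' N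
  obtain ⟨h, hh⟩ := exists_algEquiv_apply_eq
    (Algebra.TensorProduct.lift i i' fun _ _ => Commute.all _ _)
    (Algebra.TensorProduct.lift ((g : N →ₐ[F] N).comp i) i' fun _ _ => Commute.all _ _)
  refine ⟨h, mem_fixing.2 fun l => ?_, mem_fixing.2 fun l => ?_⟩
  · have := hh (1 ⊗ₜ l)
    simpa [i'] using this
  · have := hh (l ⊗ₜ 1)
    simp only [Algebra.TensorProduct.lift_tmul, map_one, mul_one] at this
    change h.symm (g (i l)) = i l
    rw [AlgEquiv.symm_apply_eq]
    exact this.symm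

/-! ### Comparing the cocycles of two nested division algebras -/

section CommonMultiplier

variable {F L L' N S S' : Type*} [Field F] [Field L] [Field L'] [Field N] [Algebra F L]
  [Algebra F L'] [Algebra F N] [Algebra L N] [Algebra L' N] [IsScalarTower F L N]
  [IsScalarTower F L' N] [FiniteDimensional F N] [DivisionRing S] [DivisionRing S'] [Algebra F S]
  [Algebra F S'] [Algebra L S] [Algebra L' S'] [IsScalarTower F L S]
  [FiniteDimensional F S] [FiniteDimensional F S'] [FiniteDimensional L' S']
  [Algebra.IsCentral L' S']

/-- The intertwiners between the spaces of `ρ'` and `ρ` over `S ⊗ L'` are stable under the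
automorphisms that fix both centers and have the multiplier `f / f'`. Taking determinants on this
space of dimension `w` shows that `(f / f') ^ w` is a coboundary. -/
theorem isCob_pow_of_injective {a a' : ℕ} (ρ : S →ₐ[L] Module.End N (Fin a → N))
    (ρ' : S' →ₐ[L'] Module.End N (Fin a' → N)) (ha' : a' ^ 2 = Module.finrank L' S')
    {τ : SemilinearFamily F N (Fin a → N)} {τ' : SemilinearFamily F N (Fin a' → N)}
    {f f' : (N ≃ₐ[F] N) → (N ≃ₐ[F] N) → Nˣ}
    (hτ : τ.HasMultiplier (fixing F L N) f) (hτ' : τ'.HasMultiplier (fixing F L' N) f')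
    (hτρ : ∀ g ∈ fixing F L N, ∀ x v, τ g (ρ x v) = ρ x (τ g v))
    (hτρ' : ∀ g ∈ fixing F L' N, ∀ x v, τ' g (ρ' x v) = ρ' x (τ' g v))
    (ψ : S ⊗[F] L' →ₐ[F] S') (hψ : Function.Injective ψ)
    (hψL : ∀ l, ψ (1 ⊗ₜ l) = algebraMap L' S' l) :
    ∃ w : ℕ, w * a' * (Module.finrank F S * Module.finrank F L') = Module.finrank F S' * a ∧
      IsCob (fixing F L N ⊓ fixing F L' N) ((f * f'⁻¹) ^ w) := by
  let _ : DivisionRing ψ.range := divisionRingSubalgebra ψ.range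
  have : FiniteDimensional F L' := Module.Finite.of_injective
    (IsScalarTower.toAlgHom F L' N).toLinearMap (algebraMap L' N).injective
  let Δ₀ : S ⊗[F] L' →ₐ[F] Module.End N (Fin a → N) :=
    Algebra.TensorProduct.lift (ρ.restrictScalars F)
      ((Algebra.ofId N (Module.End N (Fin a → N))).restrictScalars F |>.comp
        (IsScalarTower.toAlgHom F L' N))
      (fun s l => (Algebra.commutes (R := N) (algebraMap L' N l) (ρ s)).symm)
  have hΔ₀ : ∀ s l, Δ₀ (s ⊗ₜ l) = ρ s * algebraMap N _ (algebraMap L' N l) := fun s l =>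
    Algebra.TensorProduct.lift_tmul _ _ _ _ _
  let e := AlgEquiv.ofInjective ψ hψ
  let Δ : ψ.range →ₐ[F] Module.End N (Fin a → N) := Δ₀.comp e.symm.toAlgHom
  have hΔe : ∀ x, Δ (e x) = Δ₀ x := fun x => by
    change Δ₀ (e.symm (e x)) = Δ₀ x
    rw [AlgEquiv.symm_apply_apply]
  have hL' : ∀ l : L', ∃ d : ψ.range, ψ.range.val d = algebraMap L' S' l ∧
      ∀ v, Δ d v = algebraMap L' N l • v := fun l => ⟨e (1 ⊗ₜ l), hψL l, fun v => by
    rw [hΔe, hΔ₀, map_one, one_mul, Module.algebraMap_end_apply]⟩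
  have hrank := finrank_intertwiners (F := F) ρ' ha' ψ.range.val Δ hL'
  have hΔτ : ∀ g ∈ fixing F L N ⊓ fixing F L' N, ∀ d v, τ g (Δ d v) = Δ d (τ g v) := by
    intro g hg d v
    obtain ⟨x, rfl⟩ := e.surjective d
    rw [hΔe]
    induction x using TensorProduct.induction_on generalizing v with
    | zero => simp
    | tmul s l =>
      rw [hΔ₀, Module.End.mul_apply, Module.End.mul_apply, hτρ g hg.1, Module.algebraMap_end_apply,
        Module.algebraMap_end_apply, τ.semilinear, mem_fixing.1 hg.2]
    | add x y hx hy => simp only [map_add, LinearMap.add_apply, hx, hy]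
  set W := intertwiners (F := F) (fun d => ρ' (ψ.range.val d)) fun d => Δ d with hW
  have hmem : ∀ g ∈ fixing F L N ⊓ fixing F L' N, ∀ X ∈ W, τ'.hom τ g X ∈ W := by
    intro g hg X hX d v
    rw [SemilinearFamily.hom_apply, SemilinearFamily.hom_apply, ← hΔτ g hg, ← hX d]
    congr 2
    rw [AddEquiv.symm_apply_eq, hτρ' g hg.2, AddEquiv.apply_symm_apply]
  have hmem' : ∀ g ∈ fixing F L N ⊓ fixing F L' N, ∀ X ∈ W, (τ'.hom τ g).symm X ∈ W := by
    intro g hg X hX d v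
    change (τ g).symm (X (τ' g (ρ' _ v))) = Δ d ((τ g).symm (X (τ' g v)))
    rw [AddEquiv.symm_apply_eq, hΔτ g hg, AddEquiv.apply_symm_apply, hτρ' g hg.2]
    exact hX d _
  obtain ⟨ω, hω⟩ := exists_semilinearFamily_of_partial (V := W) (fixing F L N ⊓ fixing F L' N)
    (fun g hg =>
      { toFun := fun X => ⟨τ'.hom τ g X, hmem g hg X X.2⟩
        invFun := fun X => ⟨(τ'.hom τ g).symm X, hmem' g hg X X.2⟩
        left_inv := fun X => Subtype.ext ((τ'.hom τ g).symm_apply_apply _)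
        right_inv := fun X => Subtype.ext ((τ'.hom τ g).apply_symm_apply _)
        map_add' := fun X Y => Subtype.ext (map_add _ _ _) })
    (fun g hg c X => Subtype.ext ((τ'.hom τ).semilinear g c X))
  refine ⟨Module.finrank N W, ?_, ?_⟩
  · rw [Module.finrank_fin_fun, ← (AlgEquiv.ofInjective ψ hψ).toLinearEquiv.finrank_eq,
      Module.finrank_tensorProduct] at hrank
    exact hrank
  · refine SemilinearFamily.HasMultiplier.isCob_pow_finrank (τ := ω) fun g hg h hh X => ?_
    rw [hω g hg, hω h hh, hω _ (mul_mem hg hh)]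
    exact Subtype.ext ((hτ.mono inf_le_left).hom (hτ'.mono inf_le_right) g hg h hh X)

end CommonMultiplier

/-! ### From a descended cocycle to an embedded central division algebra -/

section Descent

universe uN

variable {F : Type*} {N : Type uN} [Field F] [Field N] [Algebra F N] [FiniteDimensional F N] [IsGalois F N]

theorem exists_prime_coprime_index_sylow {G : Type*} [Group G] [Finite G] {q : ℕ} (hq : q.Prime) :
    ∃ P : Subgroup G, IsPGroup q P ∧ ¬ q ∣ P.index := by
  have := Fact.mk hq
  obtain ⟨P⟩ : Nonempty (Sylow q G) := inferInstance
  exact ⟨P, P.2, P.not_dvd_index⟩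

theorem exists_pGroup_le {G : Type*} [Group G] [Finite G] {p : ℕ} (hp : p.Prime) (H : Subgroup G)
    (hH : ¬ p ∣ H.index) : ∃ Q : Subgroup G, Q ≤ H ∧ IsPGroup p Q ∧ ¬ p ∣ Q.index := by
  obtain ⟨P, hP, hP'⟩ := exists_prime_coprime_index_sylow (G := H) hp
  refine ⟨P.map H.subtype, Subgroup.map_subtype_le P, hP.map _, ?_⟩
  rw [Subgroup.index_map_subtype, hp.dvd_mul]
  tauto

variable (F N) in
/-- The action of the automorphisms on the field itself. -/
def unitFamily : SemilinearFamily F N N where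
  toFun g := g.toAddEquiv
  semilinear g c v := map_mul g c v

/-- `A` is the division algebra underlying the commutant of the regular representation of `φ`. Since
`φ` splits on the Sylow subgroups for primes other than `p`, the degree of `A` is a power of `p`. On
a large `p`-group fixing `L'` the multipliers `φ` and `f'` agree, and the resulting bimodule over
`A` and `S'` determines the degree and provides the embedding. -/
theorem exists_algHom_of_cocycle {L' S' : Type*} [Field L'] [Algebra F L'] [Algebra L' N]
    [IsScalarTower F L' N] [DivisionRing S'] [Algebra F S'] [Algebra L' S'] [IsScalarTower F L' S']
    [FiniteDimensional F S'] [FiniteDimensional L' S'] [Algebra.IsCentral L' S']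
    {p k m' a' : ℕ} (hp : p.Prime)
    (ρ' : S' →ₐ[L'] Module.End N (Fin a' → N)) (ha' : a' ^ 2 = Module.finrank L' S')
    {τ' : SemilinearFamily F N (Fin a' → N)} {f' : (N ≃ₐ[F] N) → (N ≃ₐ[F] N) → Nˣ}
    (hτ' : τ'.HasMultiplier (fixing F L' N) f')
    (hτρ' : ∀ g ∈ fixing F L' N, ∀ x v, τ' g (ρ' x v) = ρ' x (τ' g v))
    (hL' : ¬ p ∣ Module.finrank F L') (hk : a' = p ^ k * m') (hm' : ¬ p ∣ m')
    {φ : (N ≃ₐ[F] N) → (N ≃ₐ[F] N) → Nˣ} (hφ : IsCocycleOn ⊤ φ)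
    (hφp : ∀ Q : Subgroup (N ≃ₐ[F] N), Q ≤ fixing F L' N → IsPGroup p Q → IsCob Q (φ * f'⁻¹))
    (hφq : ∀ P : Subgroup (N ≃ₐ[F] N), p.Coprime (Nat.card P) → IsCob P φ) :
    ∃ (A : Type uN) (_ : DivisionRing A) (_ : Algebra F A), FiniteDimensional F A ∧
      Algebra.IsCentral F A ∧ Module.finrank F A = (p ^ k) ^ 2 ∧ Nonempty (A →ₐ[F] S') := by
  classical
  let V := (N ≃ₐ[F] N) → N
  have hτ := hasMultiplier_regularFamily hφ
  have := Fintype.ofFinite (N ≃ₐ[F] N)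
  have hVdim : Module.finrank N ((N ≃ₐ[F] N) → N) = Nat.card (N ≃ₐ[F] N) := by
    rw [Module.finrank_fintype_fun_eq_card, Nat.card_eq_fintype_card]
  obtain ⟨h1, h2, h3, h4⟩ := commutant_properties hτ
  rw [hVdim] at h4
  have : IsArtinianRing (commutant (regularFamily φ)) :=
    isArtinianRing_of_finiteDimensional F (commutant (regularFamily φ))
  obtain ⟨r, hr, A, _, _, hAfin, ⟨e⟩⟩ := IsSimpleRing.exists_algEquiv_matrix_divisionRing_finite F
    (commutant (regularFamily φ))
  have : Algebra.IsCentral F (Matrix (Fin r) (Fin r) A) := Algebra.IsCentral.of_algEquiv F _ _ e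
  have hAc : Algebra.IsCentral F A := isCentral_of_matrix (r := r)
  set n := Nat.card (N ≃ₐ[F] N) with hn
  have hn0 : 0 < n := Nat.card_pos
  have hr0 : 0 < r := Nat.pos_of_ne_zero (NeZero.ne r)
  have hA : n ^ 2 = r ^ 2 * Module.finrank F A := by
    rw [← h4, e.toLinearEquiv.finrank_eq, Module.finrank_matrix]
    simp [sq]
  obtain ⟨a₀, ha₀⟩ : r ∣ n := (Nat.pow_dvd_pow_iff two_ne_zero).1 ⟨_, hA⟩
  have hA' : Module.finrank F A = a₀ ^ 2 := by
    rw [ha₀, mul_pow] at hA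
    exact (Nat.eq_of_mul_eq_mul_left (pow_pos hr0 2) hA).symm
  have ha₀0 : 0 < a₀ := Nat.pos_of_ne_zero (by rintro rfl; omega)
  -- divisibility of the degree
  have hq : ∀ q : ℕ, q.Prime → q ∣ a₀ → q = p := by
    intro q hq hqa
    by_contra hqp
    obtain ⟨P, hP, hP'⟩ := exists_prime_coprime_index_sylow (G := N ≃ₐ[F] N) hq
    have := Fact.mk hq
    have hcop : p.Coprime (Nat.card P) := by
      obtain ⟨s, hs⟩ := hP.exists_card_eq
      rw [hs]
      exact Nat.Coprime.pow_right _ ((Nat.coprime_primes hp hq).2 (Ne.symm hqp))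
    -- With `U = N` and `C = F` the bimodule is just an `A`-space of dimension `P.index * a₀`. As
    -- `a₀ ^ 2` divides this, `q` would divide the index of its Sylow subgroup.
    obtain ⟨M, α, _, _, hM⟩ := exists_bimodule hτ e (P := P) (θ := unitFamily F N) (χ := 1)
      (C := F) (fun g _ h _ v => by
        rw [Pi.one_apply, Pi.one_apply, Units.val_one, one_smul]; rfl)
      (by simpa using hφq P hcop) (Algebra.ofId F (Module.End N N)) (fun g _ c v => by
        rw [Algebra.ofId_apply, Module.algebraMap_end_apply, Module.algebraMap_end_apply]
        exact map_smul g c v)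
    obtain ⟨t, ht⟩ := finrank_dvd_of_algHom (F := F) (M := M) α
    rw [hVdim, Module.finrank_self, one_mul, ht, hA', ha₀] at hM
    apply hP'
    refine hqa.trans ⟨t, ?_⟩
    apply Nat.eq_of_mul_eq_mul_left (Nat.mul_pos hr0 ha₀0)
    linear_combination hM
  have hap : a₀ = p ^ a₀.primeFactorsList.length :=
    Nat.eq_prime_pow_of_unique_prime_dvd ha₀0.ne' fun {q} hq' hqa => hq q hq' hqa
  set j := a₀.primeFactorsList.length with hj
  obtain ⟨Q, hQ, hQp, hQi⟩ := exists_pGroup_le hp (fixing F L' N) (by rwa [index_fixing])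
  have hτQ := hτ'.mono hQ
  obtain ⟨M, α, γ, hcomm, hM⟩ := exists_bimodule hτ e hτQ (hφp Q hQ hQp) (ρ'.restrictScalars F)
    (fun g hg c v => hτρ' g (hQ hg) c v)
  obtain ⟨t₁, ht₁⟩ := finrank_dvd_of_algHom (F := F) (M := M) α
  obtain ⟨t₀, ht₀⟩ := finrank_dvd_of_algHom (F := F) (M := M) γ
  rw [(MulOpposite.opLinearEquiv F : S' ≃ₗ[F] S'ᵐᵒᵖ).finrank_eq.symm] at ht₀
  have hS' : Module.finrank F S' = Module.finrank F L' * a' ^ 2 := by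
    rw [ha', Module.finrank_mul_finrank]
  have hS'pos : 0 < Module.finrank F S' := Module.finrank_pos
  have ha'0 : 0 < a' := Nat.pos_of_ne_zero (by rintro rfl; simp at hS'; omega)
  rw [hVdim, Module.finrank_fin_fun] at hM
  -- The bimodule is a space over `A` and over `S'`. The two counts of its dimension force `a₀` and
  -- `a'` to contain the same power of `p`, since `Q.index` is prime to `p`.
  have hM1 : Q.index * a' = a₀ * t₁ := by
    apply Nat.eq_of_mul_eq_mul_left (Nat.mul_pos hr0 ha₀0)
    rw [ht₁, hA', ha₀] at hM
    linear_combination hM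
  have hM2 : Q.index * a₀ = t₀ * Module.finrank F L' * a' := by
    apply Nat.eq_of_mul_eq_mul_left (Nat.mul_pos hr0 ha'0)
    rw [ht₀, hS', ha₀] at hM
    linear_combination hM
  have hcopQ : ∀ i, (p ^ i).Coprime Q.index := fun i =>
    Nat.Coprime.pow_left i ((Nat.Prime.coprime_iff_not_dvd hp).2 hQi)
  have hjk : j = k := by
    apply le_antisymm
    · have h5 : p ^ j ∣ Q.index * a' := by rw [hM1, ← hap]; exact dvd_mul_right _ _
      have h6 := (hcopQ j).dvd_of_dvd_mul_left h5
      rw [hk] at h6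
      have h7 := (Nat.Coprime.pow_left j ((Nat.Prime.coprime_iff_not_dvd hp).2 hm')).dvd_of_dvd_mul_right
        h6
      exact (Nat.pow_dvd_pow_iff_le_right hp.one_lt).1 h7
    · have h5 : p ^ k ∣ Q.index * a₀ := by
        rw [hM2, hk]
        exact (dvd_mul_right _ _).trans (dvd_mul_left _ _)
      have h6 := (hcopQ k).dvd_of_dvd_mul_left h5
      rw [hap] at h6
      exact (Nat.pow_dvd_pow_iff_le_right hp.one_lt).1 h6
  have ht₀p : ¬ p ∣ t₀ := by
    rintro ⟨c, rfl⟩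
    apply hQi
    rw [hap, hjk, hk] at hM2
    refine ⟨c * Module.finrank F L' * m', ?_⟩
    apply Nat.eq_of_mul_eq_mul_right (pow_pos hp.pos k)
    linear_combination hM2
  refine ⟨A, inferInstance, inferInstance, hAfin, hAc, by rw [hA', hap, hjk], ?_⟩
  have : FiniteDimensional F (((Fin a' → N) →ₗ[N] ((N ≃ₐ[F] N) → N))) := Module.Finite.trans N _
  refine exists_algHom_of_coprime (M := M) α γ hcomm t₀ (by rw [ht₀, mul_comm]) ?_
  rw [hA', hap]
  exact (Nat.Coprime.pow_right _ (Nat.Coprime.pow_right _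
    ((Nat.Prime.coprime_iff_not_dvd hp).2 ht₀p).symm))

end Descent

/-! ### Descent of the p-component to the ground field -/

section Existence

universe uF

theorem exists_isGalois_of_separable {F : Type uF} [Field F] (K K' : Type*) [Field K] [Field K']
    [Algebra F K] [Algebra F K'] [FiniteDimensional F K] [FiniteDimensional F K']
    [Algebra.IsSeparable F K] [Algebra.IsSeparable F K'] :
    ∃ (N : Type uF) (_ : Field N) (_ : Algebra F N), FiniteDimensional F N ∧ IsGalois F N ∧
      Nonempty (K →ₐ[F] N) ∧ Nonempty (K' →ₐ[F] N) := by
  let j : K →ₐ[F] SeparableClosure F := IsSepClosed.lift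
  let j' : K' →ₐ[F] SeparableClosure F := IsSepClosed.lift
  have h1 : Algebra.IsSeparable F j.fieldRange :=
    AlgEquiv.Algebra.isSeparable (AlgEquiv.ofInjectiveField j)
  have h2 : Algebra.IsSeparable F j'.fieldRange :=
    AlgEquiv.Algebra.isSeparable (AlgEquiv.ofInjectiveField j')
  have h3 : FiniteDimensional F j.fieldRange :=
    (AlgEquiv.ofInjectiveField j).toLinearEquiv.finiteDimensional
  have h4 : FiniteDimensional F j'.fieldRange :=
    (AlgEquiv.ofInjectiveField j').toLinearEquiv.finiteDimensional
  have h5 : Algebra.IsSeparable F (j.fieldRange ⊔ j'.fieldRange : IntermediateField F _) :=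
    inferInstance
  have h6 : FiniteDimensional F (j.fieldRange ⊔ j'.fieldRange : IntermediateField F _) :=
    inferInstance
  have hle : j.fieldRange ⊔ j'.fieldRange ≤ IntermediateField.normalClosure F
    (j.fieldRange ⊔ j'.fieldRange : IntermediateField F _) (SeparableClosure F) :=
    IntermediateField.le_normalClosure _
  refine ⟨IntermediateField.normalClosure F
    (j.fieldRange ⊔ j'.fieldRange : IntermediateField F _) (SeparableClosure F),
    inferInstance, inferInstance, inferInstance,
    inferInstance, ?_, ?_⟩
  · exact ⟨(IntermediateField.inclusion (le_sup_left.trans hle)).comp j.rangeRestrict⟩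
  · exact ⟨(IntermediateField.inclusion (le_sup_right.trans hle)).comp j'.rangeRestrict⟩

universe uS

theorem exists_separable_splitting_field (F L : Type*) (S : Type uS) [Field F] [Field L]
    [DivisionRing S] [Algebra F L] [Algebra L S] [Algebra.IsCentral L S]
    [FiniteDimensional L S] [FiniteDimensional F L] [Algebra.IsSeparable F L] :
    ∃ (K : Type uS) (_ : Field K) (_ : Algebra F K) (_ : Algebra L K),
      IsScalarTower F L K ∧ FiniteDimensional F K ∧ Algebra.IsSeparable F K ∧
      Nonempty (K →ₐ[L] S) ∧ Module.finrank L K ^ 2 = Module.finrank L S := by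
  obtain ⟨θ, hθ, hc⟩ := exists_separable_maximal_subfield L S
  let _ : Field (Algebra.adjoin L {θ}) := fieldSubalgebra _ (adjoin_commute (by simp))
  have hθK : θ ∈ Algebra.adjoin L {θ} := Algebra.self_mem_adjoin_singleton L θ
  have h1 : Algebra.IsSeparable L (Algebra.adjoin L {θ}) := by
    refine isSeparable_of_adjoin_eq_top (x := ⟨θ, hθK⟩) ((isSeparable_coe _ ⟨θ, hθK⟩).1 hθ) ?_
    rw [← Algebra.adjoin_adjoin_coe_preimage (R := L) (s := {θ})]
    congr 1
    ext x
    simp [Subtype.ext_iff]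
  let _ : Algebra F (Algebra.adjoin L {θ}) :=
    ((algebraMap L (Algebra.adjoin L {θ})).comp (algebraMap F L)).toAlgebra
  have h2 : IsScalarTower F L (Algebra.adjoin L {θ}) := IsScalarTower.of_algebraMap_eq fun _ => rfl
  exact ⟨Algebra.adjoin L {θ}, inferInstance, inferInstance, inferInstance, h2,
    Module.Finite.trans L _, Algebra.IsSeparable.trans F L _, ⟨(Algebra.adjoin L {θ}).val⟩,
    finrank_sq_of_centralizer_eq hc⟩

/-- The key existence theorem: under conditions of linear disjointness, the `p`-component of a
division algebra contains a division algebra which is central over the ground field. -/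
theorem exists_central_algHom {F : Type uF} {L L' S S' : Type*} [Field F] [Field L] [Field L']
    [DivisionRing S] [DivisionRing S'] [Algebra F L] [Algebra F L'] [Algebra F S] [Algebra F S']
    [Algebra L S] [Algebra L' S'] [IsScalarTower F L S] [IsScalarTower F L' S']
    [FiniteDimensional F S] [FiniteDimensional F S'] [FiniteDimensional L S]
    [FiniteDimensional L' S'] [FiniteDimensional F L] [FiniteDimensional F L']
    [Algebra.IsCentral L S] [Algebra.IsCentral L' S']
    [Algebra.IsSeparable F L] [Algebra.IsSeparable F L'] {p k m m' : ℕ} (hp : p.Prime)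
    (hL : ¬ p ∣ Module.finrank F L) (hL' : ¬ p ∣ Module.finrank F L')
    (hS : Module.finrank L S = (p ^ k * m) ^ 2)
    (hS' : Module.finrank L' S' = (p ^ k * m') ^ 2) (hm' : ¬ p ∣ m')
    (σ : S →ₐ[F] S') (hσ : ∀ s l, Commute (σ s) (IsScalarTower.toAlgHom F L' S' l))
    (hinj : Function.Injective (Algebra.TensorProduct.lift σ (IsScalarTower.toAlgHom F L' S') hσ)) :
    ∃ (A : Type uF) (_ : DivisionRing A) (_ : Algebra F A), FiniteDimensional F A ∧
      Algebra.IsCentral F A ∧ Module.finrank F A = (p ^ k) ^ 2 ∧ Nonempty (A →ₐ[F] S') := by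
  obtain ⟨K, _, _, _, _, _, _, ⟨ι⟩, hK⟩ := exists_separable_splitting_field F L S
  obtain ⟨K', _, _, _, _, _, _, ⟨ι'⟩, hK'⟩ := exists_separable_splitting_field F L' S'
  obtain ⟨N, _, _, _, _, ⟨j⟩, ⟨j'⟩⟩ := exists_isGalois_of_separable (F := F) K K'
  let _ : Algebra L N := (j.toRingHom.comp (algebraMap L K)).toAlgebra
  let _ : Algebra L' N := (j'.toRingHom.comp (algebraMap L' K')).toAlgebra
  have : IsScalarTower F L N := IsScalarTower.of_algebraMap_eq fun c => by
    change algebraMap F N c = j (algebraMap L K (algebraMap F L c))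
    rw [← IsScalarTower.algebraMap_apply F L K, AlgHom.commutes]
  have : IsScalarTower F L' N := IsScalarTower.of_algebraMap_eq fun c => by
    change algebraMap F N c = j' (algebraMap L' K' (algebraMap F L' c))
    rw [← IsScalarTower.algebraMap_apply F L' K', AlgHom.commutes]
  let jL : K →ₐ[L] N := { j.toRingHom with commutes' := fun _ => rfl }
  let jL' : K' →ₐ[L'] N := { j'.toRingHom with commutes' := fun _ => rfl }
  obtain ⟨ρ⟩ := exists_splitting_rep ι jL hK
  obtain ⟨ρ'⟩ := exists_splitting_rep ι' jL' hK'
  obtain ⟨τ, f, hτ, hτρ⟩ := exists_semilinearFamily (F := F) ρ hK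
  obtain ⟨τ', f', hτ', hτρ'⟩ := exists_semilinearFamily (F := F) ρ' hK'
  have ha : Module.finrank L K = p ^ k * m := by
    rw [hS] at hK
    exact Nat.pow_left_injective (n := 2) (by norm_num) hK
  have ha' : Module.finrank L' K' = p ^ k * m' := by
    rw [hS'] at hK'
    exact Nat.pow_left_injective (n := 2) (by norm_num) hK'
  obtain ⟨w, hw, hcob⟩ := isCob_pow_of_injective ρ ρ' hK' hτ hτ' hτρ hτρ' _ hinj (fun l => by
    rw [Algebra.TensorProduct.lift_tmul, map_one, one_mul]
    rfl)
  have hpos : 0 < Module.finrank L K := by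
    have : 0 < Module.finrank L S := Module.finrank_pos
    rw [← hK] at this
    exact Nat.pos_of_ne_zero fun h => by simp [h] at this
  have hpos' : 0 < Module.finrank L' K' := by
    have : 0 < Module.finrank L' S' := Module.finrank_pos
    rw [← hK'] at this
    exact Nat.pos_of_ne_zero fun h => by simp [h] at this
  -- Both degrees contain the same power `p ^ k`, so after cancelling it `w` divides the number `m'`
  -- prime to `p`: the two classes have the same `p`-part.
  have hw' : w * Module.finrank F L * m = m' := by
    rw [← Module.finrank_mul_finrank F L S, ← Module.finrank_mul_finrank F L' S', ← hK, ← hK'] at hw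
    have h1 : w * Module.finrank F L * Module.finrank L K = Module.finrank L' K' := by
      have hL'pos : 0 < Module.finrank F L' := Module.finrank_pos
      apply Nat.eq_of_mul_eq_mul_left (Nat.mul_pos hL'pos (Nat.mul_pos hpos hpos'))
      linear_combination hw
    rw [ha, ha'] at h1
    apply Nat.eq_of_mul_eq_mul_left (pow_pos hp.pos k)
    linear_combination h1
  have hpw : ¬ p ∣ w := fun h => hm' (by
    rw [← hw']
    exact (h.mul_right _).mul_right _)
  -- `L` and `L'` inherit linear disjointness, so the Galois group is the product of the two
  -- subgroups that fix them.
  have hLL' : Function.Injective ((Algebra.TensorProduct.lift σ (IsScalarTower.toAlgHom F L' S')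
      hσ).comp (Algebra.TensorProduct.map (IsScalarTower.toAlgHom F L S) (AlgHom.id F L'))) := by
    refine hinj.comp ?_
    exact Module.Flat.rTensor_preserves_injective_linearMap (M := L')
      (IsScalarTower.toAlgHom F L S).toLinearMap (algebraMap L S).injective
  have hne : Nonempty (Fin (Module.finrank L K)) := ⟨⟨0, hpos⟩⟩
  have hne' : Nonempty (Fin (Module.finrank L' K')) := ⟨⟨0, hpos'⟩⟩
  obtain ⟨φ, hφ, hφp, hφq⟩ := exists_stable_cocycle hp
    (fun g => exists_mem_fixing _ hLL' g) hτ.isCocycleOn hτ'.isCocycleOn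
    (by rw [index_fixing]; exact (Nat.Prime.coprime_iff_not_dvd hp).2 hL)
    ((Nat.Prime.coprime_iff_not_dvd hp).2 hpw) hcob
  exact exists_algHom_of_cocycle hp ρ' hK' hτ' hτρ' hL' ha' hm' hφ hφp hφq

end Existence

/-! ### Commuting actions of matrix algebras -/

section MatrixAction

variable {E M : Type*} [Field E] [AddCommGroup M] [Module E M] {ι : Type*} [DecidableEq ι]
  (r : ι → ℕ)

/-- The action of a matrix algebra on functions of several indices. -/
def matrixAction {B : Type*} [Ring B] [Algebra E B] (j : ι) (α : B →ₐ[E] Module.End E M) :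
    Matrix (Fin (r j)) (Fin (r j)) B →ₐ[E] Module.End E ((∀ j, Fin (r j)) → M) where
  toFun A :=
    { toFun := fun v I => ∑ k, α (A (I j) k) (v (Function.update I j k))
      map_add' := fun v w => by
        funext I
        simp [Finset.sum_add_distrib]
      map_smul' := fun c v => by
        funext I
        simp [Finset.smul_sum] }
  map_one' := by
    refine LinearMap.ext fun v => funext fun I => ?_
    change ∑ k, α ((1 : Matrix _ _ B) (I j) k) (v (Function.update I j k)) = v I
    rw [Finset.sum_eq_single (I j)]
    · simp
    · intro k _ hk
      simp [Matrix.one_apply_ne' hk]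
    · simp
  map_mul' A B := by
    refine LinearMap.ext fun v => funext fun I => ?_
    change ∑ k, α ((A * B) (I j) k) (v (Function.update I j k)) =
      ∑ k, α (A (I j) k) (∑ l, α (B (Function.update I j k j) l)
        (v (Function.update (Function.update I j k) j l)))
    simp only [Function.update_idem, Function.update_self, Matrix.mul_apply, map_sum, map_mul,
      LinearMap.sum_apply, Module.End.mul_apply]
    rw [Finset.sum_comm]
  map_zero' := by
    refine LinearMap.ext fun v => funext fun I => ?_
    change ∑ k, α 0 (v (Function.update I j k)) = 0
    simp
  map_add' A B := by
    refine LinearMap.ext fun v => funext fun I => ?_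
    change ∑ k, α (A (I j) k + B (I j) k) (v (Function.update I j k)) =
      ∑ k, α (A (I j) k) (v (Function.update I j k)) +
      ∑ k, α (B (I j) k) (v (Function.update I j k))
    simp [Finset.sum_add_distrib]
  commutes' c := by
    refine LinearMap.ext fun v => funext fun I => ?_
    change ∑ k, α ((algebraMap E (Matrix _ _ B) c) (I j) k) (v (Function.update I j k)) = c • v I
    rw [Finset.sum_eq_single (I j)]
    · simp [Matrix.algebraMap_matrix_apply]
    · intro k _ hk
      simp [Matrix.algebraMap_matrix_apply, hk.symm]
    · simp

theorem matrixAction_apply {B : Type*} [Ring B] [Algebra E B] (j : ι) (α : B →ₐ[E] Module.End E M)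
    (A : Matrix (Fin (r j)) (Fin (r j)) B) (v : (∀ j, Fin (r j)) → M) (I : ∀ j, Fin (r j)) :
    matrixAction r j α A v I = ∑ k, α (A (I j) k) (v (Function.update I j k)) := rfl

theorem matrixAction_commute {B B' : Type*} [Ring B] [Algebra E B] [Ring B'] [Algebra E B']
    {i j : ι} (hij : i ≠ j) (α : B →ₐ[E] Module.End E M) (β : B' →ₐ[E] Module.End E M)
    (h : ∀ x y, Commute (α x) (β y)) (A : Matrix (Fin (r i)) (Fin (r i)) B)
    (A' : Matrix (Fin (r j)) (Fin (r j)) B') :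
    Commute (matrixAction r i α A) (matrixAction r j β A') := by
  refine LinearMap.ext fun v => funext fun I => ?_
  simp only [Module.End.mul_apply, matrixAction_apply, map_sum]
  rw [Finset.sum_comm]
  refine Finset.sum_congr rfl fun l _ => Finset.sum_congr rfl fun k _ => ?_
  rw [Function.update_of_ne hij.symm, Function.update_of_ne hij, Function.update_comm hij,
    ← Module.End.mul_apply, (h _ _).eq, Module.End.mul_apply]

end MatrixAction

theorem commute_singleAlgHom {E ι : Type*} [Field E] [DecidableEq ι] {S : ι → Type*}
    [∀ j, Ring (S j)] [∀ j, Algebra E (S j)] {i j : ι} (hij : i ≠ j) (x : S i) (y : S j) :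
    Commute (PiTensorProduct.singleAlgHom (R := E) i x) (PiTensorProduct.singleAlgHom j y) := by
  change _ * _ = _ * _
  rw [PiTensorProduct.singleAlgHom_apply, PiTensorProduct.singleAlgHom_apply,
    PiTensorProduct.tprod_mul_tprod, PiTensorProduct.tprod_mul_tprod]
  exact congrArg _ (Pi.mulSingle_commute hij x y)

universe uE

/-- Every space with commuting actions of the algebras has a dimension which is divisible by the
`p`-parts of their dimensions. -/
def PDiv (p : ℕ) (E : Type uE) [Field E] {ι : Type} [Fintype ι] (S : ι → Type uE)
    [∀ j, DivisionRing (S j)] [∀ j, Algebra E (S j)] : Prop :=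
  ∀ (M : Type uE) [AddCommGroup M] [Module E M] [FiniteDimensional E M]
    (α : ∀ j, S j →ₐ[E] Module.End E M),
    (Pairwise fun i j => ∀ x y, Commute (α i x) (α j y)) →
      p ^ (∑ j, padicValNat p (Module.finrank E (S j))) ∣ Module.finrank E M

/-! ### Families of division algebras under extension of the center -/

section Step

variable {p : ℕ} {E : Type uE} [Field E] {ι : Type} [Fintype ι] {S : ι → Type uE}
  [∀ j, DivisionRing (S j)] [∀ j, Algebra E (S j)] [∀ j, FiniteDimensional E (S j)]
  [∀ j, Algebra.IsCentral E (S j)]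

theorem padicValNat_prod {ι : Type*} (p : ℕ) (hp : p.Prime) (s : Finset ι) (f : ι → ℕ)
    (hf : ∀ i ∈ s, f i ≠ 0) :
    padicValNat p (∏ i ∈ s, f i) = ∑ i ∈ s, padicValNat p (f i) := by
  classical
  have := Fact.mk hp
  induction s using Finset.induction_on with
  | empty => simp
  | insert a s ha ih =>
    rw [Finset.prod_insert ha, Finset.sum_insert ha, padicValNat.mul (hf a (by simp))
      (Finset.prod_ne_zero_iff.2 fun i hi => hf i (by simp [hi])), ih fun i hi => hf i (by simp [hi])]

/-- The passage to an extension field. -/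
theorem PDiv.exists_extension (hp : p.Prime) (h : PDiv p E S) (E' : Type uE) [Field E']
    [Algebra E E'] [FiniteDimensional E E'] :
    ∃ (S' : ι → Type uE) (_ : ∀ j, DivisionRing (S' j)) (_ : ∀ j, Algebra E' (S' j)) (r : ι → ℕ),
      (∀ j, FiniteDimensional E' (S' j)) ∧ (∀ j, Algebra.IsCentral E' (S' j)) ∧
      (∀ j, r j ≠ 0 ∧ Nonempty (E' ⊗[E] S j ≃ₐ[E'] Matrix (Fin (r j)) (Fin (r j)) (S' j))) ∧
      (∀ j, Module.finrank E (S j) = r j ^ 2 * Module.finrank E' (S' j)) ∧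
      (∑ j, padicValNat p (r j) ≤ padicValNat p (Module.finrank E E')) ∧
      (padicValNat p (Module.finrank E E') ≤ ∑ j, padicValNat p (r j) → PDiv p E' S') := by
  classical
  have := Fact.mk hp
  have hW : ∀ j, ∃ (n : ℕ) (_ : NeZero n) (D : Type uE) (_ : DivisionRing D) (_ : Algebra E' D)
      (_ : Module.Finite E' D), Nonempty (E' ⊗[E] S j ≃ₐ[E'] Matrix (Fin n) (Fin n) D) := fun j => by
    have : IsArtinianRing (E' ⊗[E] S j) := isArtinianRing_of_finiteDimensional E' (E' ⊗[E] S j)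
    exact IsSimpleRing.exists_algEquiv_matrix_divisionRing_finite E' (E' ⊗[E] S j)
  choose r hr S' hS'd hS'a hS'f e using hW
  have hr0 : ∀ j, r j ≠ 0 := fun j => (hr j).out
  have hdim : ∀ j, Module.finrank E (S j) = r j ^ 2 * Module.finrank E' (S' j) := fun j => by
    obtain ⟨e⟩ := e j
    rw [← Module.finrank_baseChange (R := E'), e.toLinearEquiv.finrank_eq, Module.finrank_matrix]
    simp [sq]
  have hcent : ∀ j, Algebra.IsCentral E' (S' j) := fun j => by
    obtain ⟨e⟩ := e j
    have : Algebra.IsCentral E' (Matrix (Fin (r j)) (Fin (r j)) (S' j)) :=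
      Algebra.IsCentral.of_algEquiv E' _ _ e
    exact isCentral_of_matrix (r := r j)
  have hpos : ∀ j, Module.finrank E' (S' j) ≠ 0 := fun j => Module.finrank_pos.ne'
  have hv : ∑ j, padicValNat p (Module.finrank E (S j)) =
      2 * ∑ j, padicValNat p (r j) + ∑ j, padicValNat p (Module.finrank E' (S' j)) := by
    rw [Finset.mul_sum, ← Finset.sum_add_distrib]
    refine Finset.sum_congr rfl fun j _ => ?_
    rw [hdim, padicValNat.mul (pow_ne_zero _ (hr0 j)) (hpos j), padicValNat.pow]
  -- `M` inflated by all the matrix sizes `r j` carries commuting actions of the `S j` over `E`. Its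
  -- dimension gains `∏ r j`, whereas the dimensions of the `S j` contain the squares of the `r j`;
  -- hence only one `r j` survives in the inequality.
  have key : ∀ (M : Type uE) [AddCommGroup M] [Module E' M] [FiniteDimensional E' M]
      (α : ∀ j, S' j →ₐ[E'] Module.End E' M),
      (Pairwise fun i j => ∀ x y, Commute (α i x) (α j y)) → Module.finrank E' M ≠ 0 →
      ∑ j, padicValNat p (r j) + ∑ j, padicValNat p (Module.finrank E' (S' j)) ≤
        padicValNat p (Module.finrank E E') + padicValNat p (Module.finrank E' M) := by
    intro M _ _ _ α hα hM
    let _ : Module E ((∀ j, Fin (r j)) → M) := Module.compHom _ (algebraMap E E')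
    have hsm : ∀ (c : E) (v : (∀ j, Fin (r j)) → M), c • v = algebraMap E E' c • v := fun _ _ => rfl
    have : IsScalarTower E E' ((∀ j, Fin (r j)) → M) := ⟨fun c d v => by
      rw [hsm, Algebra.smul_def, mul_smul]⟩
    have : FiniteDimensional E ((∀ j, Fin (r j)) → M) := Module.Finite.trans E' _
    let res : Module.End E' ((∀ j, Fin (r j)) → M) →ₐ[E] Module.End E ((∀ j, Fin (r j)) → M) :=
      { toFun := fun f => f.restrictScalars E
        map_one' := rfl
        map_mul' := fun _ _ => rfl
        map_zero' := rfl
        map_add' := fun _ _ => rfl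
        commutes' := fun _ => rfl }
    let β : ∀ j, S j →ₐ[E] Module.End E ((∀ j, Fin (r j)) → M) := fun j =>
      (res.comp (((matrixAction r j (α j)).comp (e j).some.toAlgHom).restrictScalars E)).comp
        Algebra.TensorProduct.includeRight
    have h1 := h _ β (fun i j hij x y =>
      (matrixAction_commute r hij (α i) (α j) (hα hij) _ _).map res)
    rw [← Module.finrank_mul_finrank E E', Module.finrank_pi_fintype, Finset.sum_const,
      Finset.card_univ, Fintype.card_pi, smul_eq_mul] at h1
    simp only [Fintype.card_fin] at h1
    have hE : Module.finrank E E' ≠ 0 := Module.finrank_pos.ne'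
    have hprod : ∏ j, r j ≠ 0 := Finset.prod_ne_zero_iff.2 fun j _ => hr0 j
    rw [padicValNat_dvd_iff_le (mul_ne_zero hE (mul_ne_zero hprod hM)), hv,
      padicValNat.mul hE (mul_ne_zero hprod hM), padicValNat.mul hprod hM,
      padicValNat_prod p hp _ _ fun j _ => hr0 j] at h1
    omega
  -- Apply `key` to the tensor product of the new algebras acting on itself, where the terms of the
  -- `S' j` cancel.
  have hle : ∑ j, padicValNat p (r j) ≤ padicValNat p (Module.finrank E E') := by
    have h1 := key (⨂[E'] j, S' j)
      (fun j => (Algebra.lmul E' _).comp (PiTensorProduct.singleAlgHom j))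
      (fun i j hij x y => (Commute.map (commute_singleAlgHom hij x y)
        (Algebra.lmul E' (⨂[E'] j, S' j))))
      (by
        rw [finrank_piTensorProduct]
        exact Finset.prod_ne_zero_iff.2 fun j _ => hpos j)
    rw [finrank_piTensorProduct, padicValNat_prod p hp _ _ fun j _ => hpos j] at h1
    omega
  refine ⟨S', hS'd, hS'a, r, hS'f, hcent, fun j => ⟨hr0 j, e j⟩, hdim, hle, fun hle' => ?_⟩
  intro M _ _ _ α hα
  by_cases hM : Module.finrank E' M = 0
  · rw [hM]; exact dvd_zero _
  have h1 := key M α hα hM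
  rw [padicValNat_dvd_iff_le hM]
  omega

end Step

/-! ### Kronecker products of semilinear families -/

section TensorFamily

variable (F N : Type*) [Field F] [Field N] [Algebra F N]

/-- The coordinatewise action on functions on a set. -/
def functionFamily (I : Type*) : SemilinearFamily F N (I → N) where
  toFun g :=
    { toFun := fun v i => g (v i)
      invFun := fun v i => g.symm (v i)
      left_inv := fun v => by ext; simp
      right_inv := fun v => by ext; simp
      map_add' := fun v w => by ext; simp }
  semilinear g c v := by ext; simp

variable {F N} {K : Type*} [Fintype K] [DecidableEq K] {r : K → ℕ}

/-- The matrices of a semilinear family. -/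
def familyMatrix {a : ℕ} (τ : SemilinearFamily F N (Fin a → N)) (g : N ≃ₐ[F] N) :
    Matrix (Fin a) (Fin a) N :=
  LinearMap.toMatrix' ((functionFamily F N (Fin a)).hom τ g LinearMap.id)

/-- The inverses of the matrices of a semilinear family. -/
def familyMatrixInv {a : ℕ} (τ : SemilinearFamily F N (Fin a → N)) (g : N ≃ₐ[F] N) :
    Matrix (Fin a) (Fin a) N :=
  LinearMap.toMatrix' (τ.hom (functionFamily F N (Fin a)) g LinearMap.id)

theorem familyMatrix_mulVec {a : ℕ} (τ : SemilinearFamily F N (Fin a → N)) (g : N ≃ₐ[F] N)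
    (v : Fin a → N) :
    (familyMatrix τ g).mulVec v = τ g (((functionFamily F N (Fin a)) g).symm v) := by
  rw [← Matrix.toLin'_apply, familyMatrix, Matrix.toLin'_toMatrix']
  rfl

theorem familyMatrix_mul_inv {a : ℕ} (τ : SemilinearFamily F N (Fin a → N)) (g : N ≃ₐ[F] N) :
    familyMatrix τ g * familyMatrixInv τ g = 1 := by
  rw [familyMatrix, familyMatrixInv, ← LinearMap.toMatrix'_mul, ← LinearMap.toMatrix'_one]
  congr 1
  refine LinearMap.ext fun v => ?_
  change τ g (((functionFamily F N (Fin a)) g).symm ((functionFamily F N (Fin a)) g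
    ((τ g).symm v))) = v
  simp

theorem familyMatrixInv_mul {a : ℕ} (τ : SemilinearFamily F N (Fin a → N)) (g : N ≃ₐ[F] N) :
    familyMatrixInv τ g * familyMatrix τ g = 1 := by
  rw [familyMatrix, familyMatrixInv, ← LinearMap.toMatrix'_mul, ← LinearMap.toMatrix'_one]
  congr 1
  refine LinearMap.ext fun v => ?_
  change (functionFamily F N (Fin a)) g ((τ g).symm (τ g (((functionFamily F N (Fin a)) g).symm
    v))) = v
  simp

theorem map_mulVec_symm {a : ℕ} (X : Matrix (Fin a) (Fin a) N) (g : N ≃ₐ[F] N) (v : Fin a → N) :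
    ((functionFamily F N (Fin a)) g).symm ((X.map g).mulVec v) =
      X.mulVec (((functionFamily F N (Fin a)) g).symm v) := by
  funext i
  change g.symm (∑ j, g (X i j) * v j) = ∑ j, X i j * g.symm (v j)
  simp

/-- The action of a family of matrices on the tensor product of the coordinate spaces. -/
noncomputable def kron (r : K → ℕ) : (∀ k, Matrix (Fin (r k)) (Fin (r k)) N) →*
    Module.End N ((∀ k, Fin (r k)) → N) :=
  piMonoidHom (fun k => matrixAction r k (Algebra.lmul N N))
    (fun _ _ hij => matrixAction_commute r hij _ _ fun x y =>
      (Commute.all x y).map (Algebra.lmul N N))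

theorem kron_mulSingle (k : K) (X : Matrix (Fin (r k)) (Fin (r k)) N) :
    kron r (Pi.mulSingle k X) = matrixAction r k (Algebra.lmul N N) X :=
  piMonoidHom_mulSingle _ _ _ _

/-- Both sides are multiplicative in `c`, so families concentrated in one factor suffice. -/
theorem kron_algebraMap (c : K → N) :
    kron r (fun k => algebraMap N (Matrix (Fin (r k)) (Fin (r k)) N) (c k)) = algebraMap N _ (∏ k, c k) := by
  let f : (K → N) →* Module.End N ((∀ k, Fin (r k)) → N) :=
    (kron r).comp (MonoidHom.piMap fun k =>
      (algebraMap N (Matrix (Fin (r k)) (Fin (r k)) N) : N →* _))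
  let g : (K → N) →* Module.End N ((∀ k, Fin (r k)) → N) :=
    (algebraMap N (Module.End N ((∀ k, Fin (r k)) → N)) : N →* _).comp
      { toFun := fun c => ∏ k, c k
        map_one' := by simp
        map_mul' := fun a b => Finset.prod_mul_distrib }
  have h : f = g := by
    refine MonoidHom.pi_ext fun k c => ?_
    change kron r (fun l => algebraMap N (Matrix (Fin (r l)) (Fin (r l)) N) ((Pi.mulSingle k c : K → N) l)) =
      algebraMap N _ (∏ l, (Pi.mulSingle k c : K → N) l)
    have h1 : (fun l => algebraMap N (Matrix (Fin (r l)) (Fin (r l)) N)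
        ((Pi.mulSingle k c : K → N) l)) = Pi.mulSingle k (algebraMap N _ c) := by
      funext l
      by_cases hl : l = k
      · subst hl; simp
      · simp [hl]
    rw [h1, kron_mulSingle, Fintype.prod_pi_mulSingle', AlgHom.commutes]
  exact DFunLike.congr_fun h c

theorem functionFamily_kron (g : N ≃ₐ[F] N) (X : ∀ k, Matrix (Fin (r k)) (Fin (r k)) N)
    (w : (∀ k, Fin (r k)) → N) :
    functionFamily F N _ g (kron r X w) =
      kron r (fun k => (X k).map g) (functionFamily F N _ g w) := by
  let γ := functionFamily F N (∀ k, Fin (r k))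
  let f : (∀ k, Matrix (Fin (r k)) (Fin (r k)) N) →* Module.End N ((∀ k, Fin (r k)) → N) :=
    { toFun := fun X => γ.hom γ g (kron r X)
      map_one' := by
        rw [map_one]
        exact LinearMap.ext fun v => (γ g).apply_symm_apply v
      map_mul' := fun X Y => by
        rw [map_mul]
        refine LinearMap.ext fun v => ?_
        change γ g (kron r X (kron r Y ((γ g).symm v))) =
          γ g (kron r X ((γ g).symm (γ g (kron r Y ((γ g).symm v)))))
        rw [AddEquiv.symm_apply_apply] }
  let f' : (∀ k, Matrix (Fin (r k)) (Fin (r k)) N) →* Module.End N ((∀ k, Fin (r k)) → N) :=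
    (kron r).comp (MonoidHom.piMap fun k =>
      ((g : N →+* N).mapMatrix : Matrix (Fin (r k)) (Fin (r k)) N →+* _).toMonoidHom)
  have h : f = f' := by
    refine MonoidHom.pi_ext fun k Y => ?_
    have h1 : f' (Pi.mulSingle k Y) = kron r (Pi.mulSingle k (Y.map g)) := by
      change kron r _ = _
      congr 1
      funext l
      by_cases hl : l = k
      · subst hl
        simp [MonoidHom.piMap_apply]
      · simp [MonoidHom.piMap_apply, hl]
    rw [h1, kron_mulSingle]
    change γ.hom γ g (kron r (Pi.mulSingle k Y)) = _
    rw [kron_mulSingle]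
    refine LinearMap.ext fun v => funext fun I => ?_
    change g (∑ l, Y (I k) l * g.symm (v (Function.update I k l))) =
      ∑ l, g (Y (I k) l) * v (Function.update I k l)
    simp
  have h2 := congrArg (fun φ => φ (functionFamily F N _ g w)) (DFunLike.congr_fun h X)
  refine Eq.trans ?_ h2
  change _ = γ g (kron r X ((γ g).symm (γ g w)))
  rw [AddEquiv.symm_apply_apply]

/-- The tensor product of semilinear families. -/
noncomputable def tensorFamily (τ : ∀ k, SemilinearFamily F N (Fin (r k) → N)) :
    SemilinearFamily F N ((∀ k, Fin (r k)) → N) where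
  toFun g :=
    { toFun := fun w => kron r (fun k => familyMatrix (τ k) g) (functionFamily F N _ g w)
      invFun := fun w =>
        (functionFamily F N _ g).symm (kron r (fun k => familyMatrixInv (τ k) g) w)
      left_inv := fun w => by
        beta_reduce
        rw [← Module.End.mul_apply, ← map_mul]
        have : (fun k => familyMatrixInv (τ k) g) * (fun k => familyMatrix (τ k) g) = 1 :=
          funext fun k => familyMatrixInv_mul _ _
        rw [this, map_one, Module.End.one_apply, AddEquiv.symm_apply_apply]
      right_inv := fun w => by
        beta_reduce
        rw [AddEquiv.apply_symm_apply, ← Module.End.mul_apply, ← map_mul]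
        have : (fun k => familyMatrix (τ k) g) * (fun k => familyMatrixInv (τ k) g) = 1 :=
          funext fun k => familyMatrix_mul_inv _ _
        rw [this, map_one, Module.End.one_apply]
      map_add' := fun v w => by rw [map_add, map_add] }
  semilinear g c v := by
    change kron r _ (functionFamily F N _ g (c • v)) = _
    rw [(functionFamily F N _).semilinear, map_smul]
    rfl

theorem tensorFamily_apply (τ : ∀ k, SemilinearFamily F N (Fin (r k) → N)) (g : N ≃ₐ[F] N)
    (w : (∀ k, Fin (r k)) → N) : tensorFamily τ g w =
      kron r (fun k => familyMatrix (τ k) g) (functionFamily F N _ g w) := rfl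

theorem hasMultiplier_tensorFamily {τ : ∀ k, SemilinearFamily F N (Fin (r k) → N)}
    {H : Subgroup (N ≃ₐ[F] N)} {f : K → (N ≃ₐ[F] N) → (N ≃ₐ[F] N) → Nˣ}
    (hf : ∀ k, (τ k).HasMultiplier H (f k)) : (tensorFamily τ).HasMultiplier H (∏ k, f k) := by
  intro g hg h hh w
  rw [tensorFamily_apply, tensorFamily_apply, functionFamily_kron, ← Module.End.mul_apply,
    ← map_mul, tensorFamily_apply]
  have h1 : (fun k => familyMatrix (τ k) g) * (fun k => (familyMatrix (τ k) h).map g) =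
      (fun k => algebraMap N _ (f k g h : N)) * (fun k => familyMatrix (τ k) (g * h)) := by
    funext k
    refine Matrix.toLin'.injective (LinearMap.ext fun v => ?_)
    simp only [Pi.mul_apply, Matrix.toLin'_apply]
    rw [← Matrix.mulVec_mulVec, familyMatrix_mulVec, map_mulVec_symm, familyMatrix_mulVec,
      hf k g hg h hh, ← Algebra.smul_def, Matrix.smul_mulVec, familyMatrix_mulVec]
    rfl
  have h2 : ((∏ k, f k) g h : N) = ∏ k, (f k g h : N) := by
    rw [Finset.prod_apply, Finset.prod_apply, Units.coe_prod]
  rw [h1, map_mul, kron_algebraMap, h2, Module.End.mul_apply, Module.algebraMap_end_apply]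
  rfl

theorem tensorFamily_matrixAction (τ : ∀ k, SemilinearFamily F N (Fin (r k) → N))
    (g : N ≃ₐ[F] N) (k : K) (X : Module.End N (Fin (r k) → N))
    (hX : ∀ v, τ k g (X v) = X (τ k g v)) (w : (∀ k, Fin (r k)) → N) :
    tensorFamily τ g (matrixAction r k (Algebra.lmul N N) (LinearMap.toMatrix' X) w) =
      matrixAction r k (Algebra.lmul N N) (LinearMap.toMatrix' X) (tensorFamily τ g w) := by
  rw [tensorFamily_apply, tensorFamily_apply, ← kron_mulSingle, functionFamily_kron,
    ← Module.End.mul_apply, ← Module.End.mul_apply, ← map_mul, ← map_mul]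
  congr 2
  funext l
  by_cases hl : l = k
  · subst hl
    refine Matrix.toLin'.injective (LinearMap.ext fun v => ?_)
    simp only [Pi.mul_apply, Matrix.toLin'_apply, Pi.mulSingle_eq_same]
    rw [← Matrix.mulVec_mulVec, familyMatrix_mulVec, map_mulVec_symm, ← Matrix.mulVec_mulVec,
      familyMatrix_mulVec, ← Matrix.toLin'_apply, Matrix.toLin'_toMatrix',
      ← Matrix.toLin'_apply (LinearMap.toMatrix' X), Matrix.toLin'_toMatrix', hX]
  · simp [hl]

end TensorFamily

/-! ### Splitting the p-th powers of algebras of degree p -/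

section Splitting

theorem exists_isGalois_of_separable_family {F : Type uF} [Field F] {ι : Type*} [Finite ι]
    (K : ι → Type*) [∀ i, Field (K i)] [∀ i, Algebra F (K i)] [∀ i, FiniteDimensional F (K i)]
    [∀ i, Algebra.IsSeparable F (K i)] :
    ∃ (N : Type uF) (_ : Field N) (_ : Algebra F N), FiniteDimensional F N ∧ IsGalois F N ∧
      ∀ i, Nonempty (K i →ₐ[F] N) := by
  let j : ∀ i, K i →ₐ[F] SeparableClosure F := fun i => IsSepClosed.lift
  have h4 : ∀ i, FiniteDimensional F (j i).fieldRange := fun i =>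
    (AlgEquiv.ofInjectiveField (j i)).toLinearEquiv.finiteDimensional
  have h6 : FiniteDimensional F (⨆ i, (j i).fieldRange : IntermediateField F _) :=
    IntermediateField.finiteDimensional_iSup_of_finite
  have hle : ⨆ i, (j i).fieldRange ≤ IntermediateField.normalClosure F
    (⨆ i, (j i).fieldRange : IntermediateField F _) (SeparableClosure F) :=
    IntermediateField.le_normalClosure _
  have h5 : Algebra.IsSeparable F (IntermediateField.normalClosure F
    (⨆ i, (j i).fieldRange : IntermediateField F _) (SeparableClosure F)) :=
    Algebra.isSeparable_tower_bot_of_isSeparable F _ (SeparableClosure F)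
  refine ⟨IntermediateField.normalClosure F
    (⨆ i, (j i).fieldRange : IntermediateField F _) (SeparableClosure F),
    inferInstance, inferInstance, inferInstance, ⟨⟩, fun i => ?_⟩
  exact ⟨(IntermediateField.inclusion ((le_iSup (fun i => (j i).fieldRange) i).trans hle)).comp
    (j i).rangeRestrict⟩

theorem exists_separable_maximal_field (E : Type*) (S : Type uS) [Field E] [DivisionRing S]
    [Algebra E S] [Algebra.IsCentral E S] [FiniteDimensional E S] :
    ∃ (K : Type uS) (_ : Field K) (_ : Algebra E K), FiniteDimensional E K ∧
      Algebra.IsSeparable E K ∧ Nonempty (K →ₐ[E] S) ∧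
      Module.finrank E K ^ 2 = Module.finrank E S := by
  obtain ⟨K, _, i₁, i₂, ht, hfd, hsep, hS, hdim⟩ := exists_separable_splitting_field E E S
  obtain rfl : i₁ = i₂ := Algebra.algebra_ext _ _ fun x =>
    @IsScalarTower.algebraMap_apply E E K _ _ _ _ i₂ i₁ ht x
  exact ⟨K, inferInstance, inferInstance, hfd, hsep, hS, hdim⟩

/-- The action on an invariant subspace. -/
def restrictAction {E M B : Type*} [Field E] [AddCommGroup M] [Module E M] [Ring B] [Algebra E B]
    (φ : B →ₐ[E] Module.End E M) (Y : Submodule E M) (h : ∀ b, ∀ y ∈ Y, φ b y ∈ Y) :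
    B →ₐ[E] Module.End E Y where
  toFun b := (φ b).restrict (h b)
  map_one' := by ext; simp
  map_mul' a b := by ext; simp
  map_zero' := by ext; simp
  map_add' a b := by ext; simp
  commutes' c := by ext; simp

theorem isCob_prod {G M κ : Type*} [Group G] [CommGroup M] [MulDistribMulAction G M]
    {H : Subgroup G} (s : Finset κ) (f : κ → G → G → M) (h : ∀ i ∈ s, IsCob H (f i)) :
    IsCob H (∏ i ∈ s, f i) :=
  Finset.prod_induction f (IsCob H) (fun _ _ ha hb => ha.mul hb) ⟨1, fun g _ h _ => by simp⟩ h

variable {p : ℕ} {E : Type uE} [Field E] {ι : Type} [Fintype ι] [DecidableEq ι]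
  (S : ι → Type uE)
  [∀ j, DivisionRing (S j)] [∀ j, Algebra E (S j)] [∀ j, FiniteDimensional E (S j)]
  [∀ j, Algebra.IsCentral E (S j)]

/-- The `p`-th tensor powers of central division algebras of degree `p` are split. -/
theorem exists_splitting_space (hS : ∀ j, Module.finrank E (S j) = p ^ 2) :
    ∃ (M : Type uE) (_ : AddCommGroup M) (_ : Module E M)
      (α : ∀ k : ι × Fin p, S k.1 →ₐ[E] Module.End E M), FiniteDimensional E M ∧
      (Pairwise fun i j => ∀ x y, Commute (α i x) (α j y)) ∧
      Module.finrank E M = p ^ (Fintype.card ι * p) := by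
  choose K hKf hKa hKfd hKsep hKS hKdim using fun j => exists_separable_maximal_field E (S j)
  obtain ⟨N, _, _, _, _, hN⟩ := exists_isGalois_of_separable_family (F := E) K
  have hrp : ∀ j, Module.finrank E (K j) = p := fun j => by
    have := hKdim j
    rw [hS] at this
    exact Nat.pow_left_injective (n := 2) (by norm_num) this
  have hρ : ∀ j, ∃ ρ : S j →ₐ[E] Module.End N (Fin p → N), True := fun j => by
    obtain ⟨ρ⟩ := exists_splitting_rep (hKS j).some (hN j).some (hKdim j)
    rw [hrp] at ρ
    exact ⟨ρ, trivial⟩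
  choose ρ _ using hρ
  choose τ f hτf hτρ using fun j => exists_semilinearFamily (F := E) (ρ j) (hS j).symm
  have htop : fixing E E N = ⊤ := top_le_iff.1 fun g _ => mem_fixing.2 fun l => g.commutes l
  rw [htop] at hτf hτρ
  let r : ι × Fin p → ℕ := fun _ => p
  have h1 : (tensorFamily (r := r) fun k => τ k.1).HasMultiplier ⊤ (∏ k : ι × Fin p, f k.1) :=
    hasMultiplier_tensorFamily (r := r) fun k => hτf k.1
  -- Each `f j` occurs `p` times, and `f j ^ p` is a coboundary by determinants on a space of
  -- dimension `p`.
  have h2 : IsCob (⊤ : Subgroup (N ≃ₐ[E] N)) (∏ k : ι × Fin p, f k.1) := by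
    rw [Fintype.prod_prod_type]
    simp only [Finset.prod_const, Finset.card_univ, Fintype.card_fin]
    refine isCob_prod _ _ fun j _ => ?_
    have := (hτf j).isCob_pow_finrank
    rwa [Module.finrank_fin_fun] at this
  obtain ⟨b, hb⟩ := h1.exists_rescale (f' := 1) (by simpa using h2)
  let W := (∀ k : ι × Fin p, Fin (r k)) → N
  let σ : SemilinearFamily E N W := (tensorFamily (r := r) fun k => τ k.1).rescale b
  let Y : Submodule E W :=
    { carrier := {v | ∀ g ∈ (⊤ : Subgroup (N ≃ₐ[E] N)), σ g v = v}
      add_mem' := fun ha hb g hg => by rw [map_add, ha g hg, hb g hg]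
      zero_mem' := fun g _ => map_zero _
      smul_mem' := fun c v hv g hg => by
        have : c • v = algebraMap E N c • v := by rw [algebraMap_smul]
        rw [this, σ.semilinear, hv g hg, g.commutes] }
  have hYdim := SemilinearFamily.finrank_fixed hb Y fun v => Iff.rfl
  let res : Module.End N W →ₐ[E] Module.End E W :=
    { toFun := fun f => f.restrictScalars E
      map_one' := rfl
      map_mul' := fun _ _ => rfl
      map_zero' := rfl
      map_add' := fun _ _ => rfl
      commutes' := fun c => LinearMap.ext fun v => by
        change algebraMap E (Module.End N W) c v = c • v
        rw [IsScalarTower.algebraMap_apply E N, Module.algebraMap_end_apply, algebraMap_smul] }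
  let toMat : Module.End N (Fin p → N) →ₐ[E] Matrix (Fin p) (Fin p) N :=
    (LinearMap.toMatrixAlgEquiv' (R := N) (n := Fin p)).toAlgHom.restrictScalars E
  let β : ∀ k : ι × Fin p, S k.1 →ₐ[E] Module.End E W := fun k =>
    (res.comp ((matrixAction r k (Algebra.lmul N N)).restrictScalars E)).comp (toMat.comp (ρ k.1))
  have hβ : Pairwise fun i j => ∀ x y, Commute (β i x) (β j y) := fun i j hij x y =>
    (matrixAction_commute r hij (Algebra.lmul N N) (Algebra.lmul N N)
      (fun x y => (Commute.all x y).map (Algebra.lmul N N)) _ _).map res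
  -- The operators of `S k` commute with the semilinear family, so they preserve its fixed points.
  have hinv : ∀ k x, ∀ w ∈ Y, β k x w ∈ Y := fun k x w hw g hg => by
    have h3 := tensorFamily_matrixAction (r := r) (fun k => τ k.1) g k (ρ k.1 x)
      (hτρ k.1 g hg x) w
    have h4 := hw g hg
    change (b g : N) • tensorFamily (r := r) (fun k => τ k.1) g w = w at h4
    change (b g : N) • tensorFamily (r := r) (fun k => τ k.1) g
      (matrixAction r k (Algebra.lmul N N) (LinearMap.toMatrix' (ρ k.1 x)) w) =
      matrixAction r k (Algebra.lmul N N) (LinearMap.toMatrix' (ρ k.1 x)) w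
    rw [h3, ← map_smul, h4]
  have : FiniteDimensional E W := Module.Finite.trans N W
  refine ⟨Y, inferInstance, inferInstance, fun k => restrictAction (β k) Y (hinv k),
    inferInstance, ?_, ?_⟩
  · intro i j hij x y
    refine LinearMap.ext fun v => Subtype.ext ?_
    exact LinearMap.congr_fun (hβ hij x y) (v : W)
  · rw [hYdim, InfiniteGalois.fixedField_bot, IntermediateField.finrank_bot, one_mul,
      Module.finrank_pi]
    simp [r]

end Splitting

/-! ### The exponent divides the order of every split tensor power -/

section Exponent

variable {E : Type uE} [Field E] (T : Type uE) [Ring T] [Algebra E T]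

/-- A space on which `k` copies of `T` act as if it were a splitting of the tensor power. -/
def HasSplitPower (E : Type uE) [Field E] (T : Type uE) [Ring T] [Algebra E T] (k : ℕ) : Prop :=
  ∃ (M : Type uE) (_ : AddCommGroup M) (_ : Module E M) (α : Fin k → T →ₐ[E] Module.End E M),
    FiniteDimensional E M ∧ (Pairwise fun i j => ∀ x y, Commute (α i x) (α j y)) ∧
    Module.finrank E M ^ 2 = Module.finrank E T ^ k

variable {T}

theorem hasSplitPower_of_algEquiv {k m : ℕ}
    (e : (⨂[E] _ : Fin k, T) ≃ₐ[E] Matrix (Fin m) (Fin m) E) [FiniteDimensional E T] :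
    HasSplitPower E T k := by
  refine ⟨Fin m → E, inferInstance, inferInstance, fun i =>
    ((Matrix.toLinAlgEquiv' (R := E) (n := Fin m)).toAlgHom.comp e.toAlgHom).comp
      (PiTensorProduct.singleAlgHom (A := fun _ : Fin k => T) i), inferInstance,
    fun i j hij x y => (commute_singleAlgHom (S := fun _ : Fin k => T) hij x y).map
      ((Matrix.toLinAlgEquiv' (R := E) (n := Fin m)).toAlgHom.comp e.toAlgHom), ?_⟩
  have h := e.toLinearEquiv.finrank_eq
  rw [finrank_piTensorProduct, Module.finrank_matrix] at h
  simp only [Finset.prod_const, Finset.card_univ, Fintype.card_fin, Module.finrank_self,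
    mul_one] at h
  rw [Module.finrank_fin_fun, sq, h]

variable [IsSimpleRing T] [Algebra.IsCentral E T] [FiniteDimensional E T]

theorem HasSplitPower.exists_algEquiv {k : ℕ} (h : HasSplitPower E T k) :
    ∃ m : ℕ, 0 < m ∧ Nonempty ((⨂[E] _ : Fin k, T) ≃ₐ[E] Matrix (Fin m) (Fin m) E) := by
  obtain ⟨M, _, _, α, _, hα, hd⟩ := h
  have hpos : 0 < Module.finrank E M := by
    refine Nat.pos_of_ne_zero fun h0 => ?_
    rw [h0] at hd
    exact (pow_ne_zero k (Module.finrank_pos (R := E) (M := T)).ne') hd.symm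
  have : Nontrivial M := Module.nontrivial_of_finrank_pos hpos
  have hinj : Function.Injective (piLift (A := fun _ : Fin k => T) α hα) :=
    (piLift (A := fun _ : Fin k => T) α hα).toRingHom.injective
  have hbij : Function.Bijective (piLift (A := fun _ : Fin k => T) α hα) := by
    refine ⟨hinj, (LinearMap.injective_iff_surjective_of_finrank_eq_finrank
      (f := (piLift (A := fun _ : Fin k => T) α hα).toLinearMap) ?_).1 hinj⟩
    rw [finrank_piTensorProduct, Module.finrank_linearMap]
    simp [← sq, hd]
  exact ⟨_, hpos, ⟨(AlgEquiv.ofBijective _ hbij).trans (algEquivMatrix (Module.finBasis E M))⟩⟩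

/-- The last `b` copies of `T` generate a matrix algebra in `End M`; the other copies commute with
it and act on its corner, whose dimension is smaller by the factor `m`. -/
theorem HasSplitPower.sub {a b : ℕ} (h : HasSplitPower E T (a + b)) (hb : HasSplitPower E T b) :
    HasSplitPower E T a := by
  obtain ⟨m, hm, ⟨e⟩⟩ := hb.exists_algEquiv
  obtain ⟨M, _, _, α, _, hα, hd⟩ := h
  have hβ : Pairwise fun i j : Fin b => ∀ x y, Commute (α (Fin.natAdd a i) x)
      (α (Fin.natAdd a j) y) := fun i j hij => hα (by simpa using hij)
  let Ψ := piLift (A := fun _ : Fin b => T) (fun i => α (Fin.natAdd a i)) hβ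
  let Φ : Matrix (Fin m) (Fin m) E →ₐ[E] Module.End E M := Ψ.comp e.symm.toAlgHom
  let i₀ : Fin m := ⟨0, hm⟩
  have h1 := finrank_eq_mul_finrank_range i₀ Φ
  have hc : ∀ i x, Commute (Φ (Matrix.single i₀ i₀ 1)) (α (Fin.castAdd b i) x) := fun i x =>
    (piLift_commute (A := fun _ : Fin b => T) _ hβ _ (fun j y => hα (by
      intro h
      have := congrArg Fin.val h
      simp at this
      omega) x y) _).symm
  refine ⟨LinearMap.range (Φ (Matrix.single i₀ i₀ 1)), inferInstance, inferInstance, fun i =>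
    restrictRange _ (α (Fin.castAdd b i)) (hc i), inferInstance, ?_, ?_⟩
  · intro i j hij x y
    refine LinearMap.ext fun v => Subtype.ext ?_
    exact LinearMap.congr_fun (hα (i := Fin.castAdd b i) (j := Fin.castAdd b j) (by simpa using hij)
      x y) (v : M)
  · have h := e.toLinearEquiv.finrank_eq
    rw [finrank_piTensorProduct, Module.finrank_matrix] at h
    simp only [Finset.prod_const, Finset.card_univ, Fintype.card_fin, Module.finrank_self,
      mul_one] at h
    rw [h1, mul_pow, pow_add, h, sq m, mul_comm] at hd
    exact Nat.eq_of_mul_eq_mul_right (by positivity) hd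

/-- Split powers can be subtracted, so the remainder of `n` modulo the exponent would be a smaller
one. -/
theorem exponent_dvd_of_hasSplitPower {n : ℕ} (hn : 0 < n) (h : HasSplitPower E T n) :
    exponent E T ∣ n := by
  have hne : {n : ℕ | 0 < n ∧ ∃ m : ℕ, 0 < m ∧
      Nonempty ((⨂[E] _ : Fin n, T) ≃ₐ[E] Matrix (Fin m) (Fin m) E)}.Nonempty :=
    ⟨n, hn, h.exists_algEquiv⟩
  have hmem := Nat.sInf_mem hne
  obtain ⟨hpos, m, _, ⟨e⟩⟩ := hmem
  have hs := hasSplitPower_of_algEquiv e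
  change 0 < exponent E T at hpos
  change HasSplitPower E T (exponent E T) at hs
  by_contra hnd
  have hr : 0 < n % exponent E T := Nat.pos_of_ne_zero fun h0 => hnd (Nat.dvd_of_mod_eq_zero h0)
  have hind : ∀ q r, HasSplitPower E T (r + exponent E T * q) → HasSplitPower E T r := by
    intro q
    induction q with
    | zero => intro r h; simpa using h
    | succ q ih =>
      intro r h
      refine ih r (HasSplitPower.sub (b := exponent E T) ?_ hs)
      rwa [add_assoc, ← Nat.mul_succ]
  have h1 : HasSplitPower E T (n % exponent E T) := hind (n / exponent E T) _ (by
    rwa [Nat.mod_add_div])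
  have h2 : exponent E T ≤ n % exponent E T := Nat.sInf_le ⟨hr, h1.exists_algEquiv⟩
  exact absurd (Nat.mod_lt n hpos) (not_lt.2 h2)

end Exponent

/-! ### The bound when all degrees equal p -/

section DegreePrime

variable {p : ℕ} {E : Type uE} [Field E] {ι : Type} [Fintype ι] {S : ι → Type uE}
  [∀ j, DivisionRing (S j)] [∀ j, Algebra E (S j)] [∀ j, FiniteDimensional E (S j)]
  [∀ j, Algebra.IsCentral E (S j)]

/-- If the tensor product is `M_n(D)`, it acts on `D ^ n`. By `PDiv` its dimension `n ^ 2 * [D : E]`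
divides `n * [D : E]`, so `n = 1` and the tensor product is a division algebra. -/
theorem PDiv.schurIndex_eq (hp : p.Prime) (h : PDiv p E S)
    (hS : ∀ j, Module.finrank E (S j) = p ^ 2) :
    schurIndex E (⨂[E] j, S j) = p ^ Fintype.card ι := by
  classical
  have := Fact.mk hp
  have hT : Module.finrank E (⨂[E] j, S j) = (p ^ Fintype.card ι) ^ 2 := by
    rw [finrank_piTensorProduct]
    simp only [hS, Finset.prod_const, Finset.card_univ]
    rw [← pow_mul, ← pow_mul, mul_comm]
  have hv : ∑ j, padicValNat p (Module.finrank E (S j)) = Fintype.card ι * 2 := by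
    simp only [hS, padicValNat.prime_pow, Finset.sum_const, Finset.card_univ, smul_eq_mul]
  have key : ∀ (D : Type uE) [DivisionRing D] [Algebra E D] (n : ℕ), n ≠ 0 →
      Nonempty ((⨂[E] j, S j) ≃ₐ[E] Matrix (Fin n) (Fin n) D) →
      Module.finrank E D = (p ^ Fintype.card ι) ^ 2 := by
    rintro D _ _ n hn ⟨e⟩
    have h1 := e.toLinearEquiv.finrank_eq
    rw [Module.finrank_matrix, hT] at h1
    simp only [Fintype.card_fin] at h1
    have hp0 : 0 < (p ^ Fintype.card ι) ^ 2 := pow_pos (pow_pos hp.pos _) _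
    have hD : 0 < Module.finrank E D := Nat.pos_of_ne_zero fun h0 => by
      rw [h0, mul_zero] at h1
      omega
    have : FiniteDimensional E D := Module.finite_of_finrank_pos hD
    let r : Unit → ℕ := fun _ => n
    let Φ : (⨂[E] j, S j) →ₐ[E] Module.End E ((∀ k, Fin (r k)) → D) :=
      (matrixAction r () (Algebra.lmul E D)).comp e.toAlgHom
    have h2 := h ((∀ k, Fin (r k)) → D) (fun j => Φ.comp (PiTensorProduct.singleAlgHom j))
      (fun i j hij x y => (commute_singleAlgHom hij x y).map Φ)
    rw [hv, Module.finrank_pi_fintype] at h2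
    simp only [Finset.sum_const, Finset.card_univ, Fintype.card_pi, Finset.prod_const,
      Fintype.card_fin, Fintype.card_unit, pow_one, smul_eq_mul, r, pow_mul] at h2
    rw [h1, mul_assoc] at h2
    have h3 : n ∣ 1 := by
      refine Nat.dvd_of_mul_dvd_mul_right (k := n * Module.finrank E D)
        (Nat.mul_pos (Nat.pos_of_ne_zero hn) hD) ?_
      rwa [one_mul]
    obtain rfl : n = 1 := Nat.dvd_one.1 h3
    rw [h1]
    simp
  have hset : {d : ℕ | ∃ (D : Type uE) (_ : DivisionRing D) (_ : Algebra E D) (n : ℕ),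
      n ≠ 0 ∧ Nonempty ((⨂[E] j, S j) ≃ₐ[E] Matrix (Fin n) (Fin n) D) ∧
      Module.finrank E D = d ^ 2} = {p ^ Fintype.card ι} := by
    ext d
    constructor
    · rintro ⟨D, _, _, n, hn, he, hd⟩
      have := key D n hn he
      rw [hd] at this
      exact Nat.pow_left_injective (n := 2) (by norm_num) this
    · rintro rfl
      have : IsArtinianRing (⨂[E] j, S j) := isArtinianRing_of_finiteDimensional E _
      obtain ⟨n, hn, D, _, _, _, he⟩ :=
        IsSimpleRing.exists_algEquiv_matrix_divisionRing_finite E (⨂[E] j, S j)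
      exact ⟨D, inferInstance, inferInstance, n, hn.out, he, key D n hn.out he⟩
  rw [schurIndex, hset, csInf_singleton]

theorem hasSplitPower_piTensorProduct (hS : ∀ j, Module.finrank E (S j) = p ^ 2) :
    HasSplitPower E (⨂[E] j, S j) p := by
  classical
  obtain ⟨M, _, _, α, _, hα, hd⟩ := exists_splitting_space S hS
  have hβ : ∀ i : Fin p, Pairwise fun j j' => ∀ x y, Commute (α (j, i) x) (α (j', i) y) :=
    fun i j j' hj => hα (by simpa using hj)
  refine ⟨M, inferInstance, inferInstance, fun i => piLift (fun j => α (j, i)) (hβ i),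
    inferInstance, ?_, ?_⟩
  · intro i i' hi x y
    refine piLift_commute _ _ _ (fun j' y => ?_) _
    refine (piLift_commute _ _ _ (fun j x => ?_) _).symm
    exact hα (i := (j', i')) (j := (j, i)) (fun h => hi (congrArg Prod.snd h).symm) y x
  · rw [hd, finrank_piTensorProduct]
    simp only [hS, Finset.prod_const, Finset.card_univ, ← pow_mul]
    congr 1
    ring

/-- A finite infimum in `ℕ∞` is taken over a nonempty set, so it is attained. -/
theorem exists_le_of_brauerPDim_le {m : ℕ} (hm : brauerPDim p E ≤ m) :
    ∃ n ≤ m, ∀ (A : Type uE) [Ring A] [Algebra E A] [Algebra.IsCentral E A] [IsSimpleRing A]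
      [FiniteDimensional E A],
      (∃ r : ℕ, exponent E A = p ^ r) → schurIndex E A ∣ exponent E A ^ n := by
  have hne : {N : ℕ∞ | ∃ n : ℕ, N = n ∧
    ∀ (A : Type uE) [Ring A] [Algebra E A] [Algebra.IsCentral E A] [IsSimpleRing A]
      [FiniteDimensional E A],
      (∃ r : ℕ, exponent E A = p ^ r) → schurIndex E A ∣ exponent E A ^ n}.Nonempty := by
    by_contra h
    rw [Set.not_nonempty_iff_eq_empty] at h
    rw [brauerPDim, h, sInf_empty] at hm
    exact absurd hm (by simp)
  obtain ⟨n, hn, h⟩ := csInf_mem hne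
  refine ⟨n, ?_, h⟩
  change brauerPDim p E = n at hn
  rw [hn] at hm
  exact_mod_cast hm

/-- The tensor product has index `p ^ card ι` and exponent 1 or `p`. -/
theorem PDiv.card_le_of_finrank_eq (hp : p.Prime) (h : PDiv p E S)
    (hS : ∀ j, Module.finrank E (S j) = p ^ 2) {m : ℕ} (hm : brauerPDim p E ≤ m) :
    Fintype.card ι ≤ m := by
  obtain ⟨n, hn, hA⟩ := exists_le_of_brauerPDim_le hm
  have h1 := exponent_dvd_of_hasSplitPower hp.pos (hasSplitPower_piTensorProduct hS)
  obtain ⟨r, hr, he⟩ := (Nat.dvd_prime_pow hp (m := 1)).1 ((pow_one p).symm ▸ h1)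
  have h3 := hA (⨂[E] j, S j) ⟨r, he⟩
  rw [h.schurIndex_eq hp hS, he, ← pow_mul, Nat.pow_dvd_pow_iff_le_right hp.one_lt] at h3
  refine h3.trans (le_trans ?_ hn)
  calc r * n ≤ 1 * n := Nat.mul_le_mul_right _ hr
    _ = n := one_mul n

end DegreePrime

/-! ### Reduction to degree p -/

section Reduction

theorem nonempty_algEquiv_of_matrix_one {E A D : Type*} [Field E] [Ring A] [Algebra E A] [Ring D]
    [Algebra E D] {r : ℕ} (hr : r = 1) (e : A ≃ₐ[E] Matrix (Fin r) (Fin r) D) :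
    Nonempty (A ≃ₐ[E] D) := by
  subst hr
  refine ⟨e.trans ?_⟩
  convert Matrix.uniqueAlgEquiv (m := Fin 1) (R := E) (A := D)

theorem exists_injective_of_algEquiv {E E' K S D : Type*} [Field E] [Field E'] [Algebra E E']
    [Field K] [Algebra E K] [FiniteDimensional E K] [Ring S] [Algebra E S] [DivisionRing D]
    [Algebra E' D] (κ : K →ₐ[E] S) (e : E' ⊗[E] S ≃ₐ[E'] D) :
    IsSimpleRing (E' ⊗[E] K) ∧ ∃ μ : E' ⊗[E] K →ₐ[E'] D, Function.Injective μ := by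
  have h2 : Nontrivial S := by
    by_contra h
    rw [not_nontrivial_iff_subsingleton] at h
    have := e.symm.toEquiv.subsingleton
    exact not_subsingleton D this
  have h1 : Function.Injective (Algebra.TensorProduct.map (AlgHom.id E' E') κ) :=
    Module.Flat.lTensor_preserves_injective_linearMap (M := E') κ.toLinearMap
      (RingHom.injective (κ : K →+* S))
  let μ : E' ⊗[E] K →ₐ[E'] D := e.toAlgHom.comp (Algebra.TensorProduct.map (AlgHom.id E' E') κ)
  have hμ : Function.Injective μ := e.injective.comp h1
  have h3 : IsDomain (E' ⊗[E] K) := hμ.isDomain μ.toRingHom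
  have h4 : IsArtinianRing (E' ⊗[E] K) := isArtinianRing_of_finiteDimensional E' (E' ⊗[E] K)
  exact ⟨(isSimpleRing_iff_isField _).2 (IsArtinianRing.isField_of_isDomain _), μ, hμ⟩

/-- A nontrivial subextension of a Galois extension of `p`-power degree contains a subextension of
degree `p`. -/
theorem exists_degree_prime {p : ℕ} (hp : p.Prime) {E N : Type*} [Field E] [Field N] [Algebra E N]
    [FiniteDimensional E N] [IsGalois E N] (hG : IsPGroup p (N ≃ₐ[E] N))
    (P : IntermediateField E N) (hP : Module.finrank E P ≠ 1) :
    ∃ (a : ℕ) (E' : IntermediateField E N), 0 < a ∧ Module.finrank E P = p ^ a ∧ E' ≤ P ∧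
      Module.finrank E E' = p := by
  have := Fact.mk hp
  obtain ⟨s, hs⟩ := IsPGroup.iff_card.1 hG
  have h1 := P.fixingSubgroup.card_mul_index
  rw [← IntermediateField.finrank_eq_fixingSubgroup_index, hs] at h1
  obtain ⟨a, ha, haP⟩ := (Nat.dvd_prime_pow hp).1 (Dvd.intro_left _ h1)
  have ha0 : 0 < a := Nat.pos_of_ne_zero fun h0 => hP (by rw [haP, h0, pow_zero])
  have h2 : Nat.card P.fixingSubgroup = p ^ (s - a) := by
    rw [haP] at h1
    refine Nat.eq_of_mul_eq_mul_right (pow_pos hp.pos a) ?_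
    rw [h1, ← pow_add, Nat.sub_add_cancel ha]
  obtain ⟨K, hK, hPK⟩ := Sylow.exists_subgroup_card_pow_prime_le p (n := s - a) (m := s - 1)
    (by rw [hs]; exact pow_dvd_pow p (by omega)) P.fixingSubgroup h2 (by omega)
  refine ⟨a, IntermediateField.fixedField K, ha0, haP, ?_, ?_⟩
  · calc IntermediateField.fixedField K ≤ IntermediateField.fixedField P.fixingSubgroup :=
          IntermediateField.fixedField_antitone hPK
      _ = P := IsGalois.fixedField_fixingSubgroup P
  · rw [finrank_fixedField]
    have h3 := K.card_mul_index
    rw [hK, hs] at h3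
    refine Nat.eq_of_mul_eq_mul_left (pow_pos hp.pos (s - 1)) ?_
    rw [h3, ← pow_succ]
    congr 1
    omega

theorem sum_lt_sum_of_sq_mul {ι : Type*} [Fintype ι] {d d' r : ι → ℕ} (hd' : ∀ j, 0 < d' j)
    (hr : ∀ j, r j ≠ 0) (h : ∀ j, d j = r j ^ 2 * d' j) (i : ι) (hi : r i ≠ 1) :
    ∑ j, d' j < ∑ j, d j := by
  have h0 : ∀ j, 0 < r j := fun j => Nat.pos_of_ne_zero (hr j)
  refine Finset.sum_lt_sum (fun j _ => ?_) ⟨i, Finset.mem_univ i, ?_⟩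
  · rw [h]
    exact Nat.le_mul_of_pos_left _ (pow_pos (h0 j) 2)
  · rw [h]
    have h1 : 1 < r i ^ 2 := Nat.one_lt_pow two_ne_zero (by have := h0 i; omega)
    exact (Nat.lt_mul_iff_one_lt_left (hd' i)).2 h1

theorem dvd_of_dvd_sq_mul {p r d d' : ℕ} (hp : p.Prime) (hd : p ∣ d) (h : d = r ^ 2 * d')
    (hr0 : r ≠ 0) (hr : padicValNat p r = 0) : p ∣ d' := by
  rw [h] at hd
  rcases hp.dvd_mul.1 hd with h1 | h1
  · have h2 := hp.dvd_of_dvd_pow h1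
    rcases padicValNat.eq_zero_iff.1 hr with h | h | h
    · exact absurd h hp.one_lt.ne'
    · exact absurd h hr0
    · exact absurd h2 h
  · exact h1

variable {p : ℕ} {E : Type uE} [Field E] {ι : Type} [Fintype ι] {S : ι → Type uE}
  [∀ j, DivisionRing (S j)] [∀ j, Algebra E (S j)] [∀ j, FiniteDimensional E (S j)]
  [∀ j, Algebra.IsCentral E (S j)]

/-- The passage to an extension of degree `p` which embeds in one of the algebras. -/
theorem PDiv.exists_extension_degree_prime (hp : p.Prime) (h : PDiv p E S)
    (hd : ∀ j, p ∣ Module.finrank E (S j)) (E' : Type uE) [Field E'] [Algebra E E']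
    [FiniteDimensional E E'] (hE : Module.finrank E E' = p) (i : ι) (ν : E' →ₐ[E] S i) {a : ℕ}
    (ha : Module.finrank E (S i) = (p ^ a) ^ 2) (ha' : a ≠ 1) :
    ∃ (S' : ι → Type uE) (_ : ∀ j, DivisionRing (S' j)) (_ : ∀ j, Algebra E' (S' j)),
      (∀ j, FiniteDimensional E' (S' j)) ∧ (∀ j, Algebra.IsCentral E' (S' j)) ∧
      (∀ j, p ∣ Module.finrank E' (S' j)) ∧ PDiv p E' S' ∧
      ∑ j, Module.finrank E' (S' j) < ∑ j, Module.finrank E (S j) := by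
  classical
  have := Fact.mk hp
  obtain ⟨S', _, _, r, hfd, hc, hr, hdim, hle, hP⟩ := h.exists_extension hp E'
  -- If `E' ⊗ S i` remained a division algebra, `E' ⊗ E'` would be a field, and its multiplication
  -- map to `E'` would be injective, against the dimensions.
  have hi1 : r i ≠ 1 := by
    intro h1
    obtain ⟨e⟩ := (hr i).2
    obtain ⟨e'⟩ := nonempty_algEquiv_of_matrix_one h1 e
    obtain ⟨hs, -⟩ := exists_injective_of_algEquiv ν e'
    have hinj : Function.Injective (Algebra.TensorProduct.lmul' E (S := E')) :=
      (Algebra.TensorProduct.lmul' E (S := E')).toRingHom.injective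
    have h2 := LinearMap.finrank_le_finrank_of_injective
      (f := (Algebra.TensorProduct.lmul' E (S := E')).toLinearMap) hinj
    rw [Module.finrank_tensorProduct, hE] at h2
    have := hp.two_le
    nlinarith
  -- `r i` is a nontrivial power of `p`, and the exponents of `p` in all the `r j` add up to at most
  -- 1. So `r i = p`, the other `r j` are prime to `p`, and the equality that preserves `PDiv`
  -- holds.
  obtain ⟨b, hb, hrb⟩ := (Nat.dvd_prime_pow hp (i := r i) (m := a)).1 (by
    refine (Nat.pow_dvd_pow_iff two_ne_zero).1 ?_
    rw [← ha, hdim]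
    exact Dvd.intro _ rfl)
  have hb0 : b ≠ 0 := fun h0 => hi1 (by rw [hrb, h0, pow_zero])
  have hvi : padicValNat p (r i) = b := by rw [hrb, padicValNat.prime_pow]
  rw [hE, padicValNat_self] at hle hP
  have hsum := Finset.add_sum_erase Finset.univ (fun j => padicValNat p (r j)) (Finset.mem_univ i)
  have hb1 : b = 1 := by
    simp only [hvi] at hsum
    omega
  have hother : ∀ j, j ≠ i → padicValNat p (r j) = 0 := by
    intro j hj
    have h1 := Finset.single_le_sum (f := fun j => padicValNat p (r j))
      (fun _ _ => Nat.zero_le _) (Finset.mem_erase.2 ⟨hj, Finset.mem_univ j⟩)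
    simp only [hvi] at hsum h1
    omega
  refine ⟨S', inferInstance, inferInstance, hfd, hc, fun j => ?_, hP (by
    simp only [hvi] at hsum
    omega), sum_lt_sum_of_sq_mul (fun j => Module.finrank_pos) (fun j => (hr j).1) hdim i hi1⟩
  by_cases hj : j = i
  · subst hj
    have h1 := hdim j
    have ha2 : 2 ≤ a := by omega
    have h2 : (p ^ a) ^ 2 = (p ^ 1) ^ 2 * (p ^ (a - 1)) ^ 2 := by
      rw [← mul_pow, ← pow_add]
      congr 2
      omega
    rw [ha, hrb, hb1, h2] at h1
    rw [← Nat.eq_of_mul_eq_mul_left (by have := hp.pos; positivity) h1, ← pow_mul]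
    exact dvd_pow_self p (by omega)
  · exact dvd_of_dvd_sq_mul hp (hd j) (hdim j) (hr j).1 (hother j hj)

/-- The Brauer `p`-dimensions of the finite extensions of `E` are bounded by `m`. -/
def HasBound (p m : ℕ) (E : Type uE) [Field E] : Prop :=
  ∀ (E' : Type uE) [Field E'] [Algebra E E'] [FiniteDimensional E E'], brauerPDim p E' ≤ m

theorem HasBound.of_extension {m : ℕ} (h : HasBound p m E) (E' : Type uE) [Field E'] [Algebra E E']
    [FiniteDimensional E E'] : HasBound p m E' := by
  intro E'' _ _ _
  let _ : Algebra E E'' := ((algebraMap E' E'').comp (algebraMap E E')).toAlgebra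
  have : IsScalarTower E E' E'' := IsScalarTower.of_algebraMap_eq fun _ => rfl
  have : FiniteDimensional E E'' := FiniteDimensional.trans E E' E''
  exact h E''

/-- Induction on the sum of the dimensions, over varying fields. When some degree is not `p`, a
suitable finite extension keeps `PDiv` and the divisibility by `p` but lowers the sum. -/
theorem PDiv.card_le {p m : ℕ} (hp : p.Prime) (n : ℕ) : ∀ {E : Type uE} [Field E] {ι : Type}
    [Fintype ι] {S : ι → Type uE} [∀ j, DivisionRing (S j)] [∀ j, Algebra E (S j)]
    [∀ j, FiniteDimensional E (S j)] [∀ j, Algebra.IsCentral E (S j)],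
    HasBound p m E → (∀ j, p ∣ Module.finrank E (S j)) → PDiv p E S →
    ∑ j, Module.finrank E (S j) = n → Fintype.card ι ≤ m := by
  induction n using Nat.strong_induction_on with
  | _ n ih =>
  intro E _ ι _ S _ _ _ _ hm hd h hn
  have := Fact.mk hp
  by_cases hall : ∀ j, Module.finrank E (S j) = p ^ 2
  · exact h.card_le_of_finrank_eq hp hall (hm E)
  push Not at hall
  obtain ⟨i, hi⟩ := hall
  obtain ⟨K, _, _, _, _, ⟨κ⟩, hK⟩ := exists_separable_maximal_field E (S i)
  obtain ⟨N, _, _, _, _, hN⟩ := exists_isGalois_of_separable_family (F := E) fun _ : Unit => K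
  obtain ⟨j⟩ := hN ()
  -- The fixed field of a Sylow `p`-subgroup has degree prime to `p`, so the passage to it preserves
  -- `PDiv`; the sum drops unless all algebras stay division algebras.
  obtain ⟨Q, hQ, hQi⟩ := exists_prime_coprime_index_sylow (G := N ≃ₐ[E] N) hp
  have hv : padicValNat p (Module.finrank E (IntermediateField.fixedField Q)) = 0 := by
    rw [finrank_fixedField]
    exact padicValNat.eq_zero_of_not_dvd hQi
  obtain ⟨S', _, _, r, hfd, hc, hr, hdim, hle, hP⟩ :=
    h.exists_extension hp (IntermediateField.fixedField Q)
  rw [hv] at hle hP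
  have hP' := hP (Nat.zero_le _)
  have hr0 : ∀ j, padicValNat p (r j) = 0 := fun j =>
    Nat.le_zero.1 ((Finset.single_le_sum (f := fun j => padicValNat p (r j))
      (fun _ _ => Nat.zero_le _) (Finset.mem_univ j)).trans hle)
  have hm' := hm.of_extension (IntermediateField.fixedField Q)
  have hd' : ∀ j, p ∣ Module.finrank (IntermediateField.fixedField Q) (S' j) := fun j =>
    dvd_of_dvd_sq_mul hp (hd j) (hdim j) (hr j).1 (hr0 j)
  by_cases hr1 : ∀ j, r j = 1
  swap
  · push Not at hr1
    obtain ⟨l, hl⟩ := hr1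
    exact ih _ (hn ▸ sum_lt_sum_of_sq_mul (fun j => Module.finrank_pos) (fun j => (hr j).1) hdim
      l hl) hm' hd' hP' rfl
  have hdim' : ∀ j, Module.finrank E (S j) =
      Module.finrank (IntermediateField.fixedField Q) (S' j) := fun j => by
    rw [hdim, hr1, one_pow, one_mul]
  obtain ⟨e⟩ := (hr i).2
  obtain ⟨e'⟩ := nonempty_algEquiv_of_matrix_one (hr1 i) e
  obtain ⟨hs, μ, hμ⟩ := exists_injective_of_algEquiv κ e'
  -- The maximal subfield `K` of `S i`, extended to the fixed field, now lies in a Galois extension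
  -- with a `p`-group. So it has `p`-power degree and contains an extension of degree `p`, which
  -- embeds in the `i`-th algebra.
  let ψ : IntermediateField.fixedField Q ⊗[E] K →ₐ[IntermediateField.fixedField Q] N :=
    Algebra.TensorProduct.lift (Algebra.ofId _ N) j fun _ _ => Commute.all _ _
  have hψ : Function.Injective ψ := ψ.toRingHom.injective
  let P : IntermediateField (IntermediateField.fixedField Q) N :=
    { ψ.range with
      inv_mem' := fun x hx => inv_mem_of_finiteDimensional ψ.range hx }
  let eP : (IntermediateField.fixedField Q ⊗[E] K) ≃ₐ[IntermediateField.fixedField Q] P :=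
    AlgEquiv.ofInjective ψ hψ
  have hPdim : Module.finrank (IntermediateField.fixedField Q) P = Module.finrank E K := by
    rw [← eP.toLinearEquiv.finrank_eq, Module.finrank_baseChange]
  have hG : IsPGroup p (N ≃ₐ[IntermediateField.fixedField Q] N) := by
    obtain ⟨s, hs⟩ := IsPGroup.iff_card.1 hQ
    refine IsPGroup.of_card (n := s) ?_
    rw [IsGalois.card_aut_eq_finrank, IntermediateField.finrank_fixedField_eq_card, hs]
  obtain ⟨a, E', ha, haP, hE', hE'dim⟩ := exists_degree_prime hp hG P (by
    rw [hPdim]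
    intro h1
    have h2 := hd i
    rw [← hK, h1, one_pow, Nat.dvd_one] at h2
    exact hp.one_lt.ne' h2)
  have hKa : Module.finrank E K = p ^ a := hPdim ▸ haP
  obtain ⟨S'', _, _, hfd'', hc'', hd'', hP'', hlt⟩ := hP'.exists_extension_degree_prime hp hd' E'
    hE'dim i ((μ.comp eP.symm.toAlgHom).comp (IntermediateField.inclusion hE')) (a := a)
    (by rw [← hdim', ← hK, hKa]) (by
      rintro rfl
      exact hi (by rw [← hK, hKa, pow_one]))
  refine ih _ ?_ (hm'.of_extension E') hd'' hP'' rfl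
  refine hlt.trans_eq ?_
  rw [← hn]
  exact Finset.sum_congr rfl fun j _ => (hdim' j).symm

end Reduction

/-! ### Copies in the universe of the ground field -/

section Copies

/-- The Brauer `p`-dimensions concern algebras in the universe of `F`, while the subalgebras of `R`
live in that of `R`. -/
theorem small_of_finiteDimensional (F : Type u) (V : Type v) [Field F] [AddCommGroup V] [Module F V]
    [FiniteDimensional F V] : Small.{u} V :=
  ⟨_, ⟨(Module.finBasis F V).equivFun.toEquiv⟩⟩

theorem exists_divisionRing_copy {F : Type u} {R : Type v} [Field F] [DivisionRing R] [Algebra F R]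
    (S : Subalgebra F R) [FiniteDimensional F S] :
    ∃ (S' : Type u) (_ : DivisionRing S') (_ : Algebra F S'), Nonempty (S' ≃ₐ[F] S) := by
  have := small_of_finiteDimensional F S
  let _ : DivisionRing S := divisionRingSubalgebra S
  exact ⟨Shrink.{u} S, (equivShrink S).symm.divisionRing, (equivShrink S).symm.algebra F,
    ⟨(equivShrink S).symm.algEquiv F⟩⟩

theorem exists_field_copy {F : Type u} {R : Type v} [Field F] [DivisionRing R] [Algebra F R]
    (Z : Subalgebra F R) [FiniteDimensional F Z] (hZ : ∀ x ∈ Z, ∀ y ∈ Z, x * y = y * x) :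
    ∃ (E : Type u) (_ : Field E) (_ : Algebra F E), Nonempty (E ≃ₐ[F] Z) := by
  have := small_of_finiteDimensional F Z
  let _ : Field Z := fieldSubalgebra Z hZ
  exact ⟨Shrink.{u} Z, (equivShrink Z).symm.field, (equivShrink Z).symm.algebra F,
    ⟨(equivShrink Z).symm.algEquiv F⟩⟩

theorem finrank_dvd_of_isDomain {F D M : Type*} [Field F] [Ring D] [IsDomain D] [Algebra F D]
    [FiniteDimensional F D] [AddCommGroup M] [Module F M] (φ : D →ₐ[F] Module.End F M) :
    Module.finrank F D ∣ Module.finrank F M := by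
  let _ : DivisionRing D := divisionRingOfFiniteDimensional F D
  exact finrank_dvd_of_algHom φ

/-- The tensor product is simple, so it embeds in the domain `C` and is a division algebra; the
dimension of every space on which it acts is a multiple of its own. -/
theorem PDiv.of_commute {p : ℕ} (hp : p.Prime) {E : Type uE} [Field E] {ι : Type} [Fintype ι]
    {S : ι → Type uE} [∀ j, DivisionRing (S j)] [∀ j, Algebra E (S j)]
    [∀ j, FiniteDimensional E (S j)] [∀ j, Algebra.IsCentral E (S j)] {C : Type*} [Ring C]
    [IsDomain C] [Algebra E C] (ψ : ∀ j, S j →ₐ[E] C)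
    (hψ : Pairwise fun i j => ∀ x y, Commute (ψ i x) (ψ j y)) : PDiv p E S := by
  have := Fact.mk hp
  intro M _ _ _ α hα
  have hinj : Function.Injective (piLift ψ hψ) := (piLift ψ hψ).toRingHom.injective
  have : IsDomain (⨂[E] j, S j) := hinj.isDomain (piLift ψ hψ).toRingHom
  refine dvd_trans ?_ (finrank_dvd_of_isDomain (piLift α hα))
  rw [finrank_piTensorProduct, ← Finset.prod_pow_eq_pow_sum]
  exact Finset.prod_dvd_prod_of_dvd _ _ fun j _ => pow_padicValNat_dvd

end Copies

/-! ### Flags of commuting subalgebras have bounded length -/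

section Flags

variable {F : Type u} {R : Type v} [Field F] [DivisionRing R] [Algebra F R]

/-- A family of pairwise commuting subalgebras with the common center `Z`, whose dimensions over
`Z` are divisible by `p`. -/
structure IsFlag (p : ℕ) (Z : Subalgebra F R) {n : ℕ} (S : Fin n → Subalgebra F R) : Prop where
  finiteDimensional_center : FiniteDimensional F Z
  comm : ∀ x ∈ Z, ∀ y ∈ Z, x * y = y * x
  finiteDimensional : ∀ j, FiniteDimensional F (S j)
  cen_eq : ∀ j, cen (S j) = Z
  dvd : ∀ j, p * Module.finrank F Z ∣ Module.finrank F (S j)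
  commute : ∀ i j, i ≠ j → ∀ x ∈ S i, ∀ y ∈ S j, x * y = y * x

/-- All members of the flag lie in the centralizer of `Z`, which is a domain over the field `Z`; so
`PDiv.of_commute` and `PDiv.card_le` apply over a copy `E` of `Z`. -/
theorem IsFlag.le {p m : ℕ} (hp : p.Prime) (hm : HasBound p m F) {Z : Subalgebra F R} {n : ℕ}
    {S : Fin n → Subalgebra F R} (h : IsFlag p Z S) : n ≤ m := by
  have := h.finiteDimensional_center
  have := h.finiteDimensional
  obtain ⟨E, _, _, ⟨e⟩⟩ := exists_field_copy Z h.comm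
  choose S' _ _ e' using fun j => exists_divisionRing_copy (S j)
  replace e' := fun j => (e' j).some
  have hZS : ∀ j, Z ≤ S j := fun j => h.cen_eq j ▸ cen_le _
  have hZc : ∀ j, ∀ z ∈ Z, ∀ x ∈ S j, z * x = x * z := fun j z hz x hx => by
    rw [← h.cen_eq j] at hz
    exact ((mem_cen.1 hz).2 x hx).symm
  let i : ∀ j, E →ₐ[F] S' j := fun j =>
    (e' j).symm.toAlgHom.comp ((Subalgebra.inclusion (hZS j)).comp e.toAlgHom)
  have hi : ∀ j c, ((e' j (i j c) : S j) : R) = e c := fun j c => by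
    change (((e' j) ((e' j).symm (Subalgebra.inclusion (hZS j) (e c))) : S j) : R) = _
    rw [AlgEquiv.apply_symm_apply]
    rfl
  let _ : ∀ j, Algebra E (S' j) := fun j => (i j).toRingHom.toAlgebra' fun c x => by
    refine (e' j).injective (Subtype.ext ?_)
    rw [map_mul, map_mul]
    change ((e' j (i j c) : S j) : R) * _ = _ * ((e' j (i j c) : S j) : R)
    rw [hi]
    exact hZc j _ (e c).2 _ (e' j x).2
  have hmap : ∀ j c, algebraMap E (S' j) c = i j c := fun _ _ => rfl
  have : ∀ j, IsScalarTower F E (S' j) := fun j =>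
    IsScalarTower.of_algebraMap_eq fun c => ((i j).commutes c).symm
  have : FiniteDimensional F E := e.symm.toLinearEquiv.finiteDimensional
  have : ∀ j, FiniteDimensional F (S' j) := fun j => (e' j).symm.toLinearEquiv.finiteDimensional
  have : ∀ j, FiniteDimensional E (S' j) := fun j => Module.Finite.of_restrictScalars_finite F E _
  have : ∀ j, Algebra.IsCentral E (S' j) := fun j => ⟨fun x hx => by
    rw [Subalgebra.mem_center_iff] at hx
    have h1 : ((e' j x : S j) : R) ∈ cen (S j) := mem_cen.2 ⟨(e' j x).2, fun y hy => by
      have := congrArg (fun t => ((e' j t : S j) : R)) (hx ((e' j).symm ⟨y, hy⟩))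
      simpa using this⟩
    rw [h.cen_eq] at h1
    refine Algebra.mem_bot.2 ⟨e.symm ⟨_, h1⟩, ?_⟩
    refine (e' j).injective (Subtype.ext ?_)
    rw [hmap, hi, AlgEquiv.apply_symm_apply]⟩
  have hd : ∀ j, p ∣ Module.finrank E (S' j) := fun j => by
    have h1 := h.dvd j
    rw [← (e' j).toLinearEquiv.finrank_eq, ← Module.finrank_mul_finrank F E (S' j),
      e.toLinearEquiv.finrank_eq, mul_comm] at h1
    exact Nat.dvd_of_mul_dvd_mul_left Module.finrank_pos h1
  let C := Subalgebra.centralizer F (Z : Set R)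
  let iC : E →ₐ[F] C := (Subalgebra.inclusion (fun z hz =>
    (Subalgebra.mem_centralizer_iff F).2 fun z' hz' => h.comm z' hz' z hz : Z ≤ C)).comp e.toAlgHom
  let _ : Algebra E C := iC.toRingHom.toAlgebra' fun c x =>
    Subtype.ext ((Subalgebra.mem_centralizer_iff F).1 x.2 _ (e c).2)
  let ψ : ∀ j, S' j →ₐ[E] C := fun j =>
    { (Subalgebra.inclusion (fun x hx => (Subalgebra.mem_centralizer_iff F).2 fun z hz =>
        hZc j z hz x hx : S j ≤ C)).comp (e' j).toAlgHom with
      commutes' := fun c => Subtype.ext (hi j c) }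
  have hP : PDiv p E S' := PDiv.of_commute hp ψ fun i j hij x y =>
    Subtype.ext (h.commute i j hij _ (e' i x).2 _ (e' j y).2)
  have := PDiv.card_le hp _ (hm.of_extension E) hd hP rfl
  simpa using this

end Flags

/-! ### Bounded exponents of primes in the dimensions of subalgebras -/

section Bounds

variable {F : Type u} {R : Type v} [Field F] [DivisionRing R] [Algebra F R]

theorem IsLFD.finiteDimensional_sup (hR : IsLFD F R) (A B : Subalgebra F R)
    [hA : FiniteDimensional F A] [hB : FiniteDimensional F B] :
    FiniteDimensional F (A ⊔ B : Subalgebra F R) := by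
  have h : ∀ S : Subalgebra F R, FiniteDimensional F S → S.FG := fun S _ =>
    Subalgebra.fg_of_fg_toSubmodule (Module.Finite.iff_fg.1 (inferInstance :
      Module.Finite F (Subalgebra.toSubmodule S)))
  obtain ⟨t, ht⟩ := (h A hA).sup (h B hB)
  rw [← ht]
  exact hR t

theorem IsLFD.exists_le (hR : IsLFD F R) (A : Subalgebra F R) [FiniteDimensional F A]
    (Y : Finset R) : ∃ B : Subalgebra F R, FiniteDimensional F B ∧ A ≤ B ∧ (Y : Set R) ⊆ B := by
  have := hR Y
  exact ⟨A ⊔ Algebra.adjoin F Y, hR.finiteDimensional_sup _ _, le_sup_left,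
    Algebra.subset_adjoin.trans (le_sup_right : Algebra.adjoin F (Y : Set R) ≤ A ⊔ _)⟩

theorem commute_sup {A B C : Subalgebra F R} (hA : ∀ x ∈ C, ∀ y ∈ A, x * y = y * x)
    (hB : ∀ x ∈ C, ∀ y ∈ B, x * y = y * x) : ∀ x ∈ C, ∀ y ∈ A ⊔ B, x * y = y * x := by
  have h : A ⊔ B ≤ Subalgebra.centralizer F (C : Set R) :=
    sup_le (fun y hy => (Subalgebra.mem_centralizer_iff F).2 fun x hx => hA x hx y hy)
      (fun y hy => (Subalgebra.mem_centralizer_iff F).2 fun x hx => hB x hx y hy)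
  exact fun x hx y hy => (Subalgebra.mem_centralizer_iff F).1 (h hy) x hx

theorem finrank_sup_le {A B : Subalgebra F R} [FiniteDimensional F A] [FiniteDimensional F B]
    (hAB : ∀ a ∈ A, ∀ b ∈ B, a * b = b * a) :
    FiniteDimensional F (A ⊔ B : Subalgebra F R) ∧
      Module.finrank F (A ⊔ B : Subalgebra F R) ≤ Module.finrank F A * Module.finrank F B := by
  let b := Module.finBasis F B
  let T : (Fin (Module.finrank F B) → A) →ₗ[F] R :=
    { toFun := fun a => ∑ i, (a i : R) * (b i : R)
      map_add' := fun a a' => by simp [add_mul, Finset.sum_add_distrib]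
      map_smul' := fun c a => by simp [Finset.smul_sum] }
  have hT : LinearMap.range T = Subalgebra.toSubmodule (A ⊔ B) := by
    ext x
    rw [Subalgebra.mem_toSubmodule, mem_sup_iff_exists_sum hAB (fun i => (b i : R))
      (fun i => (b i).2) (fun x hx => ⟨fun i => algebraMap F R (b.repr ⟨x, hx⟩ i),
        fun i => A.algebraMap_mem _, by
          have := congrArg Subtype.val (b.sum_repr ⟨x, hx⟩)
          simpa [Algebra.smul_def] using this.symm⟩)]
    constructor
    · rintro ⟨a, rfl⟩
      exact ⟨fun i => (a i), fun i => (a i).2, rfl⟩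
    · rintro ⟨a, ha, rfl⟩
      exact ⟨fun i => ⟨a i, ha i⟩, rfl⟩
  have h1 : FiniteDimensional F (Subalgebra.toSubmodule (A ⊔ B)) := hT ▸ inferInstance
  refine ⟨h1, ?_⟩
  have h2 := LinearMap.finrank_range_le T
  rw [hT, Module.finrank_pi_fintype] at h2
  simpa [mul_comm] using h2

/-- The algebra generated by a flag and a commutative algebra which contains its center. -/
theorem IsFlag.finset_sup {p : ℕ} {Z : Subalgebra F R} {n : ℕ} {S : Fin n → Subalgebra F R}
    (h : IsFlag p Z S) {W : Subalgebra F R} [FiniteDimensional F W] (hZW : Z ≤ W)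
    (hWS : ∀ j, ∀ x ∈ S j, ∀ y ∈ W, x * y = y * x) (s : Finset (Fin n)) :
    FiniteDimensional F (s.sup S ⊔ W : Subalgebra F R) ∧ cen (s.sup S ⊔ W) = cen W ∧
      Module.finrank F (s.sup S ⊔ W : Subalgebra F R) * Module.finrank F Z ^ s.card =
        Module.finrank F W * ∏ j ∈ s, Module.finrank F (S j) := by
  have := h.finiteDimensional
  induction s using Finset.induction_on with
  | empty => 
    rw [Finset.sup_empty, bot_sup_eq]
    simp [*]
  | insert a s ha ih =>
    obtain ⟨h1, h2, h3⟩ := ih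
    have hle : cen (S a) ≤ s.sup S ⊔ W := (h.cen_eq a).trans_le (hZW.trans le_sup_right)
    have hcomm : ∀ x ∈ S a, ∀ y ∈ s.sup S ⊔ W, x * y = y * x := by
      refine commute_sup (fun x hx y hy => ?_) (hWS a)
      have : s.sup S ≤ Subalgebra.centralizer F (S a : Set R) := Finset.sup_le fun j hj y hy =>
        (Subalgebra.mem_centralizer_iff F).2 fun x hx =>
          h.commute a j (fun h => ha (h ▸ hj)) x hx y hy
      exact (Subalgebra.mem_centralizer_iff F).1 (this hy) x hx
    rw [Finset.sup_insert, sup_assoc]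
    obtain ⟨h4, h5⟩ := finrank_sup_mul_finrank_cen hcomm hle
    refine ⟨h4, by rw [cen_sup_eq hcomm hle, h2], ?_⟩
    rw [Finset.card_insert_of_notMem ha, Finset.prod_insert ha, pow_succ', ← mul_assoc]
    rw [h.cen_eq] at h5
    rw [h5, mul_assoc, h3]
    ring

theorem cen_eq_self {W : Subalgebra F R} (hW : ∀ x ∈ W, ∀ y ∈ W, x * y = y * x) : cen W = W :=
  le_antisymm (cen_le W) fun x hx => mem_cen.2 ⟨hx, fun y hy => hW y hy x hx⟩

/-- Extension of scalars from `Z` to `W`: the dimensions over the center do not change. -/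
theorem IsFlag.sup {p : ℕ} {Z : Subalgebra F R} {n : ℕ} {S : Fin n → Subalgebra F R}
    (h : IsFlag p Z S) {W : Subalgebra F R} [FiniteDimensional F W]
    (hW : ∀ x ∈ W, ∀ y ∈ W, x * y = y * x) (hZW : Z ≤ W)
    (hWS : ∀ j, ∀ x ∈ S j, ∀ y ∈ W, x * y = y * x) : IsFlag p W fun j => S j ⊔ W where
  finiteDimensional_center := inferInstance
  comm := hW
  finiteDimensional j := by
    have := h.finiteDimensional j
    exact (finrank_sup_mul_finrank_cen (hWS j) ((h.cen_eq j).trans_le hZW)).1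
  cen_eq j := by
    have := h.finiteDimensional j
    rw [cen_sup_eq (hWS j) ((h.cen_eq j).trans_le hZW), cen_eq_self hW]
  dvd j := by
    have := h.finiteDimensional j
    have := h.finiteDimensional_center
    have h1 := (finrank_sup_mul_finrank_cen (hWS j) ((h.cen_eq j).trans_le hZW)).2
    obtain ⟨c, hc⟩ := h.dvd j
    refine ⟨c, Nat.eq_of_mul_eq_mul_right (Module.finrank_pos (R := F) (M := Z)) ?_⟩
    rw [h.cen_eq, hc] at h1
    rw [h1]
    ring
  commute i j hij := by
    refine commute_sup (fun x hx y hy => ?_) (fun x hx y hy => ?_)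
    · exact (commute_sup (C := S j) (fun y hy x hx => h.commute j i hij.symm y hy x hx)
        (hWS j) y hy x hx).symm
    · exact (commute_sup (C := W) (fun y hy x hx => (hWS i x hx y hy).symm) hW y hy x hx).symm

theorem IsFlag.cons {p : ℕ} {Z : Subalgebra F R} {n : ℕ} {S : Fin n → Subalgebra F R}
    (h : IsFlag p Z S) {S₀ : Subalgebra F R} [FiniteDimensional F S₀] (h₀ : cen S₀ = Z)
    (hd : p * Module.finrank F Z ∣ Module.finrank F S₀)
    (hc : ∀ j, ∀ x ∈ S₀, ∀ y ∈ S j, x * y = y * x) :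
    IsFlag p Z (Fin.cons S₀ S : Fin (n + 1) → Subalgebra F R) where
  finiteDimensional_center := h.finiteDimensional_center
  comm := h.comm
  finiteDimensional j := by
    refine Fin.cases ?_ (fun j => ?_) j
    · simpa
    · exact h.finiteDimensional j
  cen_eq j := by
    refine Fin.cases ?_ (fun j => ?_) j
    · simpa
    · simpa using h.cen_eq j
  dvd j := by
    refine Fin.cases ?_ (fun j => ?_) j
    · simpa
    · exact h.dvd j
  commute i j := by
    refine Fin.cases ?_ (fun i => ?_) i <;> refine Fin.cases ?_ (fun j => ?_) j
    · simp
    · intro _; simpa using hc j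
    · intro _ x hx y hy
      rw [Fin.cons_succ] at hx
      rw [Fin.cons_zero] at hy
      exact (hc i y hy x hx).symm
    · intro hij
      simpa using h.commute i j fun h => hij (h ▸ rfl)

theorem exists_isFlag_forall_le {p m : ℕ} (hp : p.Prime) (hm : HasBound p m F) :
    ∃ (n : ℕ) (Z : Subalgebra F R) (S : Fin n → Subalgebra F R), IsFlag p Z S ∧
      ∀ (n' : ℕ) (Z' : Subalgebra F R) (S' : Fin n' → Subalgebra F R), IsFlag p Z' S' → n' ≤ n := by
  let X : Set ℕ := {n | ∃ (Z : Subalgebra F R) (S : Fin n → Subalgebra F R), IsFlag p Z S}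
  have hne : X.Nonempty := ⟨0, ⊥, Fin.elim0,
    { finiteDimensional_center := inferInstance
      comm := by
        rintro _ ⟨x, rfl⟩ y _
        exact Algebra.commutes x y
      finiteDimensional := fun j => j.elim0
      cen_eq := fun j => j.elim0
      dvd := fun j => j.elim0
      commute := fun j => j.elim0 }⟩
  have hb : BddAbove X := ⟨m, fun n ⟨_, _, h⟩ => h.le hp hm⟩
  obtain ⟨Z, S, h⟩ := Nat.sSup_mem hne hb
  exact ⟨_, Z, S, h, fun n' Z' S' h' => le_csSup hb ⟨Z', S', h'⟩⟩

/-- Take a flag of maximal length and a subalgebra `S₁` containing it. With scalars extended to `W =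
Z · cen S₁`, the centralizer of the flag in `S₁` has center `W`, and its dimension over `W` is prime
to `p`, since otherwise it would lengthen the flag. The centralizer theorem then bounds the exponent
of `S₁`. -/
theorem exists_padicValNat_le_add {p m : ℕ} (hp : p.Prime) (hm : HasBound p m F) :
    ∃ (T : Subalgebra F R) (c : ℕ), FiniteDimensional F T ∧ ∀ S : Subalgebra F R,
      FiniteDimensional F S → T ≤ S →
      padicValNat p (Module.finrank F S) ≤ padicValNat p (Module.finrank F (cen S)) + c := by
  have := Fact.mk hp
  obtain ⟨n, Z, S, h, hmax⟩ := exists_isFlag_forall_le (R := R) hp hm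
  have := h.finiteDimensional_center
  have := h.finiteDimensional
  have hZS : ∀ j, ∀ x ∈ S j, ∀ y ∈ Z, x * y = y * x := fun j x hx y hy =>
    (mem_cen.1 ((h.cen_eq j).symm ▸ hy)).2 x hx
  have hprod : ∏ j, Module.finrank F (S j) ≠ 0 :=
    Finset.prod_ne_zero_iff.2 fun j _ => Module.finrank_pos.ne'
  -- The dimension of `W` enters twice, through the flag algebra and through its centralizer, and
  -- `[W : cen S₁]` is at most `[Z : F]`.
  refine ⟨Finset.univ.sup S ⊔ Z, 2 * Module.finrank F Z +
    padicValNat p (∏ j, Module.finrank F (S j)), (h.finset_sup le_rfl hZS _).1, fun S₁ _ hS₁ => ?_⟩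
  have hSS₁ : ∀ j, S j ≤ S₁ := fun j =>
    (Finset.le_sup (Finset.mem_univ j)).trans (le_sup_left.trans hS₁)
  have hZS₁ : Z ≤ S₁ := le_sup_right.trans hS₁
  have hcen : ∀ x ∈ S₁, ∀ y ∈ cen S₁, x * y = y * x := fun x hx y hy => (mem_cen.1 hy).2 x hx
  obtain ⟨hWf, hWle⟩ := finrank_sup_le (A := Z) (B := cen S₁) fun x hx y hy => hcen x (hZS₁ hx) y hy
  set W := Z ⊔ cen S₁ with hW
  have hWcomm : ∀ x ∈ W, ∀ y ∈ W, x * y = y * x := by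
    refine commute_sup (fun x hx y hy => (?_ : y * x = x * y).symm) (fun x hx y hy => ?_)
    · exact commute_sup (C := Z) h.comm (fun x hx y hy => hcen x (hZS₁ hx) y hy) y hy x hx
    · exact hcen x ((sup_le hZS₁ (cen_le _) : W ≤ S₁) hx) y hy
  have hWS : ∀ j, ∀ x ∈ S j, ∀ y ∈ W, x * y = y * x := fun j =>
    commute_sup (hZS j) fun x hx y hy => hcen x (hSS₁ j hx) y hy
  have hflag := h.sup hWcomm le_sup_left hWS
  obtain ⟨hTf, hTc, hTd⟩ := h.finset_sup (W := W) le_sup_left hWS Finset.univ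
  set T := Finset.univ.sup S ⊔ W with hT
  have hTS₁ : T ≤ S₁ := sup_le (Finset.sup_le fun j _ => hSS₁ j) (sup_le hZS₁ (cen_le _))
  have hcT : cen S₁ ≤ T := le_sup_right.trans le_sup_right
  have hD := finrank_mul_finrank_inf_centralizer hTS₁ hcT
  have hcS' := cen_inf_centralizer hTS₁ hcT
  rw [hTc, cen_eq_self hWcomm] at hcS'
  set S' := S₁ ⊓ Subalgebra.centralizer F (T : Set R) with hS'
  have hWS' : W ≤ S' := hcS' ▸ cen_le S'
  obtain ⟨q, hq⟩ := finrank_dvd_of_le hWS'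
  have hpq : ¬ p ∣ q := by
    rintro ⟨q', rfl⟩
    have h1 := hmax _ _ _ (hflag.cons hcS' ⟨q', by rw [hq]; ring⟩ fun j x hx y hy =>
      ((Subalgebra.mem_centralizer_iff F).1 hx.2 y
        ((sup_le ((Finset.le_sup (Finset.mem_univ j)).trans le_sup_left) le_sup_right :
          S j ⊔ W ≤ T) hy)).symm)
    omega
  have hq0 : q ≠ 0 := fun h0 => hpq (h0 ▸ dvd_zero p)
  have hvq : padicValNat p q = 0 := padicValNat.eq_zero_of_not_dvd hpq
  have hpos : ∀ A : Subalgebra F R, FiniteDimensional F A → Module.finrank F A ≠ 0 := fun A _ =>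
    Module.finrank_pos.ne'
  have e1 := congrArg (padicValNat p) hD
  rw [padicValNat.mul (hpos T hTf) (hpos S' inferInstance),
    padicValNat.mul (hpos S₁ inferInstance) (hpos _ inferInstance), hq,
    padicValNat.mul (hpos W hWf) hq0, hvq] at e1
  have e2 := congrArg (padicValNat p) hTd
  rw [padicValNat.mul (hpos T hTf) (pow_ne_zero _ (hpos Z inferInstance)),
    padicValNat.mul (hpos W hWf) hprod] at e2
  obtain ⟨q', hq'⟩ := finrank_dvd_of_le (A := cen S₁) (B := W) le_sup_right
  have hq'le : q' ≤ Module.finrank F Z := by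
    rw [hq', mul_comm] at hWle
    exact Nat.le_of_mul_le_mul_right hWle Module.finrank_pos
  have hq'0 : q' ≠ 0 := fun h0 => hpos W hWf (by rw [hq', h0, mul_zero])
  have hvq' : padicValNat p q' ≤ q' := (padicValNat_le_nat_log q').trans (Nat.log_le_self p q')
  have e3 := congrArg (padicValNat p) hq'
  rw [padicValNat.mul (hpos _ inferInstance) hq'0] at e3
  omega

variable [Algebra.IsCentral F R]

/-- In a large `T₁` the center and `S` are linearly disjoint, so `v_p(cen T₁) + v_p(S) ≤ v_p(T₁) ≤
v_p(cen T₁) + c`. -/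
theorem exists_padicValNat_finrank_le (hR : IsLFD F R) {p m : ℕ} (hp : p.Prime)
    (hm : HasBound p m F) : ∃ c : ℕ, ∀ S : Subalgebra F R, FiniteDimensional F S →
      padicValNat p (Module.finrank F S) ≤ c := by
  have := Fact.mk hp
  obtain ⟨T, c, _, hT⟩ := exists_padicValNat_le_add (R := R) hp hm
  refine ⟨c, fun S _ => ?_⟩
  obtain ⟨Y, hY⟩ := exists_finset_finrank_sup_cen S
  have := hR.finiteDimensional_sup S T
  obtain ⟨T₁, _, h1, h2⟩ := hR.exists_le (S ⊔ T) Y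
  obtain ⟨h3, h4⟩ := hY T₁ inferInstance (le_sup_left.trans h1) h2
  have h5 := finrank_dvd_of_le (sup_le (cen_le T₁) (le_sup_left.trans h1) : cen T₁ ⊔ S ≤ T₁)
  rw [h4] at h5
  have h6 := (padicValNat_dvd_iff_le (p := p) Module.finrank_pos.ne').1 (pow_padicValNat_dvd.trans h5)
  rw [padicValNat.mul Module.finrank_pos.ne' Module.finrank_pos.ne'] at h6
  have := hT T₁ inferInstance (le_sup_right.trans h1)
  omega

/-- The maximal exponent of `p` in the dimensions of the finite-dimensional subalgebras is even, and
attained by all sufficiently large subalgebras, whose centers have dimension prime to `p`. -/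
theorem exists_max_padicValNat (hR : IsLFD F R) {p m : ℕ} (hp : p.Prime) (hm : HasBound p m F) :
    ∃ (k : ℕ) (T : Subalgebra F R), FiniteDimensional F T ∧
      (∀ S : Subalgebra F R, FiniteDimensional F S →
        padicValNat p (Module.finrank F S) ≤ 2 * k) ∧
      ∀ S : Subalgebra F R, FiniteDimensional F S → T ≤ S →
        padicValNat p (Module.finrank F S) = 2 * k ∧ ¬ p ∣ Module.finrank F (cen S) := by
  have := Fact.mk hp
  obtain ⟨c, hc⟩ := exists_padicValNat_finrank_le hR hp hm
  let X : Set ℕ := {n | ∃ S : Subalgebra F R, FiniteDimensional F S ∧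
    padicValNat p (Module.finrank F S) = n}
  have hb : BddAbove X := ⟨c, by rintro _ ⟨S, hS, rfl⟩; exact hc S hS⟩
  have hne : X.Nonempty := ⟨_, ⊥, inferInstance, rfl⟩
  obtain ⟨S₀, hf₀, hS₀⟩ := Nat.sSup_mem hne hb
  have hle : ∀ S : Subalgebra F R, FiniteDimensional F S →
      padicValNat p (Module.finrank F S) ≤ sSup X := fun S hS => le_csSup hb ⟨S, hS, rfl⟩
  obtain ⟨Y, hY⟩ := exists_finset_finrank_sup_cen S₀
  obtain ⟨T, hTf, h1, h2⟩ := hR.exists_le S₀ Y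
  -- `S₀` attains the maximum and is linearly disjoint from the center of `S`, so that center
  -- contributes no factor `p`.
  have hT : ∀ S : Subalgebra F R, FiniteDimensional F S → T ≤ S →
      padicValNat p (Module.finrank F S) = sSup X ∧
        padicValNat p (Module.finrank F (cen S)) = 0 := fun S hS hTS => by
    obtain ⟨h3, h4⟩ := hY S inferInstance (h1.trans hTS) (h2.trans hTS)
    have h5 := finrank_dvd_of_le (sup_le (cen_le S) (h1.trans hTS) : cen S ⊔ S₀ ≤ S)
    rw [h4] at h5
    have h6 := (padicValNat_dvd_iff_le (p := p) Module.finrank_pos.ne').1 (pow_padicValNat_dvd.trans h5)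
    rw [padicValNat.mul Module.finrank_pos.ne' Module.finrank_pos.ne'] at h6
    have := hle S hS
    omega
  -- The dimension of `T` over its center is a square, and the degree of the center is prime to `p`.
  obtain ⟨k, hk⟩ : ∃ k, sSup X = 2 * k := by
    let _ : DivisionRing T := divisionRingSubalgebra T
    obtain ⟨θ, -, hθ⟩ := exists_separable_maximal_subfield (Subalgebra.center F T) T
    have h3 := finrank_sq_of_centralizer_eq hθ
    have h4 := Module.finrank_mul_finrank F (Subalgebra.center F T) T
    have h5 := hT T hTf le_rfl
    rw [← finrank_comap_val (cen_le T), comap_cen] at h5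
    rw [← h3] at h4
    have hne := Module.finrank_pos (R := F) (M := T) |>.ne'
    have h6 := congrArg (padicValNat p) h4
    rw [← h4] at hne
    rw [padicValNat.mul (left_ne_zero_of_mul hne) (right_ne_zero_of_mul hne), h5.1, h5.2, zero_add,
      padicValNat.pow] at h6
    exact ⟨_, h6.symm⟩
  refine ⟨k, T, hTf, fun S hS => hk ▸ hle S hS, fun S hS hTS => ⟨hk ▸ (hT S hS hTS).1, fun hd => ?_⟩⟩
  have h7 := (hT S hS hTS).2
  rcases padicValNat.eq_zero_iff.1 h7 with h | h | h
  · exact hp.one_lt.ne' h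
  · exact Module.finrank_pos.ne' h
  · exact h hd

end Bounds

/-! ### Existence of the p-components -/

section Components

/-- The inseparable degree is a power of the characteristic exponent. -/
theorem isSeparable_of_not_dvd_finrank {F E : Type*} [Field F] [Field E] [Algebra F E]
    [FiniteDimensional F E] {q : ℕ} [ExpChar F q] (h : q = 1 ∨ ¬ q ∣ Module.finrank F E) :
    Algebra.IsSeparable F E := by
  rw [← Field.finSepDegree_eq_finrank_iff, ← Field.finSepDegree_mul_finInsepDegree F E]
  obtain ⟨n, hn⟩ := finInsepDegree_eq_pow F E q
  suffices h1 : Field.finInsepDegree F E = 1 by rw [h1, mul_one]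
  rcases h with rfl | h
  · rw [hn, one_pow]
  · rw [hn]
    cases n with
    | zero => rfl
    | succ n =>
      refine absurd ?_ h
      rw [← Field.finSepDegree_mul_finInsepDegree F E, hn, pow_succ]
      exact Dvd.intro_left _ (by rw [mul_assoc])

theorem injective_lift_of_finrank_le {F A B X : Type*} [Field F] [Ring A] [Ring B] [Ring X]
    [Algebra F A] [Algebra F B] [Algebra F X] [FiniteDimensional F A] [FiniteDimensional F B]
    [FiniteDimensional F X] (f : A →ₐ[F] X) (g : B →ₐ[F] X) (h : ∀ a b, Commute (f a) (g b))
    (U : Submodule F X) (hU : ∀ x ∈ U, ∃ t, Algebra.TensorProduct.lift f g h t = x)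
    (hd : Module.finrank F B * Module.finrank F A ≤ Module.finrank F U) :
    Function.Injective (Algebra.TensorProduct.lift f g h) := by
  have h1 : U ≤ LinearMap.range (Algebra.TensorProduct.lift f g h).toLinearMap := hU
  have h2 := Submodule.finrank_mono h1
  have h3 := LinearMap.finrank_range_add_finrank_ker (Algebra.TensorProduct.lift f g h).toLinearMap
  rw [Module.finrank_tensorProduct, mul_comm] at h3
  have h4 : Module.finrank F (LinearMap.ker (Algebra.TensorProduct.lift f g h).toLinearMap) = 0 := by
    omega
  exact LinearMap.ker_eq_bot.1 (Submodule.finrank_eq_zero.1 h4)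

theorem exists_degree {F D : Type*} [Field F] [DivisionRing D] [Algebra F D]
    [FiniteDimensional F D] {p k : ℕ} (hp : p.Prime)
    (hv : padicValNat p (Module.finrank F D) = 2 * k)
    (hc : ¬ p ∣ Module.finrank F (Subalgebra.center F D)) :
    ∃ m, ¬ p ∣ m ∧ Module.finrank (Subalgebra.center F D) D = (p ^ k * m) ^ 2 := by
  have := Fact.mk hp
  obtain ⟨θ, -, hθ⟩ := exists_separable_maximal_subfield (Subalgebra.center F D) D
  have h3 := finrank_sq_of_centralizer_eq hθ
  have h4 := Module.finrank_mul_finrank F (Subalgebra.center F D) D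
  rw [← h3] at h4 ⊢
  obtain ⟨e, m, hm, hd⟩ := Nat.exists_eq_pow_mul_and_not_dvd
    (Module.finrank_pos (R := Subalgebra.center F D)
      (M := Algebra.adjoin (Subalgebra.center F D) {θ})).ne' p hp.one_lt.ne'
  refine ⟨m, hm, ?_⟩
  have hm0 : m ≠ 0 := fun h => hm (h ▸ dvd_zero p)
  have h6 := congrArg (padicValNat p) h4
  rw [hd, padicValNat.mul Module.finrank_pos.ne' (pow_ne_zero _ (mul_ne_zero
    (pow_ne_zero _ hp.ne_zero) hm0)), padicValNat.pow, padicValNat.mul (pow_ne_zero _ hp.ne_zero) hm0,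
    padicValNat.prime_pow, hv, padicValNat.eq_zero_of_not_dvd hm,
    padicValNat.eq_zero_of_not_dvd hc] at h6
  rw [hd]
  congr 3
  omega

variable {F : Type u} {R : Type v} [Field F] [DivisionRing R] [Algebra F R]

theorem isCentral_iff_cen_eq_bot {A : Subalgebra F R} : Algebra.IsCentral F A ↔ cen A = ⊥ := by
  constructor
  · intro h
    refine le_antisymm (fun x hx => ?_) bot_le
    have h1 : (⟨x, (mem_cen.1 hx).1⟩ : A) ∈ Subalgebra.center F A :=
      Subalgebra.mem_center_iff.2 fun y => Subtype.ext ((mem_cen.1 hx).2 y y.2)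
    rw [Algebra.IsCentral.center_eq_bot] at h1
    obtain ⟨c, hc⟩ := Algebra.mem_bot.1 h1
    exact Algebra.mem_bot.2 ⟨c, congrArg Subtype.val hc⟩
  · refine fun h => ⟨fun x hx => ?_⟩
    have h1 : (x : R) ∈ cen A := mem_cen.2 ⟨x.2, fun y hy =>
      congrArg Subtype.val (Subalgebra.mem_center_iff.1 hx ⟨y, hy⟩)⟩
    rw [h] at h1
    obtain ⟨c, hc⟩ := Algebra.mem_bot.1 h1
    exact Algebra.mem_bot.2 ⟨c, Subtype.ext hc⟩

variable [Algebra.IsCentral F R]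

/-- In positive characteristic, apply the maximality result to the characteristic itself: large
subalgebras have centers of degree prime to it, hence separable. -/
theorem exists_isSeparable_center (hR : IsLFD F R) (hF : IsBrauerFiniteDimensional F) :
    ∃ T : Subalgebra F R, FiniteDimensional F T ∧ ∃ q : ℕ, ExpChar F q ∧
      ∀ S : Subalgebra F R, FiniteDimensional F S → T ≤ S →
        q = 1 ∨ ¬ q ∣ Module.finrank F (cen S) := by
  obtain ⟨m, hm⟩ := hF
  obtain ⟨q, hq⟩ := ExpChar.exists F
  cases hq with
  | zero => exact ⟨⊥, inferInstance, 1, ExpChar.zero, fun S _ _ => Or.inl rfl⟩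
  | prime hq =>
    obtain ⟨k, T, hT, -, h⟩ := exists_max_padicValNat hR hq
      (m := m ⟨q, hq⟩) (fun E' _ _ _ => hm E' ⟨q, hq⟩)
    exact ⟨T, hT, q, ExpChar.prime hq, fun S hS hTS => Or.inr (h S hS hTS).2⟩

/-- `S` is large enough to attain the maximal exponent and to have a separable center; `S'` contains
it and has a center linearly disjoint from `S`. Both degrees contain exactly `p ^ k`, so
`exists_central_algHom` applies. -/
theorem exists_primary_component (hR : IsLFD F R) (hF : IsBrauerFiniteDimensional F) {p k : ℕ}
    (hp : p.Prime) {T : Subalgebra F R} [FiniteDimensional F T]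
    (hT : ∀ S : Subalgebra F R, FiniteDimensional F S → T ≤ S →
        padicValNat p (Module.finrank F S) = 2 * k ∧ ¬ p ∣ Module.finrank F (cen S)) :
    ∃ A : Subalgebra F R, FiniteDimensional F A ∧ cen A = ⊥ ∧ Module.finrank F A = (p ^ k) ^ 2 := by
  obtain ⟨T', _, q, _, hq⟩ := exists_isSeparable_center hR hF
  have := hR.finiteDimensional_sup T T'
  obtain ⟨S, hS⟩ : ∃ S : Subalgebra F R, S = T ⊔ T' := ⟨_, rfl⟩
  have : FiniteDimensional F S := hS ▸ this
  obtain ⟨Y, hY⟩ := exists_finset_finrank_sup_cen S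
  obtain ⟨S', _, hSS', hYS'⟩ := hR.exists_le S Y
  obtain ⟨hf, hd⟩ := hY S' inferInstance hSS' hYS'
  let _ : DivisionRing S := divisionRingSubalgebra S
  let _ : DivisionRing S' := divisionRingSubalgebra S'
  have hTS : T ≤ S := hS ▸ le_sup_left
  have hTS' : T' ≤ S := hS ▸ le_sup_right
  obtain ⟨hv, hc⟩ := hT S inferInstance hTS
  obtain ⟨hv', hc'⟩ := hT S' inferInstance (hTS.trans hSS')
  have hqS := hq S inferInstance hTS'
  have hqS' := hq S' inferInstance (hTS'.trans hSS')
  have hcd' : Module.finrank F (cen S') = Module.finrank F (Subalgebra.center F S') := by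
    rw [← finrank_comap_val (cen_le S'), comap_cen]
  rw [← finrank_comap_val (cen_le S), comap_cen] at hc hqS
  rw [hcd'] at hc' hqS' hd
  have := isSeparable_of_not_dvd_finrank hqS
  have := isSeparable_of_not_dvd_finrank hqS'
  obtain ⟨m, -, hm⟩ := exists_degree hp hv hc
  obtain ⟨m', hm'p, hm'⟩ := exists_degree hp hv' hc'
  have hσ : ∀ (s : S) (l : Subalgebra.center F S'), Commute (Subalgebra.inclusion hSS' s)
      (IsScalarTower.toAlgHom F (Subalgebra.center F S') S' l) := fun s l =>
    Subalgebra.mem_center_iff.1 l.2 _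
  obtain ⟨A, _, _, _, _, hA, ⟨f⟩⟩ := exists_central_algHom hp hc hc' hm hm' hm'p
    (Subalgebra.inclusion hSS') hσ (by
      have h1 : cen S' ⊔ S ≤ (Algebra.TensorProduct.lift (Subalgebra.inclusion hSS')
          (IsScalarTower.toAlgHom F (Subalgebra.center F S') S') hσ).range.map S'.val := by
        refine sup_le (fun x hx => ?_) fun x hx => ?_
        · refine ⟨⟨x, cen_le S' hx⟩, ⟨1 ⊗ₜ ⟨⟨x, cen_le S' hx⟩, ?_⟩, ?_⟩, rfl⟩
          · rw [← comap_cen]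
            exact hx
          · refine (Algebra.TensorProduct.lift_tmul _ _ _ _ _).trans ?_
            rw [map_one, one_mul]
            rfl
        · refine ⟨⟨x, hSS' hx⟩, ⟨⟨x, hx⟩ ⊗ₜ 1, ?_⟩, rfl⟩
          refine (Algebra.TensorProduct.lift_tmul _ _ _ _ _).trans ?_
          rw [map_one, mul_one]
          rfl
      refine injective_lift_of_finrank_le _ _ hσ
        (Subalgebra.toSubmodule ((cen S' ⊔ S).comap S'.val)) (fun x hx => ?_) ?_
      · obtain ⟨y, ⟨t, ht⟩, hy⟩ := h1 hx
        exact ⟨t, ht.trans (Subtype.ext hy)⟩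
      · exact (hd.symm.trans (finrank_comap_val (sup_le (cen_le S') hSS')).symm).le)
  let g : A →ₐ[F] R := S'.val.comp f
  have hg : Function.Injective g := g.toRingHom.injective
  let e : A ≃ₐ[F] g.range := AlgEquiv.ofInjective g hg
  refine ⟨g.range, e.toLinearEquiv.finiteDimensional, le_antisymm ?_ bot_le, ?_⟩
  · rintro _ ⟨⟨a, rfl⟩, ha⟩
    have h1 : a ∈ Subalgebra.center F A := Subalgebra.mem_center_iff.2 fun b => hg (by
      rw [map_mul, map_mul]
      exact (Subalgebra.mem_centralizer_iff F).1 ha _ ⟨b, rfl⟩)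
    rw [Algebra.IsCentral.center_eq_bot] at h1
    obtain ⟨c, rfl⟩ := Algebra.mem_bot.1 h1
    exact Algebra.mem_bot.2 ⟨c, (g.commutes c).symm⟩
  · rw [← e.toLinearEquiv.finrank_eq, hA]

end Components

/-! ### Commuting systems of components -/

section Components

variable {F : Type u} {R : Type v} [Field F] [DivisionRing R] [Algebra F R]

/-- Homomorphisms of a finite-dimensional simple algebra to a central division algebra differ by
an endomorphism. -/
theorem exists_algHom_apply_eq {F D S : Type*} [Field F] [DivisionRing D] [Algebra F D]
    [Algebra.IsCentral F D] [Ring S] [IsSimpleRing S] [Algebra F S] [FiniteDimensional F S]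
    (f g : S →ₐ[F] D) : ∃ d : D →ₐ[F] D, ∀ s, d (f s) = g s := by
  obtain ⟨u, hu, h⟩ := exists_conj_of_algHom f g
  refine ⟨
    { toFun := fun y => u⁻¹ * y * u
      map_one' := by simp [hu]
      map_mul' := fun y z => by simp [mul_assoc, hu]
      map_zero' := by simp
      map_add' := fun y z => by simp [mul_add, add_mul]
      commutes' := fun r => by
        rw [mul_assoc, Algebra.commutes, ← mul_assoc, inv_mul_cancel₀ hu, one_mul] }, fun s => ?_⟩
  change u⁻¹ * f s * u = g s
  rw [mul_assoc, h, ← mul_assoc, inv_mul_cancel₀ hu, one_mul]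

theorem isCentral_mulOpposite (F A : Type*) [Field F] [Ring A] [Algebra F A]
    [Algebra.IsCentral F A] : Algebra.IsCentral F Aᵐᵒᵖ where
  out x hx := by
    rw [Subalgebra.mem_center_iff] at hx
    have h1 : x.unop ∈ Subalgebra.center F A := Subalgebra.mem_center_iff.2 fun a =>
      (congrArg MulOpposite.unop (hx (MulOpposite.op a))).symm
    rw [Algebra.IsCentral.center_eq_bot] at h1
    obtain ⟨c, hc⟩ := Algebra.mem_bot.1 h1
    exact Algebra.mem_bot.2 ⟨c, MulOpposite.unop_injective hc⟩

/-- `X` itself, under left multiplication by `B` and right multiplication by `C`, is the required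
bimodule. -/
theorem exists_algHom_of_coprime_subalgebra {B C X : Subalgebra F R} [FiniteDimensional F X]
    (hB : B ≤ X) (hC : C ≤ X) (h : cen B = ⊥ ∨ cen C = ⊥) {m : ℕ}
    (hm : Module.finrank F X = m * Module.finrank F C)
    (hcop : Nat.Coprime m (Module.finrank F B)) : Nonempty (B →ₐ[F] C) := by
  have := finiteDimensional_of_le hB
  have := finiteDimensional_of_le hC
  let _ : DivisionRing B := divisionRingSubalgebra B
  let _ : DivisionRing C := divisionRingSubalgebra C
  have : IsSimpleRing (B ⊗[F] Cᵐᵒᵖ) := by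
    rcases h with h | h
    · have := isCentral_iff_cen_eq_bot.2 h
      infer_instance
    · have := isCentral_iff_cen_eq_bot.2 h
      have := isCentral_mulOpposite F C
      exact IsSimpleRing.of_ringEquiv (Algebra.TensorProduct.comm F Cᵐᵒᵖ B).toRingEquiv inferInstance
  exact exists_algHom_of_coprime (leftMul (Subalgebra.inclusion hB))
    (rightMul (Subalgebra.inclusion hC)) (leftMul_commute_rightMul _ _) m hm hcop

theorem cen_range_eq_bot {A : Subalgebra F R} (hA : cen A = ⊥) (f : A →ₐ[F] R)
    (hf : Function.Injective f) : cen f.range = ⊥ := by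
  refine le_antisymm ?_ bot_le
  rintro _ ⟨⟨a, rfl⟩, ha⟩
  have h1 : (a : R) ∈ cen A := mem_cen.2 ⟨a.2, fun b hb => congrArg Subtype.val
    (hf (a₁ := ⟨b, hb⟩ * a) (a₂ := a * ⟨b, hb⟩) (by
      rw [map_mul, map_mul]
      exact (Subalgebra.mem_centralizer_iff F).1 ha _ ⟨⟨b, hb⟩, rfl⟩))⟩
  rw [hA] at h1
  obtain ⟨c, hc⟩ := Algebra.mem_bot.1 h1
  refine Algebra.mem_bot.2 ⟨c, ?_⟩
  rw [← f.commutes c]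
  exact congrArg f (Subtype.ext hc)

/-- A finite-dimensional subalgebra with the center `F`, of degree `d`. -/
structure IsComponent (d : ℕ) (A : Subalgebra F R) : Prop where
  finiteDimensional : FiniteDimensional F A
  cen_eq : cen A = ⊥
  finrank_eq : Module.finrank F A = d ^ 2

theorem IsComponent.range {d : ℕ} {A : Subalgebra F R} (h : IsComponent d A) (f : A →ₐ[F] R) :
    IsComponent d f.range := by
  have := h.finiteDimensional
  let _ : DivisionRing A := divisionRingSubalgebra A
  have hf : Function.Injective f := f.toRingHom.injective
  let e : A ≃ₐ[F] f.range := AlgEquiv.ofInjective f hf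
  exact ⟨e.toLinearEquiv.finiteDimensional, cen_range_eq_bot h.cen_eq f hf, by
    rw [← e.toLinearEquiv.finrank_eq, h.finrank_eq]⟩

/-- `A` need not contain the center of `X`; the centralizer theorem is applied to `A · cen X`, which
has the same centralizer in `X`. -/
theorem finrank_mul_finrank_inf_centralizer_of_cen_eq_bot {A X : Subalgebra F R}
    [FiniteDimensional F X] (hAX : A ≤ X) (hA : cen A = ⊥) :
    Module.finrank F X = Module.finrank F A *
      Module.finrank F (X ⊓ Subalgebra.centralizer F (A : Set R) : Subalgebra F R) := by
  have := finiteDimensional_of_le hAX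
  have hcomm : ∀ a ∈ A, ∀ b ∈ cen X, a * b = b * a := fun a ha b hb => (mem_cen.1 hb).2 a (hAX ha)
  obtain ⟨hf, hd⟩ := finrank_sup_mul_finrank_cen hcomm (hA.trans_le bot_le)
  have h1 := finrank_mul_finrank_inf_centralizer (S := X) (B := A ⊔ cen X)
    (sup_le hAX (cen_le X)) le_sup_right
  have h2 : X ⊓ Subalgebra.centralizer F ((A ⊔ cen X : Subalgebra F R) : Set R) =
      X ⊓ Subalgebra.centralizer F (A : Set R) := by
    refine le_antisymm (inf_le_inf_left _ (Subalgebra.centralizer_le F _ _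
      (SetLike.coe_subset_coe.2 le_sup_left))) ?_
    rintro x ⟨hx, hxA⟩
    refine ⟨hx, (Subalgebra.mem_centralizer_iff F).2 fun y hy => ?_⟩
    exact (commute_sup (C := Algebra.adjoin F {x}) (A := A) (B := cen X)
      (fun z hz a ha => by
        have : Algebra.adjoin F {x} ≤ Subalgebra.centralizer F (A : Set R) :=
          Algebra.adjoin_le (by simpa using hxA)
        exact ((Subalgebra.mem_centralizer_iff F).1 (this hz) a ha).symm)
      (fun z hz b hb => (mem_cen.1 hb).2 z (Algebra.adjoin_le (by simpa using hx) hz))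
      x (Algebra.self_mem_adjoin_singleton F x) y hy).symm
  rw [h2] at h1
  rw [hA, Subalgebra.finrank_bot, mul_one] at hd
  rw [hd, mul_right_comm] at h1
  exact (Nat.eq_of_mul_eq_mul_right Module.finrank_pos h1).symm

/-- Pairwise commuting components for a finite set of primes. -/
structure IsSystem (k : Nat.Primes → ℕ) (π : Finset Nat.Primes)
    (A : Nat.Primes → Subalgebra F R) : Prop where
  component : ∀ p ∈ π, IsComponent ((p : ℕ) ^ k p) (A p)
  commute : ∀ p ∈ π, ∀ q ∈ π, p ≠ q → ∀ x ∈ A p, ∀ y ∈ A q, x * y = y * x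

variable {k : Nat.Primes → ℕ} {π : Finset Nat.Primes} {A : Nat.Primes → Subalgebra F R}

theorem IsSystem.mono (h : IsSystem k π A) {π' : Finset Nat.Primes} (hπ : π' ⊆ π) :
    IsSystem k π' A :=
  ⟨fun p hp => h.component p (hπ hp), fun p hp q hq => h.commute p (hπ hp) q (hπ hq)⟩

theorem IsSystem.congr (h : IsSystem k π A) {A' : Nat.Primes → Subalgebra F R}
    (hA : ∀ p ∈ π, A' p = A p) : IsSystem k π A' :=
  ⟨fun p hp => hA p hp ▸ h.component p hp, fun p hp q hq => by
    rw [hA p hp, hA q hq]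
    exact h.commute p hp q hq⟩

theorem IsSystem.commute_sup {q : Nat.Primes} (hq : q ∉ π)
    (h' : IsSystem k (insert q π) A) : ∀ x ∈ A q, ∀ y ∈ π.sup A, x * y = y * x := by
  have : π.sup A ≤ Subalgebra.centralizer F (A q : Set R) := Finset.sup_le fun p hp y hy =>
    (Subalgebra.mem_centralizer_iff F).2 fun x hx =>
      h'.commute q (Finset.mem_insert_self q π) p (Finset.mem_insert_of_mem hp)
        (fun h => hq (h ▸ hp)) x hx y hy
  exact fun x hx y hy => (Subalgebra.mem_centralizer_iff F).1 (this hy) x hx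

theorem IsSystem.sup (h : IsSystem k π A) :
    IsComponent (∏ p ∈ π, (p : ℕ) ^ k p) (π.sup A) := by
  induction π using Finset.induction_on with
  | empty =>
    rw [Finset.sup_empty, Finset.prod_empty]
    exact ⟨inferInstance, le_antisymm (cen_le _) bot_le, by rw [Subalgebra.finrank_bot, one_pow]⟩
  | insert q π hq ih =>
    have h1 := h.mono (Finset.subset_insert q π)
    have h2 := ih h1
    have h3 := h.component q (Finset.mem_insert_self q π)
    have := h2.finiteDimensional
    have := h3.finiteDimensional
    have hle : cen (A q) ≤ π.sup A := h3.cen_eq.trans_le bot_le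
    have hcomm := IsSystem.commute_sup hq h
    rw [Finset.sup_insert, Finset.prod_insert hq]
    obtain ⟨h4, h5⟩ := finrank_sup_mul_finrank_cen hcomm hle
    refine ⟨h4, by rw [cen_sup_eq hcomm hle, h2.cen_eq], ?_⟩
    rw [h3.cen_eq, Subalgebra.finrank_bot, mul_one, h3.finrank_eq, h2.finrank_eq] at h5
    rw [h5, mul_pow]

variable (hR : IsLFD F R)
include hR

/-- The bimodule is the algebra generated by `S` and the system. A prime dividing both its dimension
over the system and `[S : F]` belongs to `π` and would raise the exponent above the maximum `2 * k
p`. -/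
theorem IsSystem.exists_algHom
    (hv : ∀ (p : Nat.Primes) (S : Subalgebra F R), FiniteDimensional F S →
    padicValNat p (Module.finrank F S) ≤ 2 * k p)
    (h : IsSystem k π A) {S : Subalgebra F R} [FiniteDimensional F S]
    (hS : ∀ p : Nat.Primes, (p : ℕ) ∣ Module.finrank F S → p ∈ π) :
    Nonempty (S →ₐ[F] (π.sup A : Subalgebra F R)) := by
  have h1 := h.sup
  have := h1.finiteDimensional
  have := hR.finiteDimensional_sup (π.sup A) S
  obtain ⟨m, hm⟩ := finrank_dvd_of_le (le_sup_left : π.sup A ≤ π.sup A ⊔ S)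
  refine exists_algHom_of_coprime_subalgebra (X := π.sup A ⊔ S) le_sup_right le_sup_left
    (Or.inr h1.cen_eq) (m := m) (by rw [hm, mul_comm]) ?_
  refine Nat.coprime_of_dvd fun p hp hpm hpS => ?_
  have := Fact.mk hp
  have h2 := hS ⟨p, hp⟩ hpS
  have h3 := finrank_dvd_of_le (Finset.le_sup (f := A) h2)
  rw [(h.component _ h2).finrank_eq] at h3
  have h4 : p ^ (2 * k ⟨p, hp⟩ + 1) ∣ Module.finrank F (π.sup A ⊔ S : Subalgebra F R) := by
    rw [hm, pow_succ, mul_comm 2, pow_mul]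
    exact mul_dvd_mul h3 hpm
  have h5 := (padicValNat_dvd_iff_le (p := p) Module.finrank_pos.ne').1 h4
  have h6 := hv ⟨p, hp⟩ (π.sup A ⊔ S) inferInstance
  change padicValNat p _ ≤ _ at h6
  omega

variable (hA : ∀ p : Nat.Primes, ∃ A : Subalgebra F R, IsComponent ((p : ℕ) ^ k p) A)
include hA

/-- A component for `q` embeds in the centralizer of the system, because the dimension of the system
is prime to `q`. -/
theorem IsSystem.exists_insert (h : IsSystem k π A) (q : Nat.Primes) :
    ∃ A' : Nat.Primes → Subalgebra F R, IsSystem k (insert q π) A' ∧ ∀ p ∈ π, A' p = A p := by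
  classical
  by_cases hq : q ∈ π
  · exact ⟨A, by rwa [Finset.insert_eq_of_mem hq], fun _ _ => rfl⟩
  obtain ⟨B, hB⟩ := hA q
  have h1 := h.sup
  have := h1.finiteDimensional
  have := hB.finiteDimensional
  have := hR.finiteDimensional_sup (π.sup A) B
  have h2 := finrank_mul_finrank_inf_centralizer_of_cen_eq_bot
    (le_sup_left : π.sup A ≤ π.sup A ⊔ B) h1.cen_eq
  obtain ⟨f⟩ := exists_algHom_of_coprime_subalgebra (X := π.sup A ⊔ B) le_sup_right inf_le_left
    (Or.inl hB.cen_eq) h2 (by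
      rw [h1.finrank_eq, hB.finrank_eq]
      refine Nat.Coprime.pow _ _ (Nat.Coprime.prod_left fun p hp => Nat.Coprime.pow _ _ ?_)
      exact (Nat.coprime_primes p.2 q.2).2 fun h => hq (Subtype.ext h ▸ hp))
  let g : B →ₐ[F] R := (Subalgebra.val _).comp f
  have hg : ∀ x ∈ g.range, ∀ p ∈ π, ∀ y ∈ A p, y * x = x * y := by
    rintro _ ⟨b, rfl⟩ p hp y hy
    exact (Subalgebra.mem_centralizer_iff F).1 (f b).2.2 y (Finset.le_sup (f := A) hp hy)
  have hne : ∀ p ∈ π, p ≠ q := fun p hp h => hq (h ▸ hp)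
  refine ⟨Function.update A q g.range, ⟨fun p hp => ?_, fun p hp p' hp' hpp' => ?_⟩, fun p hp =>
    Function.update_of_ne (hne p hp) _ _⟩
  · rcases Finset.mem_insert.1 hp with rfl | hp
    · rw [Function.update_self]
      exact hB.range g
    · rw [Function.update_of_ne (hne p hp)]
      exact h.component p hp
  · rcases Finset.mem_insert.1 hp with h₁ | h₁ <;> rcases Finset.mem_insert.1 hp' with h₂ | h₂
    · exact absurd (h₁.trans h₂.symm) hpp'
    · rw [h₁, Function.update_self, Function.update_of_ne (hne p' h₂)]
      exact fun x hx y hy => (hg x hx p' h₂ y hy).symm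
    · rw [h₂, Function.update_self, Function.update_of_ne (hne p h₁)]
      exact fun x hx y hy => hg y hy p h₁ x hx
    · rw [Function.update_of_ne (hne p h₁), Function.update_of_ne (hne p' h₂)]
      exact h.commute p h₁ p' h₂ hpp'

theorem IsSystem.exists_union (h : IsSystem k π A) (σ : Finset Nat.Primes) :
    ∃ A' : Nat.Primes → Subalgebra F R, IsSystem k (σ ∪ π) A' ∧ ∀ p ∈ π, A' p = A p := by
  induction σ using Finset.induction_on with
  | empty => exact ⟨A, by rwa [Finset.empty_union], fun _ _ => rfl⟩
  | insert q σ _ ih =>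
    obtain ⟨A', h1, h2⟩ := ih
    obtain ⟨A'', h3, h4⟩ := h1.exists_insert hR hA q
    refine ⟨A'', by rwa [Finset.insert_union], fun p hp => ?_⟩
    rw [h4 p (Finset.mem_union_right _ hp), h2 p hp]

variable [Algebra.IsCentral F R]

/-- A system can be enlarged so that it generates a given element. -/
theorem IsSystem.exists_mem
    (hv : ∀ (p : Nat.Primes) (S : Subalgebra F R), FiniteDimensional F S →
    padicValNat p (Module.finrank F S) ≤ 2 * k p)
    (h : IsSystem k π A) (σ : Finset Nat.Primes) (x : R) :
    ∃ (π' : Finset Nat.Primes) (A' : Nat.Primes → Subalgebra F R), σ ⊆ π' ∧ π ⊆ π' ∧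
      IsSystem k π' A' ∧ (∀ p ∈ π, A' p = A p) ∧ x ∈ π'.sup A' := by
  classical
  have h1 := h.sup
  have := h1.finiteDimensional
  obtain ⟨S, _, hS, hxS⟩ := hR.exists_le (π.sup A) {x}
  let ρ : Finset Nat.Primes := (Module.finrank F S).primeFactors.subtype Nat.Prime
  have hρ : ∀ p : Nat.Primes, (p : ℕ) ∣ Module.finrank F S → p ∈ ρ := fun p hp =>
    Finset.mem_subtype.2 (Nat.mem_primeFactors.2 ⟨p.2, hp, Module.finrank_pos.ne'⟩)
  obtain ⟨A', h2, h3⟩ := h.exists_union hR hA (ρ ∪ σ)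
  have hπ : π ⊆ ρ ∪ σ ∪ π := Finset.subset_union_right
  obtain ⟨f⟩ := h2.exists_algHom hR hv (S := S) fun p hp =>
    Finset.mem_union_left _ (Finset.mem_union_left _ (hρ p hp))
  have h4 := h2.sup
  set Θ := (ρ ∪ σ ∪ π).sup A' with hΘ
  have := h4.finiteDimensional
  have hle : π.sup A ≤ Θ := Finset.sup_le fun p hp =>
    (h3 p hp).symm.trans_le (Finset.le_sup (f := A') (hπ hp))
  let _ : DivisionRing Θ := divisionRingSubalgebra Θ
  let _ : DivisionRing S := divisionRingSubalgebra S
  let _ : DivisionRing (π.sup A : Subalgebra F R) := divisionRingSubalgebra _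
  have : Algebra.IsCentral F Θ := isCentral_iff_cen_eq_bot.2 h4.cen_eq
  -- A conjugation inside `Θ` makes the embedding of `S` the identity on the old system.
  obtain ⟨c, hc⟩ := exists_algHom_apply_eq (f.comp (Subalgebra.inclusion hS))
    (Subalgebra.inclusion hle)
  have hcf : ∀ a (ha : a ∈ π.sup A), (c (f ⟨a, hS ha⟩) : R) = a := fun a ha =>
    congrArg Subtype.val (hc ⟨a, ha⟩)
  -- A conjugation in `R` brings the image of `S` back to `S`. It fixes the old system elementwise,
  -- and the image of `Θ` contains `S`, hence `x`.
  obtain ⟨d, hd⟩ := exists_algHom_apply_eq (Θ.val.comp (c.comp f)) S.val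
  have hdA : ∀ a ∈ π.sup A, d a = a := fun a ha => by
    have h5 : d (c (f ⟨a, hS ha⟩) : R) = a := hd ⟨a, hS ha⟩
    rwa [hcf a ha] at h5
  refine ⟨ρ ∪ σ ∪ π, fun p => (A' p).map d, fun p hp => Finset.mem_union_left _
    (Finset.mem_union_right _ hp), hπ, ⟨fun p hp => ?_, fun p hp q hq hpq => ?_⟩, fun p hp => (?_ : (A' p).map d = A p), ?_⟩
  · have := (h2.component p hp).range (d.comp (A' p).val)
    rwa [AlgHom.range_comp, Subalgebra.range_val] at this
  · rintro _ ⟨y, hy, rfl⟩ _ ⟨y', hy', rfl⟩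
    change d y * d y' = d y' * d y
    rw [← map_mul, h2.commute p hp q hq hpq y hy y' hy', map_mul]
  · rw [h3 p hp]
    ext y
    constructor
    · rintro ⟨y, hy, rfl⟩
      change d y ∈ _
      rwa [hdA y (Finset.le_sup (f := A) hp hy)]
    · exact fun hy => ⟨y, hy, hdA y (Finset.le_sup (f := A) hp hy)⟩
  · have h7 : Θ.map d ≤ (ρ ∪ σ ∪ π).sup fun p => (A' p).map d := by
      rw [Subalgebra.map_le]
      exact Finset.sup_le fun p hp => Subalgebra.map_le.1 (Finset.le_sup
        (f := fun p => (A' p).map d) hp)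
    have hx : x ∈ S := hxS (by simp)
    refine h7 ⟨(c (f ⟨x, hx⟩) : R), (c (f ⟨x, hx⟩)).2, ?_⟩
    exact hd ⟨x, hx⟩

end Components

/-! ### A system for all primes that absorbs a sequence -/

section Sequence

variable {F : Type u} {R : Type v} [Field F] [DivisionRing R] [Algebra F R]
  [Algebra.IsCentral F R] {k : Nat.Primes → ℕ}

/-- Step `n` adds the prime with code `n`, if there is one, and absorbs `x n`. Components chosen
once never change, so the stages have a limit. -/
theorem exists_system (hR : IsLFD F R)
    (hv : ∀ (p : Nat.Primes) (S : Subalgebra F R), FiniteDimensional F S →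
      padicValNat p (Module.finrank F S) ≤ 2 * k p)
    (hA : ∀ p : Nat.Primes, ∃ A : Subalgebra F R, IsComponent ((p : ℕ) ^ k p) A) (x : ℕ → R) :
    ∃ A : Nat.Primes → Subalgebra F R, (∀ π, IsSystem k π A) ∧ ∀ n, ∃ π : Finset Nat.Primes,
      x n ∈ π.sup A := by
  classical
  let _ : Encodable Nat.Primes := Encodable.ofCountable _
  let State := {s : Finset Nat.Primes × (Nat.Primes → Subalgebra F R) // IsSystem k s.1 s.2}
  have hstep : ∀ (n : ℕ) (s : State), ∃ t : State,
      ((Encodable.decode n : Option Nat.Primes).toFinset ⊆ t.1.1 ∧ s.1.1 ⊆ t.1.1) ∧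
      (∀ p ∈ s.1.1, t.1.2 p = s.1.2 p) ∧ x n ∈ t.1.1.sup t.1.2 := fun n s => by
    obtain ⟨π', A', h1, h2, h3, h4, h5⟩ := s.2.exists_mem hR hA hv
      (Encodable.decode n : Option Nat.Primes).toFinset (x n)
    exact ⟨⟨⟨π', A'⟩, h3⟩, ⟨h1, h2⟩, h4, h5⟩
  choose step hs1 hs2 hs3 using hstep
  let s : ℕ → State := fun n => Nat.rec
    ⟨⟨∅, fun _ => ⊥⟩, ⟨fun p hp => absurd hp (Finset.notMem_empty p),
      fun p hp => absurd hp (Finset.notMem_empty p)⟩⟩ step n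
  have hmono : ∀ n m, n ≤ m → (s n).1.1 ⊆ (s m).1.1 ∧
      ∀ p ∈ (s n).1.1, (s m).1.2 p = (s n).1.2 p := by
    intro n m hnm
    induction m, hnm using Nat.le_induction with
    | base => exact ⟨subset_rfl, fun _ _ => rfl⟩
    | succ m _ ih =>
      exact ⟨ih.1.trans (hs1 m (s m)).2, fun p hp => (hs2 m (s m) p (ih.1 hp)).trans (ih.2 p hp)⟩
  have hmem : ∀ p : Nat.Primes, p ∈ (s (Encodable.encode p + 1)).1.1 := fun p =>
    (hs1 (Encodable.encode p) (s (Encodable.encode p))).1 (by simp [Encodable.encodek])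
  -- Step `encode p` leads to stage `encode p + 1`, where `p` is certain to be present.
  let A : Nat.Primes → Subalgebra F R := fun p => (s (Encodable.encode p + 1)).1.2 p
  have hAeq : ∀ n, ∀ p ∈ (s n).1.1, A p = (s n).1.2 p := fun n p hp => by
    have h1 := (hmono _ (max n (Encodable.encode p + 1)) (le_max_left _ _)).2 p hp
    have h2 := (hmono _ (max n (Encodable.encode p + 1)) (le_max_right _ _)).2 p (hmem p)
    exact h2.symm.trans h1
  refine ⟨A, fun π => ?_, fun n => ⟨(s (n + 1)).1.1, ?_⟩⟩
  · let N := π.sup fun p => Encodable.encode p + 1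
    have hsub : π ⊆ (s N).1.1 := fun p hp =>
      (hmono _ N (Finset.le_sup (f := fun p => Encodable.encode p + 1) hp)).1 (hmem p)
    exact ((s N).2.congr (hAeq N)).mono hsub
  · rw [Finset.sup_congr rfl (hAeq (n + 1))]
    exact hs3 n (s n)

end Sequence

/-! ### The generated subalgebra as an infinite tensor product -/

section TensorProduct

variable {F : Type u} {R : Type v} [Field F] [DivisionRing R] [Algebra F R]
  {k : Nat.Primes → ℕ} {A : Nat.Primes → Subalgebra F R}

theorem piLift_mem {F C ι : Type*} [Field F] [Ring C] [Algebra F C] [Fintype ι]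
    {B : ι → Type*} [∀ i, Ring (B i)] [∀ i, Algebra F (B i)] (φ : ∀ i, B i →ₐ[F] C)
    (hφ : Pairwise fun i j => ∀ x y, Commute (φ i x) (φ j y)) (U : Subalgebra F C)
    (hU : ∀ i x, φ i x ∈ U) (x : ⨂[F] i, B i) : piLift φ hφ x ∈ U := by
  classical
  let ψ : ∀ i, B i →ₐ[F] U := fun i => (φ i).codRestrict U (hU i)
  have hψ : Pairwise fun i j => ∀ x y, Commute (ψ i x) (ψ j y) :=
    fun i j hij x y => Subtype.ext (hφ hij x y)
  have h : piLift φ hφ = U.val.comp (piLift ψ hψ) := by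
    refine PiTensorProduct.algHom_ext fun i => AlgHom.ext fun y => ?_
    exact (piLift_single φ hφ i y).trans (congrArg Subtype.val (piLift_single ψ hψ i y)).symm
  rw [h]
  exact Subtype.property _

theorem transition_singleAlgHom {ι : Type w} [DecidableEq ι] {B : ι → Type v} [∀ i, Ring (B i)]
    [∀ i, Algebra F (B i)] (S T : Finset ι) (h : S ≤ T) (i : S) (y : B i) :
    transition B F S T h (PiTensorProduct.singleAlgHom (A := fun i : S => B i) i y) =
      PiTensorProduct.singleAlgHom (A := fun i : T => B i) ⟨i, h i.2⟩ y := by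
  rw [PiTensorProduct.singleAlgHom_apply, PiTensorProduct.singleAlgHom_apply, transition_tprod]
  congr 1
  change extendOne S T (Function.update (1 : ∀ j : S, B j) i y) =
    Function.update (1 : ∀ j : T, B j) ⟨(i : ι), h i.2⟩ y
  rw [extendOne_update h, extendOne_one]

/-- The finite stages are simple and hence map injectively to `R`; so does their direct limit, whose
image is generated by the factors. -/
theorem nonempty_range_algEquiv_algTensor {ι : Type w} {B : ι → Type v} [∀ i, Ring (B i)]
    [∀ i, Algebra F (B i)] [∀ i, FiniteDimensional F (B i)] [∀ i, Algebra.IsCentral F (B i)]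
    [∀ i, IsSimpleRing (B i)] (φ : ∀ i, B i →ₐ[F] R)
    (hφ : Pairwise fun i j => ∀ x y, Commute (φ i x) (φ j y)) :
    Nonempty ((⨆ i, (φ i).range : Subalgebra F R) ≃ₐ[F] AlgTensor B F) := by
  classical
  have hcomm : ∀ S : Finset ι, Pairwise fun i j : S => ∀ x y, Commute (φ i x) (φ j y) :=
    fun S i j hij => hφ fun h => hij (Subtype.ext h)
  let g : ∀ S : Finset ι, (⨂[F] i : S, B i) →ₐ[F] R := fun S =>
    piLift (fun i : S => φ i) (hcomm S)
  have hg : ∀ S T (h : S ≤ T) x, g T (transition B F S T h x) = g S x := by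
    intro S T h x
    refine DFunLike.congr_fun (?_ : (g T).comp (transition B F S T h) = g S) x
    refine PiTensorProduct.algHom_ext fun i => AlgHom.ext fun y => ?_
    refine (congrArg (g T) (transition_singleAlgHom S T h i y)).trans ?_
    exact (piLift_single (fun i : T => φ i) (hcomm T) ⟨i, h i.2⟩ y).trans
      (piLift_single (fun i : S => φ i) (hcomm S) i y).symm
  let G : AlgTensor B F →ₐ[F] R :=
    DirectLimit.Algebra.lift (fun S : Finset ι => ⨂[F] i : S, B i) (transition B F) R g hg
  have hinj : Function.Injective G :=
    DirectLimit.lift_injective _ (fun S => g S) (fun S T h x => (hg S T h x).symm)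
      fun S => (g S).toRingHom.injective
  have hrange : G.range = ⨆ i, (φ i).range := by
    refine le_antisymm ?_ (iSup_le fun i => ?_)
    · rintro _ ⟨z, rfl⟩
      obtain ⟨S, t, rfl⟩ := DirectLimit.exists_eq_mk _ z
      exact piLift_mem (fun i : S => φ i) (hcomm S) _
        (fun i x => (le_iSup (fun i => (φ i).range) (i : ι)) ⟨x, rfl⟩) t
    · rintro _ ⟨y, rfl⟩
      refine ⟨DirectLimit.Algebra.of (fun S : Finset ι => ⨂[F] i : S, B i)
        (transition B F) {i} (PiTensorProduct.singleAlgHom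
          (A := fun j : ({i} : Finset ι) => B j) ⟨i, Finset.mem_singleton_self i⟩ y), ?_⟩
      exact piLift_single (fun j : ({i} : Finset ι) => φ j) (hcomm {i})
        ⟨i, Finset.mem_singleton_self i⟩ y
  rw [← hrange]
  exact ⟨(AlgEquiv.ofInjective G hinj).symm⟩

theorem nonempty_algEquiv_algTensor (hA : ∀ π, IsSystem k π A) :
    Nonempty ((⨆ p, A p : Subalgebra F R) ≃ₐ[F] AlgTensor (fun p : Nat.Primes => A p) F) := by
  have hcomp : ∀ p : Nat.Primes, IsComponent ((p : ℕ) ^ k p) (A p) := fun p =>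
    (hA {p}).component p (Finset.mem_singleton_self p)
  have : ∀ p, FiniteDimensional F (A p) := fun p => (hcomp p).finiteDimensional
  have : ∀ p, Algebra.IsCentral F (A p) := fun p => isCentral_iff_cen_eq_bot.2 (hcomp p).cen_eq
  have : ∀ p, IsSimpleRing (A p) := fun p => by
    let _ : DivisionRing (A p) := divisionRingSubalgebra (A p)
    infer_instance
  have h := nonempty_range_algEquiv_algTensor (B := fun p => A p) (fun p => (A p).val)
    fun p q hpq x y => by
      classical
      exact (hA {p, q}).commute p (by simp) q (by simp) hpq x x.2 y y.2
  have h' : (⨆ p, (A p).val.range) = ⨆ p, A p := iSup_congr fun p => (A p).range_val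
  exact h' ▸ h

end TensorProduct

/-! ### Properties of the constructed subalgebra -/

section Structure

variable {F : Type u} {R : Type v} [Field F] [DivisionRing R] [Algebra F R]

theorem isFDCentralDivision_of_isComponent {d : ℕ} {A : Subalgebra F R} (h : IsComponent d A) :
    IsFDCentralDivision F A := by
  have := h.finiteDimensional
  let _ : DivisionRing A := divisionRingSubalgebra A
  exact ⟨h.finiteDimensional, isCentral_iff_cen_eq_bot.2 h.cen_eq, inferInstance,
    fun a ha => isUnit_iff_ne_zero.2 ha⟩

theorem exists_separable_of_isComponent {d : ℕ} {A : Subalgebra F R} (h : IsComponent d A) :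
    ∃ ρ : R, IsSeparable F ρ ∧ Module.finrank F (Algebra.adjoin F {ρ}) = d := by
  have := h.finiteDimensional
  have := isCentral_iff_cen_eq_bot.2 h.cen_eq
  let _ : DivisionRing A := divisionRingSubalgebra A
  obtain ⟨θ, h1, h2⟩ := exists_separable_maximal_subfield F A
  have h3 := finrank_sq_of_centralizer_eq h2
  rw [h.finrank_eq] at h3
  refine ⟨θ, (isSeparable_coe A θ).2 h1, ?_⟩
  have h4 : (Algebra.adjoin F {θ}).map A.val = Algebra.adjoin F {(θ : R)} :=
    AlgHom.map_adjoin_singleton A.val θ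
  rw [← h4, ← ((Algebra.adjoin F {θ}).equivMapOfInjective A.val
    Subtype.val_injective).toLinearEquiv.finrank_eq]
  exact Nat.pow_left_injective two_ne_zero h3

theorem IsLFD.finiteDimensional_adjoin_singleton (hR : IsLFD F R) (x : R) :
    FiniteDimensional F (Algebra.adjoin F {x}) := by
  have h := hR {x}
  rwa [Finset.coe_singleton] at h

theorem adjoin_singleton_commute (x : R) :
    ∀ a ∈ Algebra.adjoin F {x}, ∀ b ∈ Algebra.adjoin F {x}, a * b = b * a :=
  adjoin_commute fun a ha b hb => by
    rw [Set.mem_singleton_iff.1 ha, Set.mem_singleton_iff.1 hb]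

/-- The commutative algebra generated by `x` is contained in its centralizer in `Θ`. -/
theorem finrank_adjoin_sq_dvd {Θ : Subalgebra F R} [FiniteDimensional F Θ] (hΘ : cen Θ = ⊥)
    {x : R} (hx : x ∈ Θ) :
    Module.finrank F (Algebra.adjoin F {x}) ^ 2 ∣ Module.finrank F Θ := by
  have hB : Algebra.adjoin F {x} ≤ Θ := Algebra.adjoin_le (Set.singleton_subset_iff.2 hx)
  have h1 := finrank_mul_finrank_inf_centralizer hB (hΘ.trans_le bot_le)
  rw [hΘ, Subalgebra.finrank_bot, mul_one] at h1
  have h2 : Algebra.adjoin F {x} ≤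
      Θ ⊓ Subalgebra.centralizer F (Algebra.adjoin F {x} : Set R) := fun b hb =>
    ⟨hB hb, (Subalgebra.mem_centralizer_iff F).2 fun a ha => adjoin_singleton_commute x a ha b hb⟩
  have := finiteDimensional_of_le (inf_le_left :
    Θ ⊓ Subalgebra.centralizer F (Algebra.adjoin F {x} : Set R) ≤ Θ)
  rw [sq, ← h1]
  exact mul_dvd_mul_left _ (finrank_dvd_of_le h2)

variable {k : Nat.Primes → ℕ} {A : Nat.Primes → Subalgebra F R}

theorem exists_algHom_sup (hR : IsLFD F R)
    (hv : ∀ (p : Nat.Primes) (S : Subalgebra F R), FiniteDimensional F S →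
      padicValNat p (Module.finrank F S) ≤ 2 * k p)
    (hA : ∀ π, IsSystem k π A) (S : Subalgebra F R) [FiniteDimensional F S] :
    ∃ π : Finset Nat.Primes, Nonempty (S →ₐ[F] (π.sup A : Subalgebra F R)) :=
  ⟨(Module.finrank F S).primeFactors.subtype Nat.Prime, (hA _).exists_algHom hR hv fun p hp =>
    Finset.mem_subtype.2 (Nat.mem_primeFactors.2 ⟨p.2, hp, Module.finrank_pos.ne'⟩)⟩

/-- `S` embeds in a finite product of components, and Skolem-Noether in `R` moves this product onto
an algebra that contains `S`. -/
theorem exists_le_cen_eq_bot [Algebra.IsCentral F R] (hR : IsLFD F R)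
    (hv : ∀ (p : Nat.Primes) (S : Subalgebra F R), FiniteDimensional F S →
      padicValNat p (Module.finrank F S) ≤ 2 * k p)
    (hA : ∀ π, IsSystem k π A) (S : Subalgebra F R) [FiniteDimensional F S] :
    ∃ Θ : Subalgebra F R, S ≤ Θ ∧ FiniteDimensional F Θ ∧ cen Θ = ⊥ := by
  obtain ⟨π, ⟨f⟩⟩ := exists_algHom_sup hR hv hA S
  let _ : DivisionRing S := divisionRingSubalgebra S
  obtain ⟨d, hd⟩ := exists_algHom_apply_eq ((π.sup A).val.comp f) S.val
  have h := (hA π).sup.range (d.comp (π.sup A).val)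
  exact ⟨(d.comp (π.sup A).val).range, fun s hs => ⟨f ⟨s, hs⟩, hd ⟨s, hs⟩⟩, h.finiteDimensional, h.cen_eq⟩

/-- If `p` divided the degree of an element `c` of the centralizer, the algebra generated by `A p`
and `c` would have an exponent above `2 * k p`. So the degree is 1. -/
theorem centralizer_eq_bot (hR : IsLFD F R)
    (hv : ∀ (p : Nat.Primes) (S : Subalgebra F R), FiniteDimensional F S →
      padicValNat p (Module.finrank F S) ≤ 2 * k p)
    (hA : ∀ p : Nat.Primes, IsComponent ((p : ℕ) ^ k p) (A p)) :
    Subalgebra.centralizer F ((⨆ p, A p : Subalgebra F R) : Set R) = ⊥ := by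
  refine le_antisymm (fun c hc => ?_) bot_le
  have hfd := hR.finiteDimensional_adjoin_singleton c
  have hle : Algebra.adjoin F {c} ≤
      Subalgebra.centralizer F ((⨆ p, A p : Subalgebra F R) : Set R) :=
    Algebra.adjoin_le (Set.singleton_subset_iff.2 hc)
  have hdvd : ∀ p : Nat.Primes, ¬ (p : ℕ) ∣ Module.finrank F (Algebra.adjoin F {c}) := by
    intro p hp
    have := (hA p).finiteDimensional
    have : Fact (p : ℕ).Prime := ⟨p.2⟩
    obtain ⟨h1, h2⟩ := finrank_sup_mul_finrank_cen (A := A p) (B := Algebra.adjoin F {c})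
      (fun a ha b hb => (Subalgebra.mem_centralizer_iff F).1 (hle hb) a (le_iSup A p ha))
      ((hA p).cen_eq.trans_le bot_le)
    rw [(hA p).cen_eq, Subalgebra.finrank_bot, mul_one, (hA p).finrank_eq, ← pow_mul] at h2
    have h3 := hv p _ h1
    rw [h2, padicValNat.mul (pow_ne_zero _ p.2.ne_zero) Module.finrank_pos.ne',
      padicValNat.prime_pow] at h3
    have h4 := one_le_padicValNat_of_dvd Module.finrank_pos.ne' hp
    omega
  have h1 : Module.finrank F (Algebra.adjoin F {c}) = 1 := by
    by_contra h
    obtain ⟨p, hp, hd⟩ := Nat.exists_prime_and_dvd h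
    exact hdvd ⟨p, hp⟩ hd
  exact (Subalgebra.finrank_eq_one_iff.1 h1).le (Algebra.self_mem_adjoin_singleton F c)

theorem isCentral_of_centralizer_eq_bot {B : Subalgebra F R}
    (h : Subalgebra.centralizer F (B : Set R) = ⊥) : Algebra.IsCentral F B :=
  isCentral_iff_cen_eq_bot.2 (le_antisymm (fun _ hx => h.le
    ((Subalgebra.mem_centralizer_iff F).2 fun b hb => ((mem_cen.1 hx).2 b hb))) bot_le)

/-- A sequence is supplied in every case, so that one construction of the components serves the
general statement and the countable case. -/
theorem exists_seq_span_eq_top (F : Type u) (V : Type v) [Field F] [AddCommGroup V] [Module F V] :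
    ∃ x : ℕ → V, Module.rank F V = Cardinal.aleph0 → Submodule.span F (Set.range x) = ⊤ := by
  by_cases h : Module.rank F V = Cardinal.aleph0
  · let b := Module.Basis.ofVectorSpace F V
    have h1 := b.mk_eq_rank''.trans h
    obtain ⟨_⟩ := Cardinal.denumerable_iff.2 h1
    let e := Denumerable.eqv (Module.Basis.ofVectorSpaceIndex F V)
    exact ⟨b ∘ e.symm, fun _ => by rw [e.symm.surjective.range_comp, b.span_eq]⟩
  · exact ⟨0, fun h' => absurd h' h⟩

end Structure

end Koethe

theorem theorem3p1 (F : Type u) [Field F] (hF : Koethe.IsBrauerFiniteDimensional F)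
    (R : Type v) [DivisionRing R] [Algebra F R] [Algebra.IsCentral F R]
    (hR : Koethe.IsLFD F R) :
    Koethe.IsNLF F R ∧
    ∃ (k : Nat.Primes → ℕ) (Rt : Subalgebra F R),
      Algebra.IsCentral F Rt ∧
      -- (a)
      (∃ Rp : Nat.Primes → Subalgebra F R,
        (∀ p : Nat.Primes, Koethe.IsFDCentralDivision F (Rp p) ∧
          Module.finrank F (Rp p) = ((p : ℕ) ^ k p) ^ 2) ∧
        Nonempty (Rt ≃ₐ[F] Koethe.AlgTensor (fun p : Nat.Primes => Rp p) F)) ∧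
      -- (b)
      (∀ S : Subalgebra F R, FiniteDimensional F S →
        ∃ f : S →ₐ[F] Rt, Function.Injective f) ∧
      -- (c)
      (∀ p : Nat.Primes,
        IsGreatest {n : ℕ | ∃ ρ : R,
          (p : ℕ) ^ n ∣ Module.finrank F (Algebra.adjoin F {ρ})} (k p) ∧
        ∃ ρ : R, IsSeparable F ρ ∧
          (p : ℕ) ^ k p ∣ Module.finrank F (Algebra.adjoin F {ρ})) ∧
      -- (d)
      Subalgebra.centralizer F (Rt : Set R) = ⊥ ∧
      -- the case of countably infinite dimension
      (Module.rank F R = Cardinal.aleph0 → Nonempty (R ≃ₐ[F] Rt)) := by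
  open Koethe in
  obtain ⟨m, hm⟩ := id hF
  choose k T hT hv hmax using fun p : Nat.Primes =>
    exists_max_padicValNat hR p.2 (m := m p) fun E' _ _ _ => hm E' p
  have hA : ∀ p : Nat.Primes, ∃ A : Subalgebra F R, IsComponent ((p : ℕ) ^ k p) A := fun p => by
    have := hT p
    obtain ⟨A, h1, h2, h3⟩ := exists_primary_component hR hF p.2 (hmax p)
    exact ⟨A, h1, h2, h3⟩
  obtain ⟨x, hx⟩ := exists_seq_span_eq_top F R
  obtain ⟨A, hsys, hmem⟩ := exists_system hR hv hA x
  have hcomp : ∀ p : Nat.Primes, IsComponent ((p : ℕ) ^ k p) (A p) := fun p =>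
    (hsys {p}).component p (Finset.mem_singleton_self p)
  have hsup : ∀ π : Finset Nat.Primes, π.sup A ≤ ⨆ p, A p := fun π =>
    Finset.sup_le fun p _ => le_iSup A p
  have hcent := centralizer_eq_bot hR hv hcomp
  have hsep : ∀ p : Nat.Primes, ∃ ρ : R, IsSeparable F ρ ∧
      (p : ℕ) ^ k p ∣ Module.finrank F (Algebra.adjoin F {ρ}) := fun p => by
    obtain ⟨ρ, h1, h2⟩ := exists_separable_of_isComponent (hcomp p)
    exact ⟨ρ, h1, h2.symm.dvd⟩
  refine ⟨fun Y => ?_, k, ⨆ p, A p, isCentral_of_centralizer_eq_bot hcent,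
    ⟨A, fun p => ⟨isFDCentralDivision_of_isComponent (hcomp p), (hcomp p).finrank_eq⟩,
      nonempty_algEquiv_algTensor hsys⟩, fun S hS => ?_, fun p => ⟨⟨?_, ?_⟩, hsep p⟩, hcent,
    fun h => ?_⟩
  · have := hR Y
    obtain ⟨Θ, h1, h2, h3⟩ := exists_le_cen_eq_bot hR hv hsys (Algebra.adjoin F (Y : Set R))
    exact ⟨Θ, Algebra.subset_adjoin.trans h1, h2, isCentral_iff_cen_eq_bot.2 h3⟩
  · obtain ⟨π, ⟨f⟩⟩ := exists_algHom_sup hR hv hsys S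
    let _ : DivisionRing S := divisionRingSubalgebra S
    let g : S →ₐ[F] (⨆ p, A p : Subalgebra F R) := (Subalgebra.inclusion (hsup π)).comp f
    exact ⟨g, g.toRingHom.injective⟩
  · obtain ⟨ρ, -, h⟩ := hsep p
    exact ⟨ρ, h⟩
  · rintro n ⟨ρ, hn⟩
    have := hR.finiteDimensional_adjoin_singleton ρ
    have : Fact (p : ℕ).Prime := ⟨p.2⟩
    obtain ⟨Θ, h1, h2, h3⟩ := exists_le_cen_eq_bot hR hv hsys (Algebra.adjoin F {ρ})
    -- The square of the degree of an element divides the dimension of a central algebra around it;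
    -- so `2 * n ≤ 2 * k p`.
    have h4 : (p : ℕ) ^ (n * 2) ∣ Module.finrank F Θ := by
      rw [pow_mul]
      exact (pow_dvd_pow_of_dvd hn 2).trans
        (finrank_adjoin_sq_dvd h3 (h1 (Algebra.self_mem_adjoin_singleton F ρ)))
    have h5 := (padicValNat_dvd_iff_le (p := p) Module.finrank_pos.ne').1 h4
    have h6 := hv p Θ h2
    omega
  -- The absorbed sequence spans `R`, so the components generate everything.
  · have htop : (⨆ p, A p : Subalgebra F R) = ⊤ := by
      refine Algebra.toSubmodule_eq_top.1 (top_le_iff.1 ((hx h).ge.trans (Submodule.span_le.2 ?_)))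
      rintro _ ⟨n, rfl⟩
      obtain ⟨π, hπ⟩ := hmem n
      exact hsup π hπ
    rw [htop]
    exact ⟨Subalgebra.topEquiv.symm⟩
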